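/- \textbf{Theorem (Additivity).} Let $k$ be a field and let $Sm/k$ be the category of smooth separated schemes of finite type over $k$. For any $Y_1,Y_2\in Sm/k$ the map of simplicial presheaves on $Sm/k$ $$\phi: C_*Fr(-,Y_1\sqcup Y_2)\longrightarrow C_*Fr(-,Y_1)\times C_*Fr(-,Y_2),$$ whose two components are induced by composition with the explicit framed correspondences of level zero $\mathrm{id}\sqcup\emptyset: Y_1\sqcup Y_2\to Y_1$ and $\emptyset\sqcup\mathrm{id}: Y_1\sqcup Y_2\to Y_2$, is a schemewise weak equivalence; that is, for every $X\in Sm/k$ the map of simplicial sets $$Fr(X\times\Delta^\bullet,Y_1\sqcup Y_2)\to Fr(X\times\Delta^\bullet,Y_1)\times Fr(X\times\Delta^\bullet,Y_2)$$ is a weak homotopy equivalence. Here the notation is as follows. An \emph{explicit framed correspondence} $\Phi=(U,\varphi,g)$ of level $n\ge 0$ from $X$ to $Y$ (schemes over $k$) consists of a closed subset $Z\subset\mathbb A^n_X$ finite over $X$ (its \emph{support}), an étale neighbourhood $p:U\to\mathbb A^n_X$ of $Z$ (an étale morphism that is an isomorphism over $Z$ with its reduced structure), regular functions $\varphi_1,\dots,\varphi_n$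 on $U$ whose common zero locus is $p^{-1}(Z)\cong Z$ and none of whose zero loci contains a generic point of a fibre of $U\to X$, and a $k$-morphism $g:U\to Y$. Two explicit framed correspondences $(U,\varphi,g)$, $(U',\varphi',g')$ of level $n$ are \emph{equivalent} if they have the same support $Z$ and if on some open neighbourhood of $Z$ in $U\times_{\mathbb A^n_X}U'$ the pullbacks of $\varphi,\varphi'$ agree and the pullbacks of $g,g'$ agree; $Fr_n(X,Y)$ is the set of equivalence classes. For $f:X'\to X$ one has $f^*(U,\varphi,g)=(U\times_XX',\varphi\circ pr,g\circ pr)$. The composition of $(U,\varphi,g)$ of level $n$ from $X$ to $Y$ with $(V,\psi,h)$ of level $m$ from $Y$ to $Y'$ is the correspondence $(U\times_YV,(\varphi\circ pr_U,\psi\circ pr_V),h\circ pr_V)$ of level $n+m$ from $X$ to $Y'$. Let $\sigma_Y=(\mathbb A^1_Y,t,pr_Y)$, of level one from $Y$ to $Y$ with support $0\times Y$, and let $Fr(X,Y)$ be the colimit of $Fr_0(X,Y)\to Fr_1(X,Y)\to Fr_2(X,Y)\to\cdots$ along $\Phi\mapsto\sigma_Y\circ\Phi$. The correspondence $\mathrm{id}\sqcup\emptyset:Y_1\sqcup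 Y_2\to Y_1$ of level zero has support and étale neighbourhood $U=Y_1\subset Y_1\sqcup Y_2$ and $g=\mathrm{id}_{Y_1}$, and $\emptyset\sqcup\mathrm{id}$ is defined in the same way with $Y_2$. Finally $C_*Fr(-,Y)$ is the simplicial presheaf $X\mapsto Fr(X\times\Delta^\bullet,Y)$ on $Sm/k$, where $\Delta^\bullet$ is the standard cosimplicial $k$-scheme, $\Delta^n=\operatorname{Spec}k[x_0,\dots,x_n]/(x_0+\cdots+x_n-1)$. -/

import Mathlib

open CategoryTheory Limits AlgebraicGeometry Opposite TopologicalSpace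

universe u

noncomputable section

namespace Framed

/-- The affine space `𝔸ⁿ_X`. -/
abbrev Aff (n : ℕ) (X : Scheme.{u}) : Scheme.{u} := AffineSpace (ULift.{u} (Fin n)) X

/-- The projection `𝔸ⁿ_X ⟶ X`. -/
abbrev Aff.proj (n : ℕ) (X : Scheme.{u}) : Aff n X ⟶ X := Aff n X ↘ X

/-- The `i`-th coordinate function on `𝔸ⁿ_X`. -/
abbrev Aff.coord {n : ℕ} (X : Scheme.{u}) (i : Fin n) : Γ(Aff n X, ⊤) :=
  AffineSpace.coord X (ULift.up i)

/-- The morphism `𝔸ⁿ_X ⟶ 𝔸ⁿ_Y` induced by `f : X ⟶ Y`. -/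
abbrev Aff.map (n : ℕ) {X Y : Scheme.{u}} (f : X ⟶ Y) : Aff n X ⟶ Aff n Y :=
  AffineSpace.map (ULift.{u} (Fin n)) f

/-- The morphism `U ⟶ 𝔸ⁿ_X` with components `f : U ⟶ X` and `v₁, …, vₙ ∈ Γ(U, 𝒪)`. -/
abbrev Aff.lift {n : ℕ} {U X : Scheme.{u}} (f : U ⟶ X) (v : Fin n → Γ(U, ⊤)) : U ⟶ Aff n X :=
  AffineSpace.homOfVector f (fun i => v i.down)

/-- The pullback of a global function along a morphism. -/
abbrev pb {U V : Scheme.{u}} (f : U ⟶ V) (s : Γ(V, ⊤)) : Γ(U, ⊤) := f.appTop s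

lemma pb_comp {U V W : Scheme.{u}} (f : U ⟶ V) (g : V ⟶ W) (s : Γ(W, ⊤)) :
    pb (f ≫ g) s = pb f (pb g s) := by
  simp only [pb, Scheme.Hom.comp_appTop, CommRingCat.comp_apply]

lemma mem_basicOpen_pb {U V : Scheme.{u}} (f : U ⟶ V) (s : Γ(V, ⊤)) (u : U) :
    u ∈ U.basicOpen (pb f s) ↔ f u ∈ V.basicOpen s := by
  have := Scheme.preimage_basicOpen_top f s
  rw [pb, ← this]; rfl

lemma Aff.hom_ext {n : ℕ} {U X : Scheme.{u}} {a b : U ⟶ Aff n X}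
    (h : a ≫ Aff.proj n X = b ≫ Aff.proj n X)
    (h' : ∀ i, pb a (Aff.coord X i) = pb b (Aff.coord X i)) : a = b :=
  AffineSpace.hom_ext h (fun i => h' i.down)

@[simp] lemma Aff.lift_proj {n : ℕ} {U X : Scheme.{u}} (f : U ⟶ X) (v : Fin n → Γ(U, ⊤)) :
    Aff.lift f v ≫ Aff.proj n X = f := by simp

lemma Aff.lift_proj_assoc {n : ℕ} {U X T : Scheme.{u}} (f : U ⟶ X) (v : Fin n → Γ(U, ⊤))
    (h : X ⟶ T) : Aff.lift f v ≫ Aff.proj n X ≫ h = f ≫ h := by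
  rw [← Category.assoc, Aff.lift_proj]

@[simp] lemma Aff.pb_lift_coord {n : ℕ} {U X : Scheme.{u}} (f : U ⟶ X) (v : Fin n → Γ(U, ⊤))
    (i : Fin n) : pb (Aff.lift f v) (Aff.coord X i) = v i := by
  simp [pb, Aff.lift, Aff.coord]

/-- The closed subset `Z` with its reduced closed subscheme structure. -/
abbrev red {W : Scheme.{u}} (Z : Closeds W) : Scheme.{u} :=
  (Scheme.IdealSheafData.vanishingIdeal Z).subscheme

/-- The inclusion of the reduced closed subscheme with underlying set `Z`. -/
abbrev redι {W : Scheme.{u}} (Z : Closeds W) : red Z ⟶ W :=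
  (Scheme.IdealSheafData.vanishingIdeal Z).subschemeι

/-- `u` is a generic point of the fibre of `f : U ⟶ X` through `u` (i.e. of one of its
irreducible components): every point of this fibre which specializes to `u` equals `u`. -/
def IsGenericInFiber {U X : Scheme.{u}} (f : U ⟶ X) (u : U) : Prop :=
  ∀ v : U, f v = f u → v ⤳ u → v = u

lemma range_redι {W : Scheme.{u}} (Z : Closeds W) : Set.range (redι Z) = Z := by
  simp [redι]

section aux
variable {U W T X : Scheme.{u}}

lemma exists_red_lift (i : T ⟶ W) [IsClosedImmersion i] (Z : Closeds W)
    (hZ : (Z : Set W) = Set.range i) :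
    ∃ l : red Z ⟶ T, l ≫ i = redι Z := by
  have H : i.ker ≤ (redι Z).ker := by
    simp only [redι, Scheme.IdealSheafData.ker_subschemeι]
    rw [← Scheme.IdealSheafData.le_support_iff_le_vanishingIdeal]
    intro x hx
    have : x ∈ (Z : Set W) := hx
    rw [hZ] at this
    rw [← SetLike.mem_coe, Scheme.Hom.support_ker]
    exact subset_closure this
  exact ⟨_, IsClosedImmersion.lift_fac i (redι Z) H⟩

lemma red_finite (i : T ⟶ W) [IsClosedImmersion i] (Z : Closeds W)
    (hZ : (Z : Set W) = Set.range i) (π : W ⟶ X) [IsFinite (i ≫ π)] :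
    IsFinite (redι Z ≫ π) := by
  obtain ⟨l, hl⟩ := exists_red_lift i Z hZ
  have : IsClosedImmersion (l ≫ i) := by rw [hl]; infer_instance
  have : IsClosedImmersion l := .of_comp l i
  rw [← hl, Category.assoc]
  infer_instance

lemma isPullback_section {s : T ⟶ U} {p : U ⟶ W} {i : T ⟶ W} [Mono i] (h : s ≫ p = i)
    (H : ∀ {P : Scheme.{u}} (a : P ⟶ U) (t : P ⟶ T), a ≫ p = t ≫ i → a = t ≫ s) :
    IsPullback s (𝟙 T) p i := by
  refine ⟨⟨by simp [h]⟩, ⟨PullbackCone.IsLimit.mk _ (fun c => c.snd) (fun c => ?_) (fun c => ?_) ?_⟩⟩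
  · exact (H c.fst c.snd c.condition).symm
  · simp
  · intro c m _ h2; simpa using h2

lemma isPullback_section_elim {s : T ⟶ U} {p : U ⟶ W} {i : T ⟶ W}
    (h : IsPullback s (𝟙 T) p i) {P : Scheme.{u}} (a : P ⟶ U) (t : P ⟶ T)
    (e : a ≫ p = t ≫ i) : a = t ≫ s := by
  have h1 := h.lift_fst a t e
  have h2 := h.lift_snd a t e
  rw [Category.comp_id] at h2
  rw [← h1, h2]

lemma red_nbhd {s : T ⟶ U} {p : U ⟶ W} {i : T ⟶ W} [IsClosedImmersion i]
    (h : IsPullback s (𝟙 T) p i) (Z : Closeds W) (hZ : (Z : Set W) = Set.range i) :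
    IsIso (pullback.snd p (redι Z)) := by
  obtain ⟨l, hl⟩ := exists_red_lift i Z hZ
  have h1 : IsPullback (l ≫ s) (𝟙 (red Z)) p (redι Z) := by
    apply isPullback_section
    · rw [Category.assoc, h.w, Category.id_comp, hl]
    · intro P a t e
      rw [← Category.assoc]
      apply isPullback_section_elim h
      rw [e, Category.assoc, hl]
  have : pullback.snd p (redι Z) = (h1.isoPullback).inv := by
    rw [← h1.isoPullback_inv_snd, Category.comp_id]
  rw [this]; infer_instance

lemma exists_section {p : U ⟶ W} {Z : Closeds W} (h : IsIso (pullback.snd p (redι Z))) :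
    ∃ s : red Z ⟶ U, IsPullback s (𝟙 (red Z)) p (redι Z) :=
  ⟨inv (pullback.snd p (redι Z)) ≫ pullback.fst p (redι Z), by
    refine IsPullback.of_iso_pullback ⟨?_⟩ (asIso (pullback.snd p (redι Z))).symm ?_ ?_
    · rw [Category.assoc, pullback.condition, IsIso.inv_hom_id_assoc, Category.id_comp]
    · rfl
    · exact IsIso.inv_hom_id _⟩

lemma range_section {s : T ⟶ U} {p : U ⟶ W} {i : T ⟶ W} (h : IsPullback s (𝟙 T) p i) (u : U) :
    p u ∈ Set.range i ↔ u ∈ Set.range s := by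
  constructor
  · rintro ⟨t, ht⟩
    obtain ⟨x, hx, -⟩ := Scheme.Pullback.exists_preimage_pullback u t ht.symm
    refine ⟨h.isoPullback.inv x, ?_⟩
    rw [← Scheme.Hom.comp_apply, h.isoPullback_inv_fst]; exact hx
  · rintro ⟨t, rfl⟩
    refine ⟨t, ?_⟩
    rw [← Scheme.Hom.comp_apply, h.w, Category.id_comp]

end aux

lemma exists_fiber_map {W U V Y : Scheme.{u}} {fst : W ⟶ U} {snd : W ⟶ V} {g : U ⟶ Y}
    {q : V ⟶ Y} (h : IsPullback fst snd g q) (y : U) :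
    ∃ F : fst.fiber y ⟶ q.fiber (g y), Flat F ∧ F ≫ q.fiberι (g y) = fst.fiberι y ≫ snd :=
  ⟨_, MorphismProperty.of_isPullback
    (isPullback_fiberToSpecResidueField_of_isPullback h.flip y).flip inferInstance,
    pullback.lift_fst _ _ _⟩

/-- Generizations inside a fibre lift along base change. -/
lemma exists_lift_generization {W U V Y : Scheme.{u}} {fst : W ⟶ U} {snd : W ⟶ V} {g : U ⟶ Y}
    {q : V ⟶ Y} (h : IsPullback fst snd g q) (w : W) (v' : V) (hv : q v' = q (snd w))
    (hs : v' ⤳ snd w) : ∃ w' : W, w' ⤳ w ∧ fst w' = fst w ∧ snd w' = v' := by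
  obtain ⟨F, hF, hFι⟩ := exists_fiber_map h (fst w)
  have hgm := Flat.generalizingMap F
  have hqw : q (snd w) = g (fst w) := by
    rw [← Scheme.Hom.comp_apply, ← h.w, Scheme.Hom.comp_apply]
  obtain ⟨v0, hv0⟩ : ∃ v0, q.fiberι (g (fst w)) v0 = v' :=
    ⟨_, Scheme.Hom.fiberι_fiberHomeo_symm q (g (fst w)) ⟨v', hv.trans hqw⟩⟩
  obtain ⟨w0, hw0⟩ : ∃ w0, fst.fiberι (fst w) w0 = w := ⟨_, Scheme.Hom.fiberι_asFiber fst w⟩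
  have key : ∀ z, q.fiberι (g (fst w)) (F z) = snd (fst.fiberι (fst w) z) := fun z => by
    rw [← Scheme.Hom.comp_apply, hFι, Scheme.Hom.comp_apply]
  have hsp : v0 ⤳ F w0 := by
    rw [← (q.fiberι (g (fst w))).isEmbedding.isInducing.specializes_iff, key, hw0, hv0]
    exact hs
  obtain ⟨w1, hw1, hw1'⟩ := hgm hsp
  refine ⟨fst.fiberι (fst w) w1, ?_, ?_, ?_⟩
  · have := hw1.map (fst.fiberι (fst w)).continuous
    rwa [hw0] at this
  · have : fst.fiberι (fst w) w1 ∈ Set.range (fst.fiberι (fst w)) := ⟨_, rfl⟩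
    rw [Scheme.Hom.range_fiberι] at this
    exact this
  · rw [← key, hw1', hv0]

/-- An explicit framed correspondence of level `n` from `X` to `Y`, for schemes `X`, `Y` over a
base scheme `S`. -/
structure ExplicitCorr {S : Scheme.{u}} (n : ℕ) (X Y : Over S) where
  /-- the support, a closed subset of `𝔸ⁿ_X` -/
  Z : Closeds (Aff n X.left)
  /-- the support is finite over `X` -/
  finite : IsFinite (redι Z ≫ Aff.proj n X.left)
  /-- the étale neighbourhood of the support -/
  U : Scheme.{u}
  /-- the structure map of the étale neighbourhood -/
  p : U ⟶ Aff n X.left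
  etale : Etale p
  /-- `p` is an isomorphism over the support -/
  nbhd : IsIso (pullback.snd p (redι Z))
  /-- the framing functions -/
  φ : Fin n → Γ(U, ⊤)
  /-- the common zero locus of the framing functions is the support (viewed in `U`) -/
  framing : ∀ u : U, (∀ i, u ∉ U.basicOpen (φ i)) ↔ p u ∈ Z
  /-- no `φᵢ` vanishes at a generic point of a fibre of `U ⟶ X` -/
  generic : ∀ u : U, IsGenericInFiber (p ≫ Aff.proj n X.left) u → ∀ i, u ∈ U.basicOpen (φ i)
  /-- the morphism to the target -/
  g : U ⟶ Y.left
  /-- `g` is a morphism over `S` -/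
  w : g ≫ Y.hom = (p ≫ Aff.proj n X.left) ≫ X.hom

attribute [instance] ExplicitCorr.etale ExplicitCorr.nbhd ExplicitCorr.finite

namespace ExplicitCorr

variable {S : Scheme.{u}} {n m : ℕ} {X X' X'' Y Y' : Over S}

/-- The structure morphism `U ⟶ X`. -/
abbrev toX (Φ : ExplicitCorr n X Y) : Φ.U ⟶ X.left := Φ.p ≫ Aff.proj n X.left

/-- Constructor: the support is given as the image of a closed immersion `i : T ⟶ 𝔸ⁿ_X` with `T`
finite over `X`, together with a section `s : T ⟶ U` identifying `T` with its preimage in `U`. -/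
def ofSection {T U : Scheme.{u}} (i : T ⟶ Aff n X.left) (p : U ⟶ Aff n X.left) (s : T ⟶ U)
    (hi : IsClosedImmersion i) (hf : IsFinite (i ≫ Aff.proj n X.left)) (hp : Etale p)
    (hs : IsPullback s (𝟙 T) p i) (φ : Fin n → Γ(U, ⊤))
    (framing : ∀ u : U, (∀ i, u ∉ U.basicOpen (φ i)) ↔ u ∈ Set.range s)
    (generic : ∀ u : U, IsGenericInFiber (p ≫ Aff.proj n X.left) u →
      ∀ i, u ∈ U.basicOpen (φ i))
    (g : U ⟶ Y.left) (w : g ≫ Y.hom = (p ≫ Aff.proj n X.left) ≫ X.hom) :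
    ExplicitCorr n X Y where
  Z := ⟨Set.range i, i.isClosedEmbedding.isClosed_range⟩
  finite := red_finite i _ rfl _
  U := U
  p := p
  etale := hp
  nbhd := red_nbhd hs _ rfl
  φ := φ
  framing u := (framing u).trans (range_section hs u).symm
  generic := generic
  g := g
  w := w

lemma exists_sec (Φ : ExplicitCorr n X Y) :
    ∃ s : red Φ.Z ⟶ Φ.U, IsPullback s (𝟙 (red Φ.Z)) Φ.p (redι Φ.Z) :=
  exists_section Φ.nbhd

/-- The inclusion of the support into the étale neighbourhood. -/
def sec (Φ : ExplicitCorr n X Y) : red Φ.Z ⟶ Φ.U := Φ.exists_sec.choose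

lemma sec_isPullback (Φ : ExplicitCorr n X Y) :
    IsPullback Φ.sec (𝟙 (red Φ.Z)) Φ.p (redι Φ.Z) := Φ.exists_sec.choose_spec

lemma sec_p (Φ : ExplicitCorr n X Y) : Φ.sec ≫ Φ.p = redι Φ.Z := by
  rw [Φ.sec_isPullback.w, Category.id_comp]

lemma mem_range_sec (Φ : ExplicitCorr n X Y) (u : Φ.U) : u ∈ Set.range Φ.sec ↔ Φ.p u ∈ Φ.Z := by
  rw [← range_section Φ.sec_isPullback, range_redι]; rfl

lemma framing' (Φ : ExplicitCorr n X Y) (u : Φ.U) :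
    (∀ i, u ∉ Φ.U.basicOpen (Φ.φ i)) ↔ u ∈ Set.range Φ.sec := by
  rw [Φ.mem_range_sec, Φ.framing]

/-- Equivalence of explicit framed correspondences: they have the same support `Z`, and the
framings and the maps to `Y` agree on an open neighbourhood `V` of `Z` in the fibre product of the
étale neighbourhoods. -/
def Rel (Φ Ψ : ExplicitCorr n X Y) : Prop :=
  Φ.Z = Ψ.Z ∧ ∃ V : (pullback Φ.p Ψ.p).Opens,
    (∀ t : ↥(pullback Φ.p Ψ.p), (pullback.fst Φ.p Ψ.p ≫ Φ.p) t ∈ Φ.Z → t ∈ V) ∧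
    (V.ι ≫ pullback.fst Φ.p Ψ.p) ≫ Φ.g = (V.ι ≫ pullback.snd Φ.p Ψ.p) ≫ Ψ.g ∧
    ∀ i, pb (V.ι ≫ pullback.fst Φ.p Ψ.p) (Φ.φ i) = pb (V.ι ≫ pullback.snd Φ.p Ψ.p) (Ψ.φ i)

lemma pb_injective {U V : Scheme.{u}} (f : U ⟶ V) [Epi f] {s t : Γ(V, ⊤)} (h : pb f s = pb f t) :
    s = t := by
  have : Aff.lift (n := 1) (𝟙 V) (fun _ => s) = Aff.lift (𝟙 V) (fun _ => t) := by
    rw [← cancel_epi f]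
    apply Aff.hom_ext
    · simp
    · intro i
      rw [pb_comp, pb_comp, Aff.pb_lift_coord, Aff.pb_lift_coord, h]
  have h2 := congrArg (fun F => pb F (Aff.coord V 0)) this
  simpa only [Aff.pb_lift_coord] using h2

lemma p_sec_inj (Φ : ExplicitCorr n X Y) {u v : Φ.U} (hu : Φ.p u ∈ Φ.Z) (h : Φ.p u = Φ.p v) :
    u = v := by
  obtain ⟨t, rfl⟩ := (Φ.mem_range_sec u).2 hu
  obtain ⟨t', rfl⟩ := (Φ.mem_range_sec v).2 (h ▸ hu)
  rw [← Scheme.Hom.comp_apply, ← Scheme.Hom.comp_apply, Φ.sec_p] at h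
  rw [(redι Φ.Z).isClosedEmbedding.injective h]

lemma exists_point (Φ : ExplicitCorr n X Y) {z} (hz : z ∈ Φ.Z) : ∃ u : Φ.U, Φ.p u = z := by
  have : z ∈ Set.range (redι Φ.Z) := by rw [range_redι]; exact hz
  obtain ⟨t, rfl⟩ := this
  exact ⟨Φ.sec t, by rw [← Scheme.Hom.comp_apply, Φ.sec_p]⟩

lemma eqToHom_redι {W : Scheme.{u}} {Z Z' : Closeds W} (h : Z = Z') :
    eqToHom (by rw [h]) ≫ redι Z' = redι Z := by
  subst h; simp

/-- Points of `U ×_{𝔸ⁿ} U'` over the support are determined by their image in `𝔸ⁿ`. -/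
lemma point_unique (Φ Ψ : ExplicitCorr n X Y) (hZ : Φ.Z = Ψ.Z) (t t' : ↥(pullback Φ.p Ψ.p))
    (ht : (pullback.fst Φ.p Ψ.p ≫ Φ.p) t ∈ Φ.Z)
    (h : (pullback.fst Φ.p Ψ.p ≫ Φ.p) t = (pullback.fst Φ.p Ψ.p ≫ Φ.p) t') : t = t' := by
  have h1 := h ▸ ht
  -- the map `red Z ⟶ U ×_{𝔸ⁿ} U'` given by the two sections
  have hw : Φ.sec ≫ Φ.p = (eqToHom (by rw [hZ]) ≫ Ψ.sec) ≫ Ψ.p := by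
    rw [Category.assoc, Φ.sec_p, Ψ.sec_p, eqToHom_redι hZ]
  have H : IsPullback (pullback.lift _ _ hw) (𝟙 _) (pullback.fst Φ.p Ψ.p ≫ Φ.p) (redι Φ.Z) := by
    apply isPullback_section
    · rw [← Category.assoc, pullback.lift_fst, Φ.sec_p]
    · intro P a t e
      apply pullback.hom_ext
      · rw [Category.assoc, pullback.lift_fst]
        exact isPullback_section_elim Φ.sec_isPullback _ _ (by rw [Category.assoc, e])
      · rw [Category.assoc, pullback.lift_snd, ← Category.assoc]
        apply isPullback_section_elim Ψ.sec_isPullback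
        rw [Category.assoc, ← pullback.condition, e, Category.assoc, eqToHom_redι hZ]
  obtain ⟨x, rfl⟩ := (range_section H t).1 (by rw [range_redι]; exact ht)
  obtain ⟨x', rfl⟩ := (range_section H t').1 (by rw [range_redι]; exact h1)
  rw [← Scheme.Hom.comp_apply, ← Scheme.Hom.comp_apply, H.w, Category.id_comp] at h
  rw [(redι Φ.Z).isClosedEmbedding.injective h]

/-- A criterion for equivalence: it suffices to have agreement on a common étale refinement. -/
lemma Rel.of {Φ Ψ : ExplicitCorr n X Y} {V : Scheme.{u}} (a : V ⟶ Φ.U) (b : V ⟶ Ψ.U)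
    (ha : Etale a) (comm : a ≫ Φ.p = b ≫ Ψ.p) (hg : a ≫ Φ.g = b ≫ Ψ.g)
    (hφ : ∀ i, pb a (Φ.φ i) = pb b (Ψ.φ i))
    (sa : ∀ u, u ∈ Set.range Φ.sec → u ∈ Set.range a)
    (sb : ∀ u, u ∈ Set.range Ψ.sec → u ∈ Set.range b) : Rel Φ Ψ := by
  have hv : ∀ v, Φ.p (a v) ∈ Φ.Z ↔ Ψ.p (b v) ∈ Ψ.Z := fun v => by
    rw [← Φ.framing, ← Ψ.framing]
    refine forall_congr' fun i => ?_
    rw [← mem_basicOpen_pb, ← mem_basicOpen_pb, hφ]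
  have hv' : ∀ v, Φ.p (a v) = Ψ.p (b v) := fun v => by
    rw [← Scheme.Hom.comp_apply, comm, Scheme.Hom.comp_apply]
  have hZ : Φ.Z = Ψ.Z := by
    ext z
    constructor
    · intro hz
      obtain ⟨u, rfl⟩ := Φ.exists_point hz
      obtain ⟨v, rfl⟩ := sa u ((Φ.mem_range_sec u).2 hz)
      have := (hv v).1 hz
      rw [hv']; exact this
    · intro hz
      obtain ⟨u, rfl⟩ := Ψ.exists_point hz
      obtain ⟨v, rfl⟩ := sb u ((Ψ.mem_range_sec u).2 hz)
      have := (hv v).2 hz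
      rw [← hv']; exact this
  obtain ⟨e, he1, he2⟩ : ∃ e : V ⟶ pullback Φ.p Ψ.p, e ≫ pullback.fst Φ.p Ψ.p = a ∧
    e ≫ pullback.snd Φ.p Ψ.p = b := ⟨_, pullback.lift_fst _ _ comm, pullback.lift_snd _ _ comm⟩
  have he : Etale e := by
    have : Etale (e ≫ pullback.fst Φ.p Ψ.p) := by rw [he1]; exact ha
    exact Etale.of_comp e (pullback.fst Φ.p Ψ.p)
  let O : (pullback Φ.p Ψ.p).Opens := ⟨Set.range e, e.isOpenMap.isOpen_range⟩
  let e' : V ⟶ O := IsOpenImmersion.lift O.ι e (by simp [O])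
  have he' : e' ≫ O.ι = e := IsOpenImmersion.lift_fac _ _ _
  have : Etale e' := by
    have : Etale (e' ≫ O.ι) := by rw [he']; exact he
    exact Etale.of_comp e' O.ι
  have : Surjective e' := by
    refine ⟨fun x => ?_⟩
    obtain ⟨v, hv⟩ : O.ι x ∈ Set.range e := by
      have : O.ι x ∈ (Set.range O.ι) := ⟨_, rfl⟩
      rw [Scheme.Opens.range_ι] at this
      exact this
    refine ⟨v, O.ι.isOpenEmbedding.injective ?_⟩
    rw [← Scheme.Hom.comp_apply, he', hv]
  have : Epi e' := Flat.epi_of_flat_of_surjective e'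
  have h1 : e' ≫ O.ι ≫ pullback.fst Φ.p Ψ.p = a := by rw [← Category.assoc, he', he1]
  have h2 : e' ≫ O.ι ≫ pullback.snd Φ.p Ψ.p = b := by rw [← Category.assoc, he', he2]
  refine ⟨hZ, O, ?_, ?_, ?_⟩
  · intro t ht
    have hu := (Φ.mem_range_sec _).2 (by simpa using ht)
    obtain ⟨v, hv⟩ := sa _ hu
    refine ⟨v, (point_unique Φ Ψ hZ _ _ ht ?_).symm⟩
    rw [Scheme.Hom.comp_apply, ← hv, ← he1, Scheme.Hom.comp_apply, Scheme.Hom.comp_apply]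
  · rw [← cancel_epi e', ← Category.assoc, h1, hg, ← h2]
    simp only [Category.assoc]
  · intro i
    apply pb_injective e'
    rw [← pb_comp, ← pb_comp, h1, h2, hφ]

lemma Rel.elim {Φ Ψ : ExplicitCorr n X Y} (h : Rel Φ Ψ) :
    ∃ (V : Scheme.{u}) (a : V ⟶ Φ.U) (b : V ⟶ Ψ.U), Etale a ∧ Etale b ∧ a ≫ Φ.p = b ≫ Ψ.p ∧
      a ≫ Φ.g = b ≫ Ψ.g ∧ (∀ i, pb a (Φ.φ i) = pb b (Ψ.φ i)) ∧
      (∀ u, u ∈ Set.range Φ.sec → u ∈ Set.range a) ∧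
      (∀ u, u ∈ Set.range Ψ.sec → u ∈ Set.range b) := by
  obtain ⟨hZ, V, hV, hg, hφ⟩ := h
  refine ⟨V, V.ι ≫ pullback.fst _ _, V.ι ≫ pullback.snd _ _, inferInstance, inferInstance,
    by rw [Category.assoc, pullback.condition, Category.assoc], hg, hφ, ?_, ?_⟩
  · intro u hu
    have hu' := (Φ.mem_range_sec _).1 hu
    obtain ⟨u', hu''⟩ := Ψ.exists_point (hZ ▸ hu')
    obtain ⟨t, ht, -⟩ := Scheme.Pullback.exists_preimage_pullback u u' hu''.symm
    have : t ∈ V := hV t (by rw [Scheme.Hom.comp_apply, ht]; exact hu')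
    obtain ⟨t, rfl⟩ : t ∈ Set.range V.ι := by rw [Scheme.Opens.range_ι]; exact this
    exact ⟨t, by rw [Scheme.Hom.comp_apply, ht]⟩
  · intro u hu
    have hu' := (Ψ.mem_range_sec _).1 hu
    obtain ⟨u', hu''⟩ := Φ.exists_point (hZ ▸ hu')
    obtain ⟨t, ht, ht'⟩ := Scheme.Pullback.exists_preimage_pullback u' u hu''
    have : t ∈ V := hV t (by rw [Scheme.Hom.comp_apply, ht, hu'']; exact hZ ▸ hu')
    obtain ⟨t, rfl⟩ : t ∈ Set.range V.ι := by rw [Scheme.Opens.range_ι]; exact this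
    exact ⟨t, by rw [Scheme.Hom.comp_apply, ht']⟩

lemma rel_equivalence : Equivalence (Rel (n := n) (X := X) (Y := Y)) where
  refl Φ := Rel.of (𝟙 _) (𝟙 _) inferInstance rfl rfl (fun _ => rfl) (fun u _ => ⟨u, rfl⟩)
    (fun u _ => ⟨u, rfl⟩)
  symm h := by
    obtain ⟨V, a, b, ha, hb, h1, h2, h3, h4, h5⟩ := h.elim
    exact Rel.of b a hb h1.symm h2.symm (fun i => (h3 i).symm) h5 h4
  trans {Φ Ψ Θ} h h' := by
    obtain ⟨V, a, b, ha, hb, h1, h2, h3, h4, h5⟩ := h.elim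
    obtain ⟨V', a', b', ha', hb', h1', h2', h3', h4', h5'⟩ := h'.elim
    have hv : ∀ v, a v ∈ Set.range Φ.sec ↔ b v ∈ Set.range Ψ.sec := fun v => by
      rw [← Φ.framing', ← Ψ.framing']
      refine forall_congr' fun i => ?_
      rw [← mem_basicOpen_pb, ← mem_basicOpen_pb, h3]
    have hv' : ∀ v, a' v ∈ Set.range Ψ.sec ↔ b' v ∈ Set.range Θ.sec := fun v => by
      rw [← Ψ.framing', ← Θ.framing']
      refine forall_congr' fun i => ?_
      rw [← mem_basicOpen_pb, ← mem_basicOpen_pb, h3']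
    refine Rel.of (pullback.fst b a' ≫ a) (pullback.snd b a' ≫ b') inferInstance ?_ ?_ ?_ ?_ ?_
    · rw [Category.assoc, h1, pullback.condition_assoc, h1', Category.assoc]
    · rw [Category.assoc, h2, pullback.condition_assoc, h2', Category.assoc]
    · intro i
      rw [pb_comp, h3, ← pb_comp, pullback.condition, pb_comp, h3', ← pb_comp]
    · intro u hu
      obtain ⟨v, rfl⟩ := h4 u hu
      obtain ⟨v', hvv⟩ := h4' _ ((hv v).1 hu)
      obtain ⟨t, ht, -⟩ := Scheme.Pullback.exists_preimage_pullback v v' hvv.symm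
      exact ⟨t, by rw [Scheme.Hom.comp_apply, ht]⟩
    · intro u hu
      obtain ⟨v', rfl⟩ := h5' u hu
      obtain ⟨v, hvv⟩ := h5 _ ((hv' v').2 hu)
      obtain ⟨t, -, ht⟩ := Scheme.Pullback.exists_preimage_pullback v v' hvv
      exact ⟨t, by rw [Scheme.Hom.comp_apply, ht]⟩

end ExplicitCorr

lemma Aff.hom_ext_append {n m : ℕ} {U X : Scheme.{u}} {a b : U ⟶ Aff (n + m) X}
    (h : a ≫ Aff.proj _ X = b ≫ Aff.proj _ X)
    (h₁ : ∀ i, pb a (Aff.coord X (Fin.castAdd m i)) = pb b (Aff.coord X (Fin.castAdd m i)))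
    (h₂ : ∀ j, pb a (Aff.coord X (Fin.natAdd n j)) = pb b (Aff.coord X (Fin.natAdd n j))) :
    a = b :=
  Aff.hom_ext h (Fin.addCases h₁ h₂)

/-- The identification `𝔸ᵐ_{𝔸ⁿ_X} = 𝔸ⁿ⁺ᵐ_X`. -/
def Aff.sumIso (n m : ℕ) (X : Scheme.{u}) : Aff m (Aff n X) ≅ Aff (n + m) X where
  hom := Aff.lift (Aff.proj m _ ≫ Aff.proj n X)
    (Fin.append (fun i => pb (Aff.proj m (Aff n X)) (Aff.coord X i)) (fun j => Aff.coord _ j))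
  inv := Aff.lift (Aff.lift (Aff.proj _ X) (fun i => Aff.coord X (Fin.castAdd m i)))
    (fun j => Aff.coord X (Fin.natAdd n j))
  hom_inv_id := by
    apply Aff.hom_ext
    · apply Aff.hom_ext
      · simp
      · intro i
        rw [Category.assoc, Aff.lift_proj, pb_comp, Aff.pb_lift_coord, Aff.pb_lift_coord,
          Fin.append_left, Category.id_comp]
    · intro j
      rw [pb_comp, Aff.pb_lift_coord, Aff.pb_lift_coord, Fin.append_right]
      simp [pb]
  inv_hom_id := by
    apply Aff.hom_ext_append
    · rw [Category.assoc, Aff.lift_proj, Aff.lift_proj_assoc, Aff.lift_proj, Category.id_comp]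
    · intro i
      rw [pb_comp, Aff.pb_lift_coord, Fin.append_left, ← pb_comp, Aff.lift_proj,
        Aff.pb_lift_coord]
      simp [pb]
    · intro j
      rw [pb_comp, Aff.pb_lift_coord, Fin.append_right, Aff.pb_lift_coord]
      simp [pb]

lemma Aff.pb_sumIso_left (n m : ℕ) (X : Scheme.{u}) (i : Fin n) :
    pb (Aff.sumIso n m X).hom (Aff.coord X (Fin.castAdd m i)) =
      pb (Aff.proj m (Aff n X)) (Aff.coord X i) := by
  simp only [Aff.sumIso, Aff.pb_lift_coord, Fin.append_left]

lemma Aff.pb_sumIso_right (n m : ℕ) (X : Scheme.{u}) (j : Fin m) :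
    pb (Aff.sumIso n m X).hom (Aff.coord X (Fin.natAdd n j)) = Aff.coord _ j := by
  simp only [Aff.sumIso, Aff.pb_lift_coord, Fin.append_right]

@[simp] lemma Aff.pb_map_coord (n : ℕ) {X Y : Scheme.{u}} (f : X ⟶ Y) (i : Fin n) :
    pb (Aff.map n f) (Aff.coord Y i) = Aff.coord X i :=
  AffineSpace.map_appTop_coord f (ULift.up i)

lemma Aff.map_proj (n : ℕ) {X Y : Scheme.{u}} (f : X ⟶ Y) :
    Aff.map n f ≫ Aff.proj n Y = Aff.proj n X ≫ f :=
  AffineSpace.map_over f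

lemma Aff.map_proj_assoc (n : ℕ) {X Y T : Scheme.{u}} (f : X ⟶ Y) (h : Y ⟶ T) :
    Aff.map n f ≫ Aff.proj n Y ≫ h = Aff.proj n X ≫ f ≫ h := by
  rw [← Category.assoc, Aff.map_proj, Category.assoc]

lemma Aff.isPullback_map (n : ℕ) {X Y : Scheme.{u}} (f : X ⟶ Y) :
    IsPullback (Aff.map n f) (Aff.proj n X) (Aff.proj n Y) f :=
  AffineSpace.isPullback_map f

lemma Aff.flat_proj_Spec (n : ℕ) (R : CommRingCat.{u}) : Flat (Aff.proj n (Spec R)) := by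
  have h := AffineSpace.SpecIso_inv_over (n := ULift.{u} (Fin n)) R
  rw [Iso.inv_comp_eq] at h
  have : Flat (Spec.map (CommRingCat.ofHom (MvPolynomial.C (σ := ULift.{u} (Fin n)) (R := R)))) := by
    rw [Flat.SpecMap_iff]
    exact RingHom.flat_algebraMap_iff.2 inferInstance
  rw [Aff.proj, h]
  infer_instance

instance Aff.flat_proj (n : ℕ) (X : Scheme.{u}) : Flat (Aff.proj n X) := by
  have h := Aff.isPullback_map n (specULiftZIsTerminal.from X)
  have := Aff.flat_proj_Spec n (.of (ULift.{u} ℤ))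
  rw [← h.isoPullback_hom_snd]
  infer_instance

namespace ExplicitCorr

variable {S : Scheme.{u}} {n m : ℕ} {X X' X'' Y Y' : Over S}

section pull

variable (f : X' ⟶ X) (Φ : ExplicitCorr n X Y)

lemma pull_isPullback : IsPullback (pullback.fst Φ.p (Aff.map n f.left))
    (pullback.snd Φ.p (Aff.map n f.left) ≫ Aff.proj n X'.left) Φ.toX f.left :=
  (IsPullback.of_hasPullback _ _).paste_vert (Aff.isPullback_map n f.left)

/-- The inclusion of the inverse image of the support into the inverse image of `U`. -/
def pullS : pullback (redι Φ.Z) (Aff.map n f.left) ⟶ pullback Φ.p (Aff.map n f.left) :=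
  pullback.lift (pullback.fst _ _ ≫ Φ.sec) (pullback.snd _ _)
    (by rw [Category.assoc, Φ.sec_p, pullback.condition])

lemma pullS_isPullback : IsPullback (Φ.pullS f) (𝟙 _) (pullback.snd Φ.p (Aff.map n f.left))
    (pullback.snd (redι Φ.Z) (Aff.map n f.left)) := by
  apply isPullback_section
  · rw [pullS, pullback.lift_snd]
  · intro P a t e
    apply pullback.hom_ext
    · rw [Category.assoc, pullS, pullback.lift_fst, ← Category.assoc]
      apply isPullback_section_elim Φ.sec_isPullback
      rw [Category.assoc, pullback.condition, reassoc_of% e, Category.assoc,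
        pullback.condition]
    · rw [e, Category.assoc, pullS, pullback.lift_snd]

/-- The inverse image `f^*(Φ)` of an explicit correspondence `Φ` along `f : X' ⟶ X`. Its étale
neighbourhood is `U ×_{𝔸ⁿ_X} 𝔸ⁿ_{X'} = U ×_X X'`. -/
def pull : ExplicitCorr n X' Y :=
  ofSection (pullback.snd (redι Φ.Z) (Aff.map n f.left)) (pullback.snd Φ.p (Aff.map n f.left))
    (Φ.pullS f) inferInstance
    (MorphismProperty.of_isPullback (P := @IsFinite)
      ((IsPullback.of_hasPullback _ _).paste_vert (Aff.isPullback_map n f.left)) Φ.finite)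
    inferInstance
    (Φ.pullS_isPullback f) (fun i => pb (pullback.fst _ _) (Φ.φ i))
    (by
      intro u
      have h1 : (∀ i, u ∉ Scheme.basicOpen _ (pb (pullback.fst Φ.p (Aff.map n f.left)) (Φ.φ i))) ↔
          pullback.fst Φ.p (Aff.map n f.left) u ∈ Set.range Φ.sec := by
        rw [← Φ.framing']
        exact forall_congr' fun i => not_congr (mem_basicOpen_pb _ _ _)
      rw [h1]
      constructor
      · rintro ⟨t, ht⟩
        have : redι Φ.Z t = Aff.map n f.left (pullback.snd Φ.p (Aff.map n f.left) u) := by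
          rw [← Φ.sec_p, Scheme.Hom.comp_apply, ht, ← Scheme.Hom.comp_apply, pullback.condition,
            Scheme.Hom.comp_apply]
        obtain ⟨x, -, hx⟩ := Scheme.Pullback.exists_preimage_pullback t _ this
        exact (range_section (Φ.pullS_isPullback f) u).1 ⟨x, hx⟩
      · rintro ⟨t, rfl⟩
        rw [← Scheme.Hom.comp_apply, pullS, pullback.lift_fst, Scheme.Hom.comp_apply]
        exact ⟨_, rfl⟩)
    (by
      intro u hu i
      rw [mem_basicOpen_pb]
      apply Φ.generic
      intro v hv hs
      obtain ⟨w', h1, h2, h3⟩ := exists_lift_generization (Φ.pull_isPullback f).flip u v hv hs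
      rw [← h3, hu w' h2 h1])
    (pullback.fst _ _ ≫ Φ.g)
    (by rw [Category.assoc, Φ.w, ← Category.assoc, (Φ.pull_isPullback f).w, Category.assoc,
          Over.w f])

end pull

section comp

variable (Φ : ExplicitCorr n X Y) (Ψ : ExplicitCorr m Y Y')

/-- The étale neighbourhood `W = U ×_Y V` of the composition. -/
abbrev compU : Scheme.{u} := pullback Φ.g Ψ.toX

/-- The structure map `W ⟶ 𝔸ⁿ⁺ᵐ_X` of the composition. -/
def compP : compU Φ Ψ ⟶ Aff (n + m) X.left :=
  Aff.lift (pullback.fst _ _ ≫ Φ.toX)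
    (Fin.append (fun i => pb (pullback.fst _ _) (pb Φ.p (Aff.coord _ i)))
      (fun j => pb (pullback.snd _ _) (pb Ψ.p (Aff.coord _ j))))

lemma compP_proj : compP Φ Ψ ≫ Aff.proj _ _ = pullback.fst _ _ ≫ Φ.toX := Aff.lift_proj _ _

lemma pb_compP_left (i : Fin n) : pb (compP Φ Ψ) (Aff.coord _ (Fin.castAdd m i)) =
    pb (pullback.fst _ _) (pb Φ.p (Aff.coord _ i)) := by
  simp only [compP, Aff.pb_lift_coord, Fin.append_left]

lemma pb_compP_right (j : Fin m) : pb (compP Φ Ψ) (Aff.coord _ (Fin.natAdd n j)) =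
    pb (pullback.snd _ _) (pb Ψ.p (Aff.coord _ j)) := by
  simp only [compP, Aff.pb_lift_coord, Fin.append_right]

/-- The intermediate map `W ⟶ 𝔸ᵐ_U`, a base change of `V ⟶ 𝔸ᵐ_Y`. -/
def compA : compU Φ Ψ ⟶ Aff m Φ.U :=
  Aff.lift (pullback.fst _ _) (fun j => pb (pullback.snd _ _) (pb Ψ.p (Aff.coord _ j)))

lemma compA_isPullback : IsPullback (pullback.snd Φ.g Ψ.toX) (compA Φ Ψ) Ψ.p (Aff.map m Φ.g) := by
  refine IsPullback.of_bot (v₂₁ := Aff.proj m Φ.U) (v₂₂ := Aff.proj m Y.left) (h₃₁ := Φ.g) ?_ ?_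
    (Aff.isPullback_map m Φ.g)
  · rw [compA, Aff.lift_proj]
    exact (IsPullback.of_hasPullback Φ.g Ψ.toX).flip
  · apply Aff.hom_ext
    · rw [Category.assoc, Category.assoc, (Aff.isPullback_map m Φ.g).w, compA,
        Aff.lift_proj_assoc, pullback.condition]
    · intro j
      rw [pb_comp, pb_comp, Aff.pb_map_coord, compA, Aff.pb_lift_coord]

lemma compP_eq : compP Φ Ψ = compA Φ Ψ ≫ Aff.map m Φ.p ≫ (Aff.sumIso n m X.left).hom := by
  apply Aff.hom_ext_append
  · rw [compP_proj, Category.assoc, Category.assoc, Aff.sumIso, Aff.lift_proj, Aff.map_proj_assoc,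
      compA, Aff.lift_proj_assoc]
  · intro i
    rw [pb_compP_left, pb_comp, pb_comp, Aff.pb_sumIso_left, ← pb_comp (Aff.map m Φ.p),
      (Aff.isPullback_map m Φ.p).w, pb_comp, ← pb_comp (compA Φ Ψ), compA, Aff.lift_proj]
  · intro j
    rw [pb_compP_right, pb_comp, pb_comp, Aff.pb_sumIso_right, Aff.pb_map_coord, compA,
      Aff.pb_lift_coord]

instance compP_etale : Etale (compP Φ Ψ) := by
  have h1 : Etale (compA Φ Ψ) := MorphismProperty.of_isPullback (compA_isPullback Φ Ψ) Ψ.etale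
  have h2 : Etale (Aff.map m Φ.p) :=
    MorphismProperty.of_isPullback (Aff.isPullback_map m Φ.p).flip Φ.etale
  rw [compP_eq]
  infer_instance

/-- The inclusion `Z_U ×_Y Z_V ⟶ W`. -/
def compS : pullback (Φ.sec ≫ Φ.g) (redι Ψ.Z ≫ Aff.proj m Y.left) ⟶ compU Φ Ψ :=
  pullback.map _ _ _ _ Φ.sec Ψ.sec (𝟙 _) (by simp) (by
    rw [Category.comp_id, ← Category.assoc, Ψ.sec_p])

lemma compS_fst : compS Φ Ψ ≫ pullback.fst _ _ = pullback.fst _ _ ≫ Φ.sec :=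
  pullback.lift_fst _ _ _

lemma compS_snd : compS Φ Ψ ≫ pullback.snd _ _ = pullback.snd _ _ ≫ Ψ.sec :=
  pullback.lift_snd _ _ _

lemma range_compS : Set.range (compS Φ Ψ) =
    pullback.fst Φ.g Ψ.toX ⁻¹' Set.range Φ.sec ∩ pullback.snd Φ.g Ψ.toX ⁻¹' Set.range Ψ.sec := by
  unfold compS; exact Scheme.Pullback.range_map ..

/-- Two maps out of a test scheme, one into `W` and one into `Z_U ×_Y Z_V`, agree as soon as their
images in `𝔸ⁿ⁺ᵐ_X` agree. -/
lemma compS_unique {P : Scheme.{u}} (a : P ⟶ compU Φ Ψ)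
    (t : P ⟶ pullback (Φ.sec ≫ Φ.g) (redι Ψ.Z ≫ Aff.proj m Y.left))
    (e : a ≫ compP Φ Ψ = t ≫ compS Φ Ψ ≫ compP Φ Ψ) : a = t ≫ compS Φ Ψ := by
  have e0 : (a ≫ pullback.fst _ _) ≫ Φ.p = (t ≫ pullback.fst _ _) ≫ redι Φ.Z := by
    apply Aff.hom_ext
    · have := congrArg (· ≫ Aff.proj _ _) e
      simp only [Category.assoc, compP_proj] at this
      rw [← Category.assoc (compS Φ Ψ), compS_fst] at this
      simpa only [Category.assoc, ← Φ.sec_p] using this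
    · intro i
      have := congrArg (fun F => pb F (Aff.coord _ (Fin.castAdd m i))) e
      simp only [pb_comp _ (compP Φ Ψ), ← Category.assoc, pb_compP_left] at this
      rw [← pb_comp, ← pb_comp, ← pb_comp, ← pb_comp] at this
      simpa only [Category.assoc, ← Φ.sec_p, reassoc_of% (compS_fst Φ Ψ)] using this
  have e1 : a ≫ pullback.fst _ _ = t ≫ pullback.fst _ _ ≫ Φ.sec := by
    rw [← Category.assoc]
    exact isPullback_section_elim Φ.sec_isPullback _ _ e0
  have e2 : a ≫ pullback.snd _ _ = t ≫ pullback.snd _ _ ≫ Ψ.sec := by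
    rw [← Category.assoc]
    apply isPullback_section_elim Ψ.sec_isPullback
    apply Aff.hom_ext
    · have h1 : (a ≫ pullback.snd _ _) ≫ Ψ.toX = (a ≫ pullback.fst _ _) ≫ Φ.g := by
        rw [Category.assoc, Category.assoc, pullback.condition]
      have h2 : (t ≫ pullback.snd _ _) ≫ redι Ψ.Z ≫ Aff.proj _ _ =
          t ≫ pullback.fst _ _ ≫ Φ.sec ≫ Φ.g := by
        rw [pullback.condition, Category.assoc]
      rw [Category.assoc, h1, e1, Category.assoc (t ≫ _), h2]
      simp only [Category.assoc]
    · intro j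
      have := congrArg (fun F => pb F (Aff.coord _ (Fin.natAdd n j))) e
      simp only [pb_comp _ (compP Φ Ψ), ← Category.assoc, pb_compP_right] at this
      rw [← pb_comp, ← pb_comp, ← pb_comp, ← pb_comp] at this
      simpa only [Category.assoc, ← Ψ.sec_p, reassoc_of% (compS_snd Φ Ψ)] using this
  apply pullback.hom_ext
  · rw [e1, Category.assoc, compS_fst]
  · rw [e2, Category.assoc, compS_snd]

instance : Mono (compS Φ Ψ) := by
  have h1 : Mono (Φ.sec ≫ Φ.p) := by rw [Φ.sec_p]; infer_instance
  have h2 : Mono (Ψ.sec ≫ Ψ.p) := by rw [Ψ.sec_p]; infer_instance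
  have h1 : Mono Φ.sec := mono_of_mono _ Φ.p
  have h2 : Mono Ψ.sec := mono_of_mono _ Ψ.p
  constructor
  intro P a b e
  have e1 := congrArg (· ≫ pullback.fst _ _) e
  have e2 := congrArg (· ≫ pullback.snd _ _) e
  simp only [Category.assoc, compS_fst, compS_snd] at e1 e2
  simp only [← Category.assoc, cancel_mono] at e1 e2
  exact pullback.hom_ext e1 e2

instance : Mono (compS Φ Ψ ≫ compP Φ Ψ) := by
  constructor
  intro P a b e
  rw [← cancel_mono (compS Φ Ψ)]
  exact compS_unique Φ Ψ _ _ (by simpa only [Category.assoc] using e)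

instance compS_finite : IsFinite ((compS Φ Ψ ≫ compP Φ Ψ) ≫ Aff.proj _ X.left) := by
  have : (compS Φ Ψ ≫ compP Φ Ψ) ≫ Aff.proj _ X.left =
      pullback.fst _ _ ≫ (redι Φ.Z ≫ Aff.proj n X.left) := by
    rw [Category.assoc, compP_proj, ← Category.assoc, compS_fst, ← Φ.sec_p]
    simp only [Category.assoc]
  rw [this]
  infer_instance

instance : IsClosedImmersion (compS Φ Ψ ≫ compP Φ Ψ) := by
  rw [IsClosedImmersion.iff_isFinite_and_mono]
  exact ⟨IsFinite.of_comp _ (Aff.proj _ X.left), inferInstance⟩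

lemma comp_framing (w : compU Φ Ψ) :
    (∀ i, w ∉ (compU Φ Ψ).basicOpen (Fin.append (fun i => pb (pullback.fst _ _) (Φ.φ i))
      (fun j => pb (pullback.snd _ _) (Ψ.φ j)) i)) ↔ w ∈ Set.range (compS Φ Ψ) := by
  rw [range_compS, Set.mem_inter_iff, Set.mem_preimage, Set.mem_preimage, ← Φ.framing',
    ← Ψ.framing']
  constructor
  · intro h
    refine ⟨fun i => ?_, fun j => ?_⟩
    · have := h (Fin.castAdd m i)
      rwa [Fin.append_left, mem_basicOpen_pb] at this
    · have := h (Fin.natAdd n j)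
      rwa [Fin.append_right, mem_basicOpen_pb] at this
  · rintro ⟨h1, h2⟩ i
    refine Fin.addCases (fun i => ?_) (fun j => ?_) i
    · rw [Fin.append_left, mem_basicOpen_pb]; exact h1 i
    · rw [Fin.append_right, mem_basicOpen_pb]; exact h2 j

lemma comp_generic (w : compU Φ Ψ)
    (hw : IsGenericInFiber (compP Φ Ψ ≫ Aff.proj _ X.left) w) (i : Fin (n + m)) :
    w ∈ (compU Φ Ψ).basicOpen (Fin.append (fun i => pb (pullback.fst _ _) (Φ.φ i))
      (fun j => pb (pullback.snd _ _) (Ψ.φ j)) i) := by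
  rw [compP_proj] at hw
  refine Fin.addCases (fun i => ?_) (fun j => ?_) i
  · rw [Fin.append_left, mem_basicOpen_pb]
    apply Φ.generic
    intro u hu hs
    obtain ⟨w', h1, h2⟩ := Flat.generalizingMap (pullback.fst Φ.g Ψ.toX) hs
    rw [← h2, hw w' ?_ h1]
    rw [Scheme.Hom.comp_apply, h2, Scheme.Hom.comp_apply]
    exact hu
  · rw [Fin.append_right, mem_basicOpen_pb]
    apply Ψ.generic
    intro v hv hs
    obtain ⟨w', h1, h2, h3⟩ := exists_lift_generization (IsPullback.of_hasPullback Φ.g Ψ.toX) w v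
      hv hs
    rw [← h3, hw w' ?_ h1]
    rw [Scheme.Hom.comp_apply, h2, ← Scheme.Hom.comp_apply]

/-- The composition of explicit correspondences: `(U, φ, g)` followed by `(V, ψ, h)` is
`(U ×_Y V, (φ ∘ pr_U, ψ ∘ pr_V), h ∘ pr_V)`. -/
def comp : ExplicitCorr (n + m) X Y' :=
  ofSection (compS Φ Ψ ≫ compP Φ Ψ) (compP Φ Ψ) (compS Φ Ψ) inferInstance inferInstance
    inferInstance (isPullback_section rfl (compS_unique Φ Ψ))
    (Fin.append (fun i => pb (pullback.fst _ _) (Φ.φ i)) (fun j => pb (pullback.snd _ _) (Ψ.φ j)))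
    (comp_framing Φ Ψ) (comp_generic Φ Ψ) (pullback.snd _ _ ≫ Ψ.g)
    (by rw [Category.assoc, Ψ.w, compP_proj, ← Category.assoc, ← pullback.condition,
      Category.assoc, Φ.w]
        simp only [Category.assoc])

end comp
end ExplicitCorr

namespace ExplicitCorr

variable {S : Scheme.{u}} {n m : ℕ} {X X' X'' Y Y' Y'' : Over S}

section interface

variable (f : X' ⟶ X) (Φ : ExplicitCorr n X Y) (Ψ : ExplicitCorr m Y Y')

/-- The projection from the neighbourhood of `f^*(Φ)` to that of `Φ`. -/
def pullFst : (Φ.pull f).U ⟶ Φ.U := pullback.fst Φ.p (Aff.map n f.left)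

lemma pull_sq : IsPullback (Φ.pullFst f) (Φ.pull f).p Φ.p (Aff.map n f.left) :=
  IsPullback.of_hasPullback _ _

lemma pull_g : (Φ.pull f).g = Φ.pullFst f ≫ Φ.g := rfl

lemma pull_φ (i : Fin n) : (Φ.pull f).φ i = pb (Φ.pullFst f) (Φ.φ i) := rfl

lemma pull_toX_sq : IsPullback (Φ.pullFst f) (Φ.pull f).toX Φ.toX f.left :=
  (Φ.pull_sq f).paste_vert (Aff.isPullback_map n f.left)

/-- The projection from the neighbourhood of a composition to that of the first factor. -/
def compFst : (Φ.comp Ψ).U ⟶ Φ.U := pullback.fst Φ.g Ψ.toX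

/-- The projection from the neighbourhood of a composition to that of the second factor. -/
def compSnd : (Φ.comp Ψ).U ⟶ Ψ.U := pullback.snd Φ.g Ψ.toX

lemma comp_sq : IsPullback (Φ.compFst Ψ) (Φ.compSnd Ψ) Φ.g Ψ.toX :=
  IsPullback.of_hasPullback _ _

lemma comp_p_proj : (Φ.comp Ψ).p ≫ Aff.proj _ _ = Φ.compFst Ψ ≫ Φ.toX := compP_proj Φ Ψ

lemma comp_p_left (i : Fin n) : pb (Φ.comp Ψ).p (Aff.coord _ (Fin.castAdd m i)) =
    pb (Φ.compFst Ψ) (pb Φ.p (Aff.coord _ i)) := pb_compP_left Φ Ψ i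

lemma comp_p_right (j : Fin m) : pb (Φ.comp Ψ).p (Aff.coord _ (Fin.natAdd n j)) =
    pb (Φ.compSnd Ψ) (pb Ψ.p (Aff.coord _ j)) := pb_compP_right Φ Ψ j

lemma comp_g : (Φ.comp Ψ).g = Φ.compSnd Ψ ≫ Ψ.g := rfl

lemma comp_φ_left (i : Fin n) : (Φ.comp Ψ).φ (Fin.castAdd m i) = pb (Φ.compFst Ψ) (Φ.φ i) :=
  Fin.append_left (fun i => pb (Φ.compFst Ψ) (Φ.φ i)) (fun j => pb (Φ.compSnd Ψ) (Ψ.φ j)) i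

lemma comp_φ_right (j : Fin m) : (Φ.comp Ψ).φ (Fin.natAdd n j) = pb (Φ.compSnd Ψ) (Ψ.φ j) :=
  Fin.append_right (fun i => pb (Φ.compFst Ψ) (Φ.φ i)) (fun j => pb (Φ.compSnd Ψ) (Ψ.φ j)) j

lemma mem_range_sec_pull (u : (Φ.pull f).U) :
    u ∈ Set.range (Φ.pull f).sec ↔ Φ.pullFst f u ∈ Set.range Φ.sec := by
  rw [← framing', ← framing']
  exact forall_congr' fun i => not_congr (mem_basicOpen_pb _ _ _)

lemma mem_range_sec_comp (u : (Φ.comp Ψ).U) :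
    u ∈ Set.range (Φ.comp Ψ).sec ↔ Φ.compFst Ψ u ∈ Set.range Φ.sec ∧
      Φ.compSnd Ψ u ∈ Set.range Ψ.sec := by
  rw [← framing']
  exact (comp_framing Φ Ψ u).trans (by rw [range_compS]; rfl)

end interface

/-- A criterion for equivalence when one étale neighbourhood maps onto the other. -/
lemma Rel.of_hom {Φ Ψ : ExplicitCorr n X Y} (b : Φ.U ⟶ Ψ.U)
    (comm : Φ.p = b ≫ Ψ.p) (hg : Φ.g = b ≫ Ψ.g)
    (hφ : ∀ i, Φ.φ i = pb b (Ψ.φ i)) (sb : Function.Surjective b) : Rel Φ Ψ :=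
  Rel.of (𝟙 _) b inferInstance (by rw [Category.id_comp, comm]) (by rw [Category.id_comp, hg])
    (fun i => by rw [← hφ]; simp [pb]) (fun u _ => ⟨u, rfl⟩) (fun u _ => sb u)

lemma surjective_of_iso {U V : Scheme.{u}} (b : U ⟶ V) (c : V ⟶ U) (h : c ≫ b = 𝟙 V) :
    Function.Surjective b := fun v => ⟨c v, by
  rw [← Scheme.Hom.comp_apply, h]; rfl⟩

lemma exists_preimage {P A B C : Scheme.{u}} {fst : P ⟶ A} {snd : P ⟶ B} {f : A ⟶ C} {g : B ⟶ C}
    (h : IsPullback fst snd f g) (a : A) (b : B) (e : f a = g b) :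
    ∃ t : P, fst t = a ∧ snd t = b := by
  obtain ⟨t, h1, h2⟩ := Scheme.Pullback.exists_preimage_pullback a b e
  refine ⟨h.isoPullback.inv t, ?_, ?_⟩
  · rw [← Scheme.Hom.comp_apply, h.isoPullback_inv_fst, h1]
  · rw [← Scheme.Hom.comp_apply, h.isoPullback_inv_snd, h2]

lemma etale_trans {A B C : Scheme.{u}} (a : A ⟶ B) (b : B ⟶ C) (_ : Etale a) (_ : Etale b) :
    Etale (a ≫ b) := inferInstance

lemma Rel.pull (f : X' ⟶ X) {Φ Ψ : ExplicitCorr n X Y} (h : Rel Φ Ψ) :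
    Rel (Φ.pull f) (Ψ.pull f) := by
  obtain ⟨V, a, b, ha, hb, h1, h2, h3, h4, h5⟩ := h.elim
  have sqV := IsPullback.of_hasPullback (a ≫ Φ.p) (Aff.map n f.left)
  obtain ⟨A, A1, A2⟩ := (Φ.pull_sq f).exists_lift (pullback.fst (a ≫ Φ.p) (Aff.map n f.left) ≫ a)
    (pullback.snd _ _) (by rw [Category.assoc, sqV.w])
  obtain ⟨B, B1, B2⟩ := (Ψ.pull_sq f).exists_lift (pullback.fst (a ≫ Φ.p) (Aff.map n f.left) ≫ b)
    (pullback.snd _ _) (by rw [Category.assoc, ← h1, sqV.w])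
  have sA : IsPullback A (pullback.fst _ _) (Φ.pullFst f) a :=
    IsPullback.of_right (by rw [A2]; exact sqV.flip) A1 (Φ.pull_sq f).flip
  have sB : IsPullback B (pullback.fst _ _) (Ψ.pullFst f) b :=
    IsPullback.of_right (by rw [B2, ← h1]; exact sqV.flip) B1 (Ψ.pull_sq f).flip
  refine Rel.of A B (MorphismProperty.of_isPullback sA.flip ha) (A2.trans B2.symm) ?_ ?_ ?_ ?_
  · rw [pull_g, pull_g, ← Category.assoc, A1, Category.assoc, h2, ← Category.assoc, ← B1,
      Category.assoc]
  · intro i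
    rw [pull_φ, pull_φ, ← pb_comp, ← pb_comp, A1, B1, pb_comp, pb_comp, h3]
  · intro u hu
    obtain ⟨v, hv⟩ := h4 _ ((mem_range_sec_pull f Φ u).1 hu)
    obtain ⟨t, ht, -⟩ := exists_preimage sA u v hv.symm
    exact ⟨t, ht⟩
  · intro u hu
    obtain ⟨v, hv⟩ := h5 _ ((mem_range_sec_pull f Ψ u).1 hu)
    obtain ⟨t, ht, -⟩ := exists_preimage sB u v hv.symm
    exact ⟨t, ht⟩

/-- Étale maps to `Φ.U` and `Ψ.U` induce one to the neighbourhood of `Φ.comp Ψ`. -/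
lemma comp_cover (Φ : ExplicitCorr n X Y) (Ψ : ExplicitCorr m Y Y') {V V' W : Scheme.{u}}
    (a : V ⟶ Φ.U) (a' : V' ⟶ Ψ.U) {w : W ⟶ V} {w' : W ⟶ V'}
    (sq : IsPullback w w' (a ≫ Φ.g) (a' ≫ Ψ.toX)) (ha : Etale a) (ha' : Etale a')
    (h : ∀ u, u ∈ Set.range Φ.sec → u ∈ Set.range a)
    (h' : ∀ u, u ∈ Set.range Ψ.sec → u ∈ Set.range a') :
    ∃ A : W ⟶ (Φ.comp Ψ).U, A ≫ Φ.compFst Ψ = w ≫ a ∧ A ≫ Φ.compSnd Ψ = w' ≫ a' ∧ Etale A ∧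
      ∀ u, u ∈ Set.range (Φ.comp Ψ).sec → u ∈ Set.range A := by
  obtain ⟨Q, q, q', sq'⟩ : ∃ (Q : Scheme.{u}) (q : Q ⟶ Φ.U) (q' : Q ⟶ V'),
    IsPullback q q' Φ.g (a' ≫ Ψ.toX) := ⟨_, _, _, IsPullback.of_hasPullback _ _⟩
  obtain ⟨C, C1, C2⟩ := sq'.exists_lift (w ≫ a) w' (by rw [Category.assoc, sq.w])
  obtain ⟨D, D1, D2⟩ := (Φ.comp_sq Ψ).exists_lift q (q' ≫ a') (by rw [sq'.w, Category.assoc])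
  have i1 : IsPullback C w q a := IsPullback.of_right (by rw [C2]; exact sq.flip) C1 sq'.flip
  have i2 : IsPullback D q' (Φ.compSnd Ψ) a' :=
    IsPullback.of_right (by rw [D1]; exact sq') D2 (Φ.comp_sq Ψ)
  refine ⟨C ≫ D, by rw [Category.assoc, D1, C1],
    by rw [Category.assoc, D2, ← Category.assoc, C2],
    etale_trans _ _ (MorphismProperty.of_isPullback i1.flip ha)
      (MorphismProperty.of_isPullback i2.flip ha'), ?_⟩
  intro u hu
  obtain ⟨u1, u2⟩ := (mem_range_sec_comp Φ Ψ u).1 hu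
  obtain ⟨v, hv⟩ := h _ u1
  obtain ⟨v', hv'⟩ := h' _ u2
  obtain ⟨c, hc, -⟩ := exists_preimage i2 u v' hv'.symm
  obtain ⟨t, ht, -⟩ := exists_preimage i1 c v (by
    rw [hv, ← hc, ← Scheme.Hom.comp_apply, D1])
  exact ⟨t, by rw [Scheme.Hom.comp_apply, ht, hc]⟩

lemma Rel.comp {Φ Φ' : ExplicitCorr n X Y} {Ψ Ψ' : ExplicitCorr m Y Y'} (h : Rel Φ Φ')
    (h' : Rel Ψ Ψ') : Rel (Φ.comp Ψ) (Φ'.comp Ψ') := by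
  obtain ⟨V, a, b, ha, hb, h1, h2, h3, h4, h5⟩ := h.elim
  obtain ⟨V', a', b', ha', hb', h1', h2', h3', h4', h5'⟩ := h'.elim
  have e : a' ≫ Ψ.toX = b' ≫ Ψ'.toX := by rw [toX, ← Category.assoc, h1', Category.assoc]
  obtain ⟨W, w, w', sq⟩ : ∃ (W : Scheme.{u}) (w : W ⟶ V) (w' : W ⟶ V'),
    IsPullback w w' (a ≫ Φ.g) (a' ≫ Ψ.toX) := ⟨_, _, _, IsPullback.of_hasPullback _ _⟩
  have sq' := sq
  rw [h2, e] at sq'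
  obtain ⟨A, A1, A2, eA, sA⟩ := comp_cover Φ Ψ a a' sq ha ha' h4 h4'
  obtain ⟨B, B1, B2, -, sB⟩ := comp_cover Φ' Ψ' b b' sq' hb hb' h5 h5'
  refine Rel.of A B eA ?_ ?_ ?_ sA sB
  · apply Aff.hom_ext_append
    · rw [Category.assoc, Category.assoc, comp_p_proj, comp_p_proj, ← Category.assoc, A1,
        ← Category.assoc B, B1, toX, toX, Category.assoc, Category.assoc, ← Category.assoc a, h1,
        Category.assoc]
    · intro i
      rw [pb_comp, pb_comp, comp_p_left, comp_p_left, ← pb_comp, ← pb_comp, ← pb_comp, ← pb_comp,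
        A1, B1, Category.assoc, Category.assoc, h1]
    · intro j
      rw [pb_comp, pb_comp, comp_p_right, comp_p_right, ← pb_comp, ← pb_comp, ← pb_comp,
        ← pb_comp, A2, B2, Category.assoc, Category.assoc, h1']
  · rw [comp_g, comp_g, ← Category.assoc, A2, ← Category.assoc, B2, Category.assoc, h2',
      Category.assoc]
  · refine Fin.addCases (fun i => ?_) (fun j => ?_)
    · rw [comp_φ_left, comp_φ_left, ← pb_comp, ← pb_comp, A1, B1, pb_comp, pb_comp, h3]
    · rw [comp_φ_right, comp_φ_right, ← pb_comp, ← pb_comp, A2, B2, pb_comp, pb_comp, h3']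

lemma rel_pull_id (Φ : ExplicitCorr n X Y) : Rel (Φ.pull (𝟙 X)) Φ := by
  have h : Aff.map n (𝟙 X : X ⟶ X).left = 𝟙 _ := by
    rw [Over.id_left, Aff.map, AffineSpace.map_id]
  have hw := (Φ.pull_sq (𝟙 X)).w
  rw [h, Category.comp_id] at hw
  have : IsIso (Φ.pullFst (𝟙 X)) :=
    (Φ.pull_sq (𝟙 X)).isIso_fst_of_isIso (by rw [h]; infer_instance)
  exact Rel.of_hom (Φ.pullFst _) hw.symm rfl (fun _ => rfl)
    (fun u => (Φ.pullFst (𝟙 X)).surjective u)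

lemma rel_pull_comp (f : X' ⟶ X) (f' : X'' ⟶ X') (Φ : ExplicitCorr n X Y) :
    Rel (Φ.pull (f' ≫ f)) ((Φ.pull f).pull f') := by
  have hm : Aff.map n (f' ≫ f).left = Aff.map n f'.left ≫ Aff.map n f.left := by
    rw [Over.comp_left, Aff.map, AffineSpace.map_comp]
  have sq := ((Φ.pull f).pull_sq f').paste_horiz (Φ.pull_sq f)
  rw [← hm] at sq
  obtain ⟨e, e1, e2⟩ := sq.exists_lift _ _ (Φ.pull_sq (f' ≫ f)).w
  obtain ⟨e', e1', e2'⟩ := (Φ.pull_sq (f' ≫ f)).exists_lift _ _ sq.w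
  refine Rel.of_hom e e2.symm ?_ ?_ (surjective_of_iso e e' ?_)
  · rw [pull_g, pull_g, pull_g, ← e1, Category.assoc, Category.assoc]
  · intro i
    rw [pull_φ, pull_φ, pull_φ, ← e1, pb_comp, pb_comp]
  · apply sq.hom_ext
    · rw [Category.assoc, e1, e1', Category.id_comp]
    · rw [Category.assoc, e2, e2', Category.id_comp]

lemma rel_pull_of_comp (f : X' ⟶ X) (Φ : ExplicitCorr n X Y) (Ψ : ExplicitCorr m Y Y') :
    Rel ((Φ.pull f).comp Ψ) ((Φ.comp Ψ).pull f) := by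
  have sq1 := (Φ.pull f).comp_sq Ψ
  rw [pull_g] at sq1
  obtain ⟨c, c1, c2⟩ := (Φ.comp_sq Ψ).exists_lift ((Φ.pull f).compFst Ψ ≫ Φ.pullFst f)
    ((Φ.pull f).compSnd Ψ) (by rw [Category.assoc, sq1.w])
  have sq2 : IsPullback c ((Φ.pull f).compFst Ψ) (Φ.compFst Ψ) (Φ.pullFst f) :=
    IsPullback.of_right (by rw [c2]; exact sq1.flip) c1 (Φ.comp_sq Ψ).flip
  have hw : c ≫ (Φ.comp Ψ).p = ((Φ.pull f).comp Ψ).p ≫ Aff.map (n + m) f.left := by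
    apply Aff.hom_ext_append
    · rw [Category.assoc, Category.assoc, comp_p_proj, Aff.map_proj, ← Category.assoc c, c1,
        ← Category.assoc (ExplicitCorr.p _), comp_p_proj, Category.assoc, Category.assoc,
        (Φ.pull_toX_sq f).w]
    · intro i
      rw [pb_comp, pb_comp, Aff.pb_map_coord, comp_p_left, comp_p_left, ← pb_comp, c1,
        ← pb_comp, Category.assoc, (Φ.pull_sq f).w, pb_comp, pb_comp, Aff.pb_map_coord]
    · intro j
      rw [pb_comp, pb_comp, Aff.pb_map_coord, comp_p_right, comp_p_right, ← pb_comp, c2]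
  have sq3 : IsPullback c ((Φ.pull f).comp Ψ).p (Φ.comp Ψ).p (Aff.map (n + m) f.left) := by
    refine IsPullback.of_bot ?_ hw (Aff.isPullback_map _ _)
    rw [comp_p_proj, comp_p_proj]
    exact sq2.paste_vert (Φ.pull_toX_sq f)
  obtain ⟨e, e1, e2⟩ := ((Φ.comp Ψ).pull_sq f).exists_lift _ _ sq3.w
  obtain ⟨e', e1', e2'⟩ := sq3.exists_lift _ _ ((Φ.comp Ψ).pull_sq f).w
  refine Rel.of_hom e e2.symm ?_ ?_ (surjective_of_iso e e' ?_)
  · rw [pull_g, comp_g, comp_g, ← Category.assoc, e1, ← Category.assoc, c2]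
  · refine Fin.addCases (fun i => ?_) (fun j => ?_)
    · rw [pull_φ, comp_φ_left, comp_φ_left, ← pb_comp, e1, ← pb_comp, c1, pull_φ, pb_comp]
    · rw [pull_φ, comp_φ_right, comp_φ_right, ← pb_comp, e1, ← pb_comp, c2]
  · apply ((Φ.comp Ψ).pull_sq f).hom_ext
    · rw [Category.assoc, e1, e1', Category.id_comp]
    · rw [Category.assoc, e2, e2', Category.id_comp]

end ExplicitCorr

section stabilization

variable {S : Scheme.{u}}

/-- The zero section `Y ⟶ 𝔸¹_Y`. -/
def zeroSec (Y : Scheme.{u}) : Y ⟶ Aff 1 Y := Aff.lift (𝟙 Y) (fun _ => 0)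

lemma zeroSec_proj (Y : Scheme.{u}) : zeroSec Y ≫ Aff.proj 1 Y = 𝟙 Y := by
  unfold zeroSec
  exact Aff.lift_proj (n := 1) (𝟙 Y) (fun _ => 0)

lemma pb_zeroSec (Y : Scheme.{u}) (i : Fin 1) : pb (zeroSec Y) (Aff.coord Y i) = 0 := by
  unfold zeroSec
  exact Aff.pb_lift_coord (n := 1) (𝟙 Y) (fun _ => 0) i

instance (Y : Scheme.{u}) : IsClosedImmersion (zeroSec Y) := by
  have : IsClosedImmersion (zeroSec Y ≫ Aff.proj 1 Y) := by rw [zeroSec_proj]; infer_instance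
  exact IsClosedImmersion.of_comp (zeroSec Y) (Aff.proj 1 Y)

lemma coord_framing (Y : Scheme.{u}) (u : Aff 1 Y) :
    (∀ i : Fin 1, u ∉ (Aff 1 Y).basicOpen (Aff.coord Y i)) ↔ u ∈ Set.range (zeroSec Y) := by
  constructor
  · intro h
    have h0 : ∀ i, pb ((Aff 1 Y).fromSpecResidueField u) (Aff.coord Y i) = 0 := by
      intro i
      rw [← basicOpen_eq_bot_iff, eq_bot_iff]
      intro z hz
      rw [mem_basicOpen_pb] at hz
      have : (Aff 1 Y).fromSpecResidueField u z = u := by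
        have := Scheme.range_fromSpecResidueField u
        have h2 : (Aff 1 Y).fromSpecResidueField u z ∈ Set.range _ := ⟨z, rfl⟩
        rw [this] at h2; exact h2
      rw [this] at hz
      exact (h i hz).elim
    have e : (Aff 1 Y).fromSpecResidueField u =
        ((Aff 1 Y).fromSpecResidueField u ≫ Aff.proj 1 Y) ≫ zeroSec Y := by
      apply Aff.hom_ext
      · rw [Category.assoc, zeroSec_proj, Category.comp_id]
      · intro i
        rw [h0, pb_comp, pb_zeroSec]; simp [pb]
    have h2 : u ∈ Set.range ((Aff 1 Y).fromSpecResidueField u) := by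
      rw [Scheme.range_fromSpecResidueField]; rfl
    obtain ⟨z, hz⟩ := h2
    rw [e, Scheme.Hom.comp_apply] at hz
    exact ⟨_, hz⟩
  · rintro ⟨y, rfl⟩ i
    rw [← mem_basicOpen_pb, pb_zeroSec, Scheme.basicOpen_zero]
    exact id

lemma coord_generic (Y : Scheme.{u}) (u : Aff 1 Y) (hu : IsGenericInFiber (Aff.proj 1 Y) u)
    (i : Fin 1) : u ∈ (Aff 1 Y).basicOpen (Aff.coord Y i) := by
  by_contra hi
  have hr : u ∈ Set.range (zeroSec Y) := by
    rw [← coord_framing]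
    intro j
    rwa [Subsingleton.elim j i]
  obtain ⟨y, rfl⟩ := hr
  obtain ⟨z, hz⟩ : y ∈ Set.range (Y.fromSpecResidueField y) := by
    rw [Scheme.range_fromSpecResidueField]; rfl
  let K := Spec (Y.residueField y)
  let ρ : K ⟶ Y := Y.fromSpecResidueField y
  have hρ : ∀ x : K, ρ x = y := fun x => by
    have : ρ x ∈ Set.range (Y.fromSpecResidueField y) := ⟨x, rfl⟩
    rw [Scheme.range_fromSpecResidueField] at this; exact this
  let η : Aff 1 K := genericPoint (Aff 1 K)
  have hη : ∀ x : Aff 1 K, η ⤳ x := fun x => genericPoint_specializes x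
  have e0 : zeroSec K ≫ Aff.map 1 ρ = ρ ≫ zeroSec Y := by
    apply Aff.hom_ext
    · rw [Category.assoc, Category.assoc, Aff.map_proj, zeroSec_proj, ← Category.assoc,
        zeroSec_proj, Category.id_comp, Category.comp_id]
    · intro j
      rw [pb_comp, pb_comp, Aff.pb_map_coord, pb_zeroSec, pb_zeroSec]; simp [pb]
  have h1 : Aff.map 1 ρ η ⤳ zeroSec Y y := by
    have := (hη (zeroSec K z)).map (Aff.map 1 ρ).continuous
    rwa [← Scheme.Hom.comp_apply, e0, Scheme.Hom.comp_apply, hρ] at this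
  have h2 : Aff.proj 1 Y (Aff.map 1 ρ η) = Aff.proj 1 Y (zeroSec Y y) := by
    rw [← Scheme.Hom.comp_apply, Aff.map_proj, Scheme.Hom.comp_apply, hρ, ← Scheme.Hom.comp_apply,
      zeroSec_proj]
    rfl
  have h3 := hu _ h2 h1
  apply hi
  rw [← h3, ← mem_basicOpen_pb, Aff.pb_map_coord]
  refine (hη (Aff.lift (𝟙 K) (fun _ => 1) z)).mem_open (Scheme.basicOpen _ _).isOpen ?_
  change _ ∈ (Aff 1 K).basicOpen _
  rw [← mem_basicOpen_pb, Aff.pb_lift_coord, Scheme.basicOpen_of_isUnit _ isUnit_one]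
  trivial

/-- The explicit correspondence `σ_Y = ({0} × Y, 𝔸¹ × Y, t, pr_Y)` of level one from `Y` to `Y`. -/
def sigma (Y : Over S) : ExplicitCorr 1 Y Y :=
  ExplicitCorr.ofSection (zeroSec Y.left) (𝟙 _) (zeroSec Y.left) inferInstance
    (by rw [zeroSec_proj]; infer_instance) inferInstance
    (IsPullback.of_vert_isIso ⟨by simp⟩) (fun i => Aff.coord Y.left i) (coord_framing _)
    (by rw [Category.id_comp]; exact coord_generic _) (Aff.proj 1 Y.left)
    (by rw [Category.id_comp])

end stabilization

section levelZero

variable {S : Scheme.{u}}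

/-- The explicit correspondence of level zero from `X` to `Y` given by a morphism `g : U ⟶ Y` over
`S` from an open and closed subscheme `j : U ⟶ X`. Its support is `U`, its étale neighbourhood
is `U ⟶ X = 𝔸⁰_X`. -/
def levelZero {X Y : Over S} {U : Scheme.{u}} (j : U ⟶ X.left) [IsOpenImmersion j]
    [IsClosedImmersion j] (g : U ⟶ Y.left) (w : g ≫ Y.hom = j ≫ X.hom) : ExplicitCorr 0 X Y :=
  ExplicitCorr.ofSection (j ≫ inv (Aff.proj 0 X.left)) (j ≫ inv (Aff.proj 0 X.left)) (𝟙 U)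
    inferInstance (by rw [Category.assoc, IsIso.inv_hom_id, Category.comp_id]; infer_instance)
    inferInstance (isPullback_section (Category.id_comp _) (fun a t e => by
      rw [Category.comp_id]; exact (cancel_mono _).1 e))
    finZeroElim (fun u => ⟨fun _ => ⟨u, rfl⟩, fun _ i => i.elim0⟩)
    (fun u _ i => i.elim0) g
    (by rw [w, Category.assoc j, IsIso.inv_hom_id, Category.comp_id])

/-- The disjoint union of two schemes over `S`. -/
def disj (Y₁ Y₂ : Over S) : Over S := Over.mk (coprod.desc Y₁.hom Y₂.hom : Y₁.left ⨿ Y₂.left ⟶ S)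

instance (Y₁ Y₂ : Scheme.{u}) : IsClosedImmersion (coprod.inl : Y₁ ⟶ Y₁ ⨿ Y₂) := by
  refine IsClosedImmersion.of_isPreimmersion _ ?_
  rw [← (isCompl_range_inl_inr Y₁ Y₂).symm.compl_eq]
  exact (coprod.inr : Y₂ ⟶ Y₁ ⨿ Y₂).isOpenEmbedding.isOpen_range.isClosed_compl

instance (Y₁ Y₂ : Scheme.{u}) : IsClosedImmersion (coprod.inr : Y₂ ⟶ Y₁ ⨿ Y₂) := by
  refine IsClosedImmersion.of_isPreimmersion _ ?_
  rw [← (isCompl_range_inl_inr Y₁ Y₂).compl_eq]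
  exact (coprod.inl : Y₁ ⟶ Y₁ ⨿ Y₂).isOpenEmbedding.isOpen_range.isClosed_compl

/-- The inclusion of the first summand, an open and closed immersion. -/
def disjInl (Y₁ Y₂ : Over S) : Y₁.left ⟶ (disj Y₁ Y₂).left :=
  (coprod.inl : Y₁.left ⟶ Y₁.left ⨿ Y₂.left)

/-- The inclusion of the second summand, an open and closed immersion. -/
def disjInr (Y₁ Y₂ : Over S) : Y₂.left ⟶ (disj Y₁ Y₂).left :=
  (coprod.inr : Y₂.left ⟶ Y₁.left ⨿ Y₂.left)

instance (Y₁ Y₂ : Over S) : IsOpenImmersion (disjInl Y₁ Y₂) :=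
  inferInstanceAs (IsOpenImmersion (coprod.inl : Y₁.left ⟶ Y₁.left ⨿ Y₂.left))

instance (Y₁ Y₂ : Over S) : IsOpenImmersion (disjInr Y₁ Y₂) :=
  inferInstanceAs (IsOpenImmersion (coprod.inr : Y₂.left ⟶ Y₁.left ⨿ Y₂.left))

instance (Y₁ Y₂ : Over S) : IsClosedImmersion (disjInl Y₁ Y₂) :=
  inferInstanceAs (IsClosedImmersion (coprod.inl : Y₁.left ⟶ Y₁.left ⨿ Y₂.left))

instance (Y₁ Y₂ : Over S) : IsClosedImmersion (disjInr Y₁ Y₂) :=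
  inferInstanceAs (IsClosedImmersion (coprod.inr : Y₂.left ⟶ Y₁.left ⨿ Y₂.left))

lemma disjInl_hom (Y₁ Y₂ : Over S) : disjInl Y₁ Y₂ ≫ (disj Y₁ Y₂).hom = Y₁.hom :=
  coprod.inl_desc _ _

lemma disjInr_hom (Y₁ Y₂ : Over S) : disjInr Y₁ Y₂ ≫ (disj Y₁ Y₂).hom = Y₂.hom :=
  coprod.inr_desc _ _

/-- The explicit correspondence `id ⊔ ∅ : Y₁ ⊔ Y₂ ⟶ Y₁` of level zero. -/
def projLeft (Y₁ Y₂ : Over S) : ExplicitCorr 0 (disj Y₁ Y₂) Y₁ :=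
  levelZero (disjInl Y₁ Y₂) (𝟙 _) (by rw [disjInl_hom, Category.id_comp])

/-- The explicit correspondence `∅ ⊔ id : Y₁ ⊔ Y₂ ⟶ Y₂` of level zero. -/
def projRight (Y₁ Y₂ : Over S) : ExplicitCorr 0 (disj Y₁ Y₂) Y₂ :=
  levelZero (disjInr Y₁ Y₂) (𝟙 _) (by rw [disjInr_hom, Category.id_comp])

end levelZero

namespace ExplicitCorr

variable {S : Scheme.{u}} {n : ℕ} {X Y Y' : Over S}

instance (Y : Over S) : IsIso (sigma Y).p := inferInstanceAs (IsIso (𝟙 (Aff 1 Y.left)))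

lemma sigma_g (Y : Over S) : (sigma Y).g = (sigma Y).toX := (Category.id_comp _).symm

lemma sigma_φ (Y : Over S) (i : Fin 1) : (sigma Y).φ i = pb (sigma Y).p (Aff.coord Y.left i) := by
  change _ = pb (𝟙 _) _
  simp only [pb, Scheme.Hom.id_appTop]
  rfl

/-- Morphisms to `(sigma Y).U = 𝔸¹_Y`. -/
lemma exists_lift_sigma (Y : Over S) {T : Scheme.{u}} (a : T ⟶ Y.left) (v : Fin 1 → Γ(T, ⊤)) :
    ∃ l : T ⟶ (sigma Y).U, l ≫ (sigma Y).toX = a ∧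
      ∀ i, pb (l ≫ (sigma Y).p) (Aff.coord Y.left i) = v i := by
  refine ⟨Aff.lift a v ≫ inv (sigma Y).p, ?_, fun i => ?_⟩
  · rw [toX, Category.assoc, IsIso.inv_hom_id_assoc, Aff.lift_proj]
  · rw [Category.assoc, IsIso.inv_hom_id, Category.comp_id, Aff.pb_lift_coord]

lemma sigma_hom_ext (Y : Over S) {T : Scheme.{u}} {a b : T ⟶ (sigma Y).U}
    (h : a ≫ (sigma Y).toX = b ≫ (sigma Y).toX) (h' : ∀ i, pb (a ≫ (sigma Y).p)
      (Aff.coord Y.left i) = pb (b ≫ (sigma Y).p) (Aff.coord Y.left i)) : a = b := by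
  rw [← cancel_mono (sigma Y).p]
  exact Aff.hom_ext (by rwa [Category.assoc, Category.assoc]) h'

/-- Stabilization commutes with composition with correspondences of level zero. -/
lemma rel_sigma_comp (Φ : ExplicitCorr n X Y) (Ψ : ExplicitCorr 0 Y Y') :
    Rel (n := n + 1) ((Φ.comp Ψ).comp (sigma Y')) ((Φ.comp (sigma Y)).comp Ψ) := by
  have wΦΨ := (Φ.comp_sq Ψ).w
  have wΦσ := (Φ.comp_sq (sigma Y)).w
  have wL := ((Φ.comp (sigma Y)).comp_sq Ψ).w
  have wR := ((Φ.comp Ψ).comp_sq (sigma Y')).w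
  rw [comp_g] at wL wR
  rw [sigma_g] at wL
  -- the map from right to left
  obtain ⟨l, l1, l2⟩ := exists_lift_sigma Y
    (((Φ.comp Ψ).compFst (sigma Y') ≫ Φ.compFst Ψ) ≫ Φ.g)
    (fun i => pb ((Φ.comp Ψ).compSnd (sigma Y') ≫ (sigma Y').p) (Aff.coord _ i))
  obtain ⟨b1, b11, b12⟩ := (Φ.comp_sq (sigma Y)).exists_lift
    ((Φ.comp Ψ).compFst (sigma Y') ≫ Φ.compFst Ψ) l l1.symm
  obtain ⟨b, b2, b3⟩ := ((Φ.comp (sigma Y)).comp_sq Ψ).exists_lift b1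
    ((Φ.comp Ψ).compFst (sigma Y') ≫ Φ.compSnd Ψ) (by
      rw [comp_g, sigma_g, ← Category.assoc, b12, l1, Category.assoc, wΦΨ, Category.assoc])
  -- the map from left to right
  obtain ⟨r, r1, r2⟩ := exists_lift_sigma Y' ((Φ.comp (sigma Y)).compSnd Ψ ≫ Ψ.g)
    (fun i => pb (((Φ.comp (sigma Y)).compFst Ψ ≫ Φ.compSnd (sigma Y)) ≫ (sigma Y).p)
      (Aff.coord _ i))
  obtain ⟨c1, c11, c12⟩ := (Φ.comp_sq Ψ).exists_lift
    ((Φ.comp (sigma Y)).compFst Ψ ≫ Φ.compFst (sigma Y)) ((Φ.comp (sigma Y)).compSnd Ψ)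
    (by rw [Category.assoc, wΦσ, wL])
  obtain ⟨c, c2, c3⟩ := ((Φ.comp Ψ).comp_sq (sigma Y')).exists_lift c1 r
    (by rw [comp_g, ← Category.assoc, c12, r1])
  refine Rel.of_hom (n := n + 1) (Φ := (Φ.comp Ψ).comp (sigma Y'))
    (Ψ := (Φ.comp (sigma Y)).comp Ψ) b ?_ ?_ ?_ (surjective_of_iso b c ?_)
  · refine Aff.hom_ext_append (n := n) (m := 1) ?_ (fun i => ?_) (fun j => ?_)
    · refine ((Φ.comp Ψ).comp_p_proj (sigma Y')).trans ?_
      rw [Category.assoc]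
      refine Eq.trans ?_ (congrArg (b ≫ ·) ((Φ.comp (sigma Y)).comp_p_proj Ψ)).symm
      refine Eq.trans (congrArg (_ ≫ ·) (Φ.comp_p_proj Ψ)) ?_
      rw [← Category.assoc b, b2, toX, toX, comp_p_proj, ← Category.assoc b1, b11,
        Category.assoc]
    · refine ((Φ.comp Ψ).comp_p_left (sigma Y') i).trans ?_
      rw [pb_comp]
      refine Eq.trans ?_ (congrArg (pb b)
        ((Φ.comp (sigma Y)).comp_p_left Ψ (Fin.castAdd 1 i))).symm
      refine Eq.trans (congrArg (pb _) (Φ.comp_p_left Ψ i)) ?_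
      rw [comp_p_left, ← pb_comp b, b2, ← pb_comp, ← pb_comp b1, b11]
    · refine ((Φ.comp Ψ).comp_p_right (sigma Y') j).trans ?_
      rw [pb_comp]
      refine Eq.trans ?_ (congrArg (pb b)
        ((Φ.comp (sigma Y)).comp_p_left Ψ (Fin.natAdd n j))).symm
      rw [comp_p_right, ← pb_comp b, b2, ← pb_comp b1, ← pb_comp, ← pb_comp, b12, l2]
  · rw [comp_g, comp_g, sigma_g, ← wR, ← Category.assoc, ← Category.assoc, b3]
  · refine Fin.addCases (m := n) (n := 1) (fun i => ?_) (fun j => ?_)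
    · refine ((Φ.comp Ψ).comp_φ_left (sigma Y') i).trans ?_
      refine Eq.trans ?_ (congrArg (pb b)
        ((Φ.comp (sigma Y)).comp_φ_left Ψ (Fin.castAdd 1 i))).symm
      refine Eq.trans (congrArg (pb _) (Φ.comp_φ_left Ψ i)) ?_
      rw [comp_φ_left, ← pb_comp, ← pb_comp, b2, ← pb_comp, b11]
    · refine ((Φ.comp Ψ).comp_φ_right (sigma Y') j).trans ?_
      refine Eq.trans ?_ (congrArg (pb b)
        ((Φ.comp (sigma Y)).comp_φ_left Ψ (Fin.natAdd n j))).symm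
      rw [comp_φ_right, sigma_φ, sigma_φ, ← pb_comp b, b2, ← pb_comp b1, ← pb_comp, ← pb_comp,
        b12, l2]
  · apply ((Φ.comp (sigma Y)).comp_sq Ψ).hom_ext
    · rw [Category.id_comp, Category.assoc, b2]
      apply (Φ.comp_sq (sigma Y)).hom_ext
      · rw [Category.assoc, b11, ← Category.assoc, c2, c11]
      · rw [Category.assoc, b12]
        apply sigma_hom_ext
        · rw [Category.assoc, l1, ← Category.assoc, ← Category.assoc, c2, c11, Category.assoc,
            Category.assoc, wΦσ]
        · intro i
          rw [Category.assoc, pb_comp, l2, ← pb_comp, ← Category.assoc, c3, r2]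
    · rw [Category.assoc, b3, ← Category.assoc, c2, c12, Category.id_comp]

end ExplicitCorr

section presheaf

variable {S : Scheme.{u}}

/-- `Fr_n(X, Y)`: framed correspondences of level `n`, i.e. equivalence classes of explicit framed
correspondences. -/
def FrSet (n : ℕ) (X Y : Over S) : Type (u + 1) :=
  Quotient (⟨ExplicitCorr.Rel, ExplicitCorr.rel_equivalence⟩ : Setoid (ExplicitCorr n X Y))

/-- The presheaf `X ↦ Fr_n(X, Y)`. -/
def frLevel (n : ℕ) (Y : Over S) : (Over S)ᵒᵖ ⥤ Type (u + 1) where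
  obj X := FrSet n X.unop Y
  map f := ↾(Quotient.map' (fun Φ => Φ.pull f.unop) (fun _ _ h => h.pull f.unop))
  map_id X := by
    ext a
    induction a using Quotient.inductionOn'
    exact Quotient.sound (ExplicitCorr.rel_pull_id _)
  map_comp f g := by
    ext a
    induction a using Quotient.inductionOn'
    exact Quotient.sound (ExplicitCorr.rel_pull_comp _ _ _)

/-- Composition with an explicit correspondence from `Y` to `Y'` of level `m`, as a map of presheaves
from `Fr_n(-, Y)` to `Fr_{n+m}(-, Y')`. -/
def postcomp (n : ℕ) {m : ℕ} {Y Y' : Over S} (Ψ : ExplicitCorr m Y Y') :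
    frLevel n Y ⟶ frLevel (n + m) Y' where
  app X := ↾(Quotient.map' (fun Φ => Φ.comp Ψ)
    (fun _ _ h => h.comp (ExplicitCorr.rel_equivalence.refl Ψ)))
  naturality X X' f := by
    ext a
    induction a using Quotient.inductionOn'
    exact Quotient.sound (ExplicitCorr.rel_pull_of_comp _ _ _)

/-- The sequence `Fr_0(-, Y) ⟶ Fr_1(-, Y) ⟶ ⋯` of compositions with `σ_Y`. -/
def frSequence (Y : Over S) : ℕ ⥤ (Over S)ᵒᵖ ⥤ Type (u + 1) :=
  Functor.ofSequence (X := fun n => frLevel n Y) (fun n => postcomp n (sigma Y))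

/-- The presheaf `Fr(-, Y)` of stable framed correspondences, the colimit of the `Fr_n(-, Y)`. -/
def Fr (Y : Over S) : (Over S)ᵒᵖ ⥤ Type (u + 1) := colimit (frSequence Y)

/-- The map `Fr(-, Y) ⟶ Fr(-, Y')` given by an explicit framed correspondence of level zero. -/
def Fr.map {Y Y' : Over S} (Ψ : ExplicitCorr 0 Y Y') : Fr Y ⟶ Fr Y' :=
  colimMap (NatTrans.ofSequence (F := frSequence Y) (G := frSequence Y')
    (fun n => (postcomp n Ψ : frLevel n Y ⟶ frLevel n Y')) (fun n => by
      have h : ∀ Y : Over S, (frSequence Y).map (homOfLE (Nat.le_add_right n 1)) =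
        postcomp n (sigma Y) := fun Y => Functor.ofSequence_map_homOfLE_succ _ n
      rw [h, h]
      ext X a
      induction a using Quotient.inductionOn'
      exact (Quotient.sound (ExplicitCorr.rel_sigma_comp _ Ψ)).symm))

end presheaf

section singular

variable (k : Type u) [Field k]

/-- The coordinate ring `k[x₀, …, xₙ] / (x₀ + ⋯ + xₙ - 1)` of the algebraic `n`-simplex. -/
abbrev simplexRing (n : ℕ) : Type u :=
  MvPolynomial (Fin (n + 1)) k ⧸
    Ideal.span {(∑ i, MvPolynomial.X i - 1 : MvPolynomial (Fin (n + 1)) k)}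

/-- The map of coordinate rings induced by `θ : [m] ⟶ [n]`, given by `xᵢ ↦ ∑_{θ(j) = i} xⱼ`. -/
def simplexRingMap {m n : ℕ} (θ : Fin (m + 1) → Fin (n + 1)) :
    simplexRing k n →ₐ[k] simplexRing k m :=
  Ideal.Quotient.liftₐ _
    (MvPolynomial.aeval fun i => ∑ j with θ j = i, Ideal.Quotient.mk _ (MvPolynomial.X j)) (by
      intro a ha
      induction ha using Submodule.span_induction with
      | mem x hx =>
        obtain rfl := Set.mem_singleton_iff.1 hx
        simp only [map_sub, map_sum, map_one, MvPolynomial.aeval_X]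
        rw [Finset.sum_fiberwise, ← map_sum, ← map_one (Ideal.Quotient.mk _), ← map_sub]
        exact Ideal.Quotient.eq_zero_iff_mem.2 (Ideal.subset_span rfl)
      | zero => exact map_zero _
      | add x y _ _ hx hy => rw [map_add, hx, hy, add_zero]
      | smul r x _ hx => rw [smul_eq_mul, map_mul, hx, mul_zero])

lemma simplexRingMap_X {m n : ℕ} (θ : Fin (m + 1) → Fin (n + 1)) (i : Fin (n + 1)) :
    simplexRingMap k θ (Ideal.Quotient.mk _ (MvPolynomial.X i)) =
      ∑ j with θ j = i, Ideal.Quotient.mk _ (MvPolynomial.X j) :=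
  MvPolynomial.aeval_X _ _

lemma simplexRing_hom_ext {n : ℕ} {A : Type u} [CommRing A] [Algebra k A]
    {a b : simplexRing k n →ₐ[k] A}
    (h : ∀ i, a (Ideal.Quotient.mk _ (MvPolynomial.X i)) =
      b (Ideal.Quotient.mk _ (MvPolynomial.X i))) : a = b := by
  apply Ideal.Quotient.algHom_ext
  apply MvPolynomial.algHom_ext
  exact h

lemma simplexRingMap_id (n : ℕ) : simplexRingMap k (id : Fin (n + 1) → _) = AlgHom.id k _ := by
  apply simplexRing_hom_ext
  intro i
  rw [simplexRingMap_X]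
  simp [Finset.filter_eq']

lemma simplexRingMap_comp {l m n : ℕ} (θ : Fin (l + 1) → Fin (m + 1))
    (η : Fin (m + 1) → Fin (n + 1)) :
    simplexRingMap k (η ∘ θ) = (simplexRingMap k θ).comp (simplexRingMap k η) := by
  apply simplexRing_hom_ext
  intro i
  rw [AlgHom.comp_apply, simplexRingMap_X, simplexRingMap_X, map_sum]
  simp only [simplexRingMap_X]
  simp only [Finset.sum_filter]
  simp only [Function.comp_apply, ← Finset.sum_filter]
  rw [Finset.sum_sigma']
  refine Finset.sum_nbij' (fun j => ⟨θ j, j⟩) (fun j => j.2) ?_ ?_ ?_ ?_ ?_ <;>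
    simp +contextual

/-- The standard cosimplicial scheme `Δ^•` over `k`. -/
def cosimplicialScheme : SimplexCategory ⥤ Over (Spec (.of k)) where
  obj n := Over.mk (Spec.map (CommRingCat.ofHom (algebraMap k (simplexRing k n.len))))
  map θ := Over.homMk (Spec.map (CommRingCat.ofHom (simplexRingMap k θ.toOrderHom).toRingHom)) (by
    refine (Spec.map_comp _ _).symm.trans ?_
    rw [← CommRingCat.ofHom_comp]
    refine congrArg (fun r => Spec.map (CommRingCat.ofHom r)) ?_
    exact (simplexRingMap k θ.toOrderHom).comp_algebraMap)
  map_id n := by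
    ext1
    refine Eq.trans ?_ (Spec.map_id (.of (simplexRing k n.len)))
    exact congrArg (fun r : _ →ₐ[k] _ => Spec.map (CommRingCat.ofHom r.toRingHom))
      (simplexRingMap_id k n.len)
  map_comp f g := by
    ext1
    refine Eq.trans ?_ (Spec.map_comp
      (CommRingCat.ofHom (simplexRingMap k g.toOrderHom).toRingHom)
      (CommRingCat.ofHom (simplexRingMap k f.toOrderHom).toRingHom))
    exact congrArg (fun r : _ →ₐ[k] _ => Spec.map (CommRingCat.ofHom r.toRingHom))
      (simplexRingMap_comp k f.toOrderHom g.toOrderHom)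

/-- Smooth separated schemes of finite type over `k`. -/
def smProp : ObjectProperty (Over (Spec (.of k))) := fun X =>
  Smooth X.hom ∧ IsSeparated X.hom ∧ QuasiCompact X.hom

/-- The category `Sm/k` of smooth separated schemes of finite type over `k`. -/
abbrev Sm : Type (u + 1) := (smProp k).FullSubcategory

variable {k}

universe w

/-- The functor `X ↦ (X × Δ^•)` from `Sm/k` to cosimplicial schemes, with opposite categories. -/
def prodSimplex : (Sm k)ᵒᵖ ⥤ SimplexCategoryᵒᵖ ⥤ (Over (Spec (.of k)))ᵒᵖ :=
  ((smProp k).ι ⋙ prod.functor ⋙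
    (Functor.whiskeringLeft _ _ _).obj (cosimplicialScheme k)).op ⋙ Functor.opHom _ _

/-- The simplicial presheaf `C_*(F) = (X ↦ F(X × Δ^•))` on `Sm/k`. -/
def Cstar (F : (Over (Spec (.of k)))ᵒᵖ ⥤ Type w) : (Sm k)ᵒᵖ ⥤ SSet.{w} :=
  prodSimplex ⋙ (Functor.whiskeringRight _ _ _).obj F

/-- Functoriality of `C_*(F)` in `F`. -/
def Cstar.map {F G : (Over (Spec (.of k)))ᵒᵖ ⥤ Type w} (α : F ⟶ G) : Cstar F ⟶ Cstar G :=
  Functor.whiskerLeft prodSimplex ((Functor.whiskeringRight _ _ _).map α)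

/-- The map `C_*Fr(-, Y₁ ⊔ Y₂) ⟶ C_*Fr(-, Y₁) × C_*Fr(-, Y₂)` given by the explicit framed
correspondences `id ⊔ ∅` and `∅ ⊔ id` of level zero. -/
def additivityMap (Y₁ Y₂ : Sm k) :
    Cstar (Fr (disj Y₁.obj Y₂.obj)) ⟶ Cstar (Fr Y₁.obj) ⨯ Cstar (Fr Y₂.obj) :=
  prod.lift (Cstar.map (Fr.map (projLeft Y₁.obj Y₂.obj)))
    (Cstar.map (Fr.map (projRight Y₁.obj Y₂.obj)))

/-- A map `f : A ⟶ B` of simplicial sets is a weak homotopy equivalence if for every Kan complex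
`K` it induces a bijection `π₀ Fun(B, K) ⟶ π₀ Fun(A, K)`. -/
def IsWeakEquiv {A B : SSet.{w}} (f : A ⟶ B) : Prop :=
  ∀ K : SSet.{w}, SSet.KanComplex K →
    Function.Bijective (SSet.mapπ₀ ((MonoidalClosed.pre f).app K))

/-- A map of simplicial presheaves on `Sm/k` is a schemewise weak equivalence if its value on each
`X` in `Sm/k` is a weak equivalence of simplicial sets. -/
def IsSchemewiseWeakEquiv {F G : (Sm k)ᵒᵖ ⥤ SSet.{w}} (f : F ⟶ G) : Prop :=
  ∀ X : Sm k, IsWeakEquiv (f.app (op X))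

end singular

end Framed

end

/-!
Fix `X` in `Sm/k`. Write `B = C_*Fr(X, Y₁) × C_*Fr(X, Y₂)` and `A = C_*Fr(X, Y₁ ⊔ Y₂)`.

Up to equivalence, a correspondence to `Y₁ ⊔ Y₂` is the same as a pair of correspondences to `Y₁`
and `Y₂` of the same level with disjoint supports. It is determined by its two components
(`rel_of_rel_proj`) because its étale neighbourhood is the disjoint union of theirs, and a pair
with disjoint supports can be added up after the étale neighbourhoods have been shrunk
(`exists_rel_proj`). Composition with `σ` is injective on equivalence classes, since a
correspondence is recovered by restriction to the zero section (`rel_of_rel_comp_sigma`), and it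
neither creates nor destroys disjointness of supports (`disjoint_comp_sigma_iff`). Hence `A ⟶ B`
is a monomorphism whose image consists of the pairs with disjoint supports, and `B` is the union
of the subcomplexes `B_n` of pairs represented in level `n`.

Two supports can always be moved apart: replace `(Φ₁, Φ₂)` by `(σ ∘ Φ₁, σ ∘ Φ₂)` and translate the
second correspondence by a function `s` in the new coordinate. For `s = 0` the pair represents the
same element of the colimit, for `s = 1` the supports lie over the sections `0` and `1` and are
disjoint (`disjoint_slide_one`), and for every `s` disjoint supports remain disjoint
(`disjoint_slide`). A simplex of `Δ[1]` defines a map from the algebraic simplex to `Δ¹`, and the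
coordinate `x₁` on `Δ¹` turns it into such a function `s`. This yields homotopies
`B_n × Δ[1] ⟶ B_{n+1}` from the inclusion to a map into `A`, preserving `A` (`levelFiltration`).

The homotopies for different `n` are not compatible with each other, and need not be: it is shown
for an arbitrary such filtration (`DeformingFiltration`) that a map `f` from `A` to a Kan complex
`K` extends to `B`. On each `B_n` one chooses a homotopy (a filling) which ends at `f` composed
with the end of the deformation, and is `f` composed with the deformation on `A`; two fillings
have starting points homotopic relative to `A`, so the filling on `B_{n+1}` can be corrected to
start, on `B_n`, where the previous one does (`Fills.exists_succ`). The starting points glue to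
the extension. The same applies to `(B, A)` multiplied with `(Δ[m], ∂Δ[m])`, so that restriction
`Fun(B, K) ⟶ Fun(A, K)` has the right lifting property with respect to `∂Δ[m] ⟶ Δ[m]` and is
bijective on connected components (`DeformingFiltration.isWeakEquiv`).
-/

noncomputable section

namespace Framed

/-! ### Gluing and homotopy extension for simplicial sets -/

section Simplicial

open MonoidalCategory CartesianMonoidalCategory Simplicial SSet.modelCategoryQuillen

lemma app_congr {X Y : SSet.{u}} {f g : X ⟶ Y} (h : f = g) {m : SimplexCategoryᵒᵖ} (x : X.obj m) :
    f.app m x = g.app m x := by rw [h]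

/-- Maps of simplicial sets glue along a jointly surjective family. -/
lemma exists_glue_family {ι : Type*} {P : ι → SSet.{u}} {Y K : SSet.{u}} (i : ∀ k, P k ⟶ Y)
    (surj : ∀ m (y : Y.obj m), ∃ k p, (i k).app m p = y) (a : ∀ k, P k ⟶ K)
    (compat : ∀ m k k' p p', (i k).app m p = (i k').app m p' → (a k).app m p = (a k').app m p') :
    ∃ c : Y ⟶ K, ∀ k, i k ≫ c = a k := by
  choose κ π hπ using surj
  let F : ∀ m, Y.obj m → K.obj m := fun m y => (a (κ m y)).app m (π m y)
  have hF : ∀ m k p, F m ((i k).app m p) = (a k).app m p := fun m k p =>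
    compat m _ _ _ _ (hπ m _)
  refine ⟨{ app := fun m => ↾(F m), naturality := fun m m' f => ?_ }, fun k => ?_⟩
  · ext y
    change F m' (Y.map f y) = K.map f (F m y)
    rw [← hπ m y, ← NatTrans.naturality_apply, hF, hF, NatTrans.naturality_apply]
  · ext m p; exact hF m k p

/-- Maps of simplicial sets glue along two jointly surjective monomorphisms. -/
lemma exists_glue {P Q Y K : SSet.{u}} (i : P ⟶ Y) (j : Q ⟶ Y)
    (hi : ∀ m, Function.Injective (i.app m)) (hj : ∀ m, Function.Injective (j.app m))
    (surj : ∀ m (y : Y.obj m), (∃ p, i.app m p = y) ∨ ∃ q, j.app m q = y) (a : P ⟶ K) (b : Q ⟶ K)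
    (compat : ∀ m p q, i.app m p = j.app m q → a.app m p = b.app m q) :
    ∃ c : Y ⟶ K, i ≫ c = a ∧ j ≫ c = b := by
  obtain ⟨c, hc⟩ := exists_glue_family (ι := Bool) (P := fun k => if k then P else Q)
    (Y := Y) (K := K) (fun k => match k with
      | true => i
      | false => j)
    (fun m y => (surj m y).elim (fun h => ⟨true, h⟩) (fun h => ⟨false, h⟩))
    (fun k => match k with
      | true => a
      | false => b) (fun m k k' p p' h => by
      match k, k', p, p', h with
      | true, true, p, p', h => exact congrArg (a.app m) (hi m h)
      | true, false, p, p', h => exact compat m p p' h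
      | false, true, p, p', h => exact (compat m p' p h.symm).symm
      | false, false, p, p', h => exact congrArg (b.app m) (hj m h))
  exact ⟨c, hc true, hc false⟩

/-- The inclusion `X ⟶ X ⊗ Δ[1]` at the vertex `e` of `Δ[1]`. -/
def endpt (X : SSet.{u}) (e : Fin 2) : X ⟶ X ⊗ Δ[1] :=
  CartesianMonoidalCategory.lift (𝟙 X) (SSet.const (SSet.stdSimplex.obj₀Equiv.{u}.symm e))

/-- The `m`-simplex of `Δ[1]` which is constant at the vertex `e`. -/
def vtx (e : Fin 2) (m : SimplexCategoryᵒᵖ) : (Δ[1] : SSet.{u}).obj m :=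
  (SSet.const (X := Δ[1]) (SSet.stdSimplex.obj₀Equiv.{u}.symm e)).app m
    (SSet.stdSimplex.const 1 0 m)

lemma asOrderHom_vtx (e : Fin 2) (m : SimplexCategoryᵒᵖ) (k) :
    SSet.stdSimplex.asOrderHom (vtx.{u} e m) k = e := rfl

lemma eq_vtx_iff (e : Fin 2) {m : SimplexCategoryᵒᵖ} (x : (Δ[1] : SSet.{u}).obj m) :
    x = vtx e m ↔ ∀ k, SSet.stdSimplex.asOrderHom x k = e := by
  constructor
  · rintro rfl k; rfl
  · intro h
    apply SSet.stdSimplex.objEquiv.injective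
    ext k
    have := h k
    change ((SSet.stdSimplex.asOrderHom x k : Fin 2) : ℕ) = _
    rw [this]; rfl

lemma vtx_injective (m : SimplexCategoryᵒᵖ) {e e' : Fin 2} (h : vtx.{u} e m = vtx e' m) :
    e = e' := by
  have := (eq_vtx_iff e' (vtx.{u} e m)).1 h 0
  rwa [asOrderHom_vtx] at this

lemma mem_horn_one (e : Fin 2) {m : SimplexCategoryᵒᵖ} (x : (Δ[1] : SSet.{u}).obj m) :
    x ∈ (SSet.horn.{u} 1 e).obj m ↔ x = vtx e m := by
  rw [SSet.mem_horn_iff, eq_vtx_iff]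
  constructor
  · intro h k
    by_contra hk
    refine h (Set.eq_univ_of_forall fun j => ?_)
    by_cases hj : j = e
    · exact Or.inr hj
    · exact Or.inl ⟨k, by grind⟩
  · intro h h'
    have : e + 1 ∈ Set.range (SSet.stdSimplex.asOrderHom x) ∪ {e} := by rw [h']; trivial
    rcases this with ⟨k, hk⟩ | h2
    · rw [h] at hk; revert hk; clear * -; revert e; decide
    · have h3 : e + 1 = e := h2
      revert h3; clear * -; revert e; decide

lemma mem_boundary_one {m : SimplexCategoryᵒᵖ} (x : (Δ[1] : SSet.{u}).obj m) :
    x ∈ (SSet.boundary.{u} 1).obj m ↔ ∃ e, x = vtx e m := by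
  change ¬ Function.Surjective _ ↔ _
  simp only [eq_vtx_iff]
  constructor
  · intro h
    simp only [Function.Surjective, not_forall, not_exists] at h
    obtain ⟨j, hj⟩ := h
    refine ⟨j + 1, fun k => ?_⟩
    have := hj k
    revert this
    generalize SSet.stdSimplex.asOrderHom x k = a
    clear * -; revert a j; decide
  · rintro ⟨e, he⟩ h
    obtain ⟨k, hk⟩ := h (e + 1)
    rw [he] at hk; revert hk; clear * -; revert e; decide

/-- Homotopy extension along the inclusion of a subcomplex, into a Kan complex. -/
lemma exists_homotopy_extension {X K : SSet.{u}} [SSet.KanComplex K] (A : X.Subcomplex) (e : Fin 2)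
    (a : X ⟶ K) (b : (A : SSet) ⊗ Δ[1] ⟶ K) (h : endpt _ e ≫ b = A.ι ≫ a) :
    ∃ c : X ⊗ Δ[1] ⟶ K, endpt X e ≫ c = a ∧ A.ι ▷ Δ[1] ≫ c = b := by
  -- `A ⊗ Δ[1] ∪ X ⊗ {e} ⟶ X ⊗ Δ[1]` is anodyne, because `{e}` is a horn of `Δ[1]`
  have hA := SSet.anodyneExtensions_unionProd_ι A (SSet.horn.{u} 1 e)
    (SSet.anodyneExtensions.horn_ι e)
  let i : X ⟶ (A.unionProd (SSet.horn.{u} 1 e) : SSet) :=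
    SSet.Subcomplex.lift (endpt X e) (by
      rintro m _ ⟨x, rfl⟩
      exact (SSet.Subcomplex.mem_unionProd_iff _ _ _).2 (Or.inl ((mem_horn_one _ _).2 rfl)))
  let j := SSet.Subcomplex.unionProd.ι₂ A (SSet.horn.{u} 1 e)
  obtain ⟨c, hc1, hc2⟩ := exists_glue i j
    (fun m x x' hx => congrArg (fun y => y.1.1) hx)
    (fun m x x' hx => Prod.ext (Subtype.ext (congrArg (fun y => y.1.1) hx))
      (congrArg (fun y => y.1.2) hx))
    (fun m ⟨⟨x, t⟩, hy⟩ => by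
      rcases (SSet.Subcomplex.mem_unionProd_iff _ _ _).1 hy with h | h
      · obtain rfl : t = vtx e m := (mem_horn_one _ _).1 h
        exact Or.inl ⟨x, rfl⟩
      · exact Or.inr ⟨(⟨x, h⟩, t), rfl⟩) a b (fun m p ⟨q, t⟩ hpq => by
      have h1 : p = q.1 := congrArg (fun y => y.1.1) hpq
      have h2 : vtx e m = t := congrArg (fun y => y.1.2) hpq
      subst h1 h2
      exact (app_congr h q).symm)
  have : HasLiftingProperty (A.unionProd (SSet.horn.{u} 1 e)).ι (terminal.from K) :=
    hA _ ((HomotopicalAlgebra.isFibrant_iff K).1 inferInstance).mem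
  have sq : CommSq c (A.unionProd (SSet.horn.{u} 1 e)).ι (terminal.from K) (terminal.from _) :=
    ⟨Subsingleton.elim _ _⟩
  have hl := sq.fac_left
  exact ⟨sq.lift, (congrArg (i ≫ ·) hl).trans hc1, (congrArg (j ≫ ·) hl).trans hc2⟩

/-- Homotopy extension relative to the ends of a cylinder, where the prescribed homotopies on the
ends form a family indexed by the vertices of `Δ[1]`. -/
lemma exists_homotopy_extension_family {X K : SSet.{u}} [SSet.KanComplex K] (A : X.Subcomplex)
    (e : Fin 2) (u : X ⊗ Δ[1] ⟶ K) (v : Fin 2 → (X ⊗ Δ[1] ⟶ K))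
    (w : ((A : SSet) ⊗ Δ[1]) ⊗ Δ[1] ⟶ K)
    (huv : ∀ j, endpt X j ≫ u = endpt X e ≫ v j)
    (huw : endpt _ e ≫ w = A.ι ▷ Δ[1] ≫ u)
    (hvw : ∀ j, endpt _ j ▷ Δ[1] ≫ w = A.ι ▷ Δ[1] ≫ v j) :
    ∃ E : (X ⊗ Δ[1]) ⊗ Δ[1] ⟶ K, endpt _ e ≫ E = u ∧ (∀ j, endpt X j ▷ Δ[1] ≫ E = v j) ∧
      (A.ι ▷ Δ[1]) ▷ Δ[1] ≫ E = w := by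
  -- homotopy extension along `A ⊗ Δ[1] ∪ X ⊗ ∂Δ[1] ⟶ X ⊗ Δ[1]`
  let B := A.unionProd (SSet.boundary.{u} 1)
  let i : Fin 2 → (X ⟶ (B : SSet)) := fun j => SSet.Subcomplex.lift (endpt X j) (by
      rintro m _ ⟨x, rfl⟩
      exact (SSet.Subcomplex.mem_unionProd_iff _ _ _).2 (Or.inl ((mem_boundary_one _).2 ⟨j, rfl⟩)))
  let i' : (A : SSet) ⊗ Δ[1] ⟶ (B : SSet) := SSet.Subcomplex.unionProd.ι₂ A (SSet.boundary.{u} 1)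
  have hvw' : ∀ m j (x : (A : SSet).obj m) t, w.app m ((x, vtx j m), t) = (v j).app m (x.1, t) :=
    fun m j x t => app_congr (hvw j) (x, t)
  obtain ⟨c, hc⟩ := exists_glue_family (ι := Option (Fin 2))
    (P := fun k => k.elim (((A : SSet) ⊗ Δ[1]) ⊗ Δ[1]) (fun _ => X ⊗ Δ[1]))
    (Y := (B : SSet) ⊗ Δ[1]) (K := K) (fun k => match k with
      | none => i' ▷ Δ[1]
      | some j => i j ▷ Δ[1])
    (fun m ⟨⟨⟨x, s⟩, hy⟩, t⟩ => by
      rcases (SSet.Subcomplex.mem_unionProd_iff _ _ _).1 hy with h | h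
      · obtain ⟨j, hj⟩ := (mem_boundary_one _).1 h
        obtain rfl : s = vtx j m := hj
        exact ⟨some j, (x, t), rfl⟩
      · exact ⟨none, ((⟨x, h⟩, s), t), rfl⟩)
    (fun k => match k with
      | none => w
      | some j => v j) (fun m k k' p p' h => by
      match k, k', p, p', h with
      | none, none, ((p, s), t), ((p', s'), t'), h =>
        have h1 : p.1 = p'.1 := congrArg (fun y => y.1.1.1) h
        have h2 : s = s' := congrArg (fun y => y.1.1.2) h
        have h3 : t = t' := congrArg (fun y => y.2) h
        obtain rfl := Subtype.ext h1
        subst h2 h3; rfl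
      | none, some j, ((p, s), t), (p', t'), h =>
        have h1 : p.1 = p' := congrArg (fun y => y.1.1.1) h
        have h2 : s = vtx j m := congrArg (fun y => y.1.1.2) h
        have h3 : t = t' := congrArg (fun y => y.2) h
        subst h1 h2 h3
        exact hvw' m j p t
      | some j, none, (p', t'), ((p, s), t), h =>
        have h1 : p' = p.1 := congrArg (fun y => y.1.1.1) h
        have h2 : vtx j m = s := congrArg (fun y => y.1.1.2) h
        have h3 : t' = t := congrArg (fun y => y.2) h
        subst h1 h2 h3
        exact (hvw' m j p _).symm
      | some j, some j', (p, t), (p', t'), h =>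
        have h1 : p = p' := congrArg (fun y => y.1.1.1) h
        have h2 : vtx j m = vtx j' m := congrArg (fun y => y.1.1.2) h
        have h3 : t = t' := congrArg (fun y => y.2) h
        obtain rfl := vtx_injective m h2
        subst h1 h3
        rfl)
  have huv' : ∀ m j (x : X.obj m), u.app m (x, vtx j m) = (v j).app m (x, vtx e m) :=
    fun m j x => app_congr (huv j) x
  have huw' : ∀ m (x : ((A : SSet) ⊗ Δ[1]).obj m), w.app m (x, vtx e m) = u.app m (x.1.1, x.2) :=
    fun m x => app_congr huw x
  obtain ⟨E, hE1, hE2⟩ := exists_homotopy_extension B e u c (by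
    ext m ⟨⟨x, s⟩, hy⟩
    rcases (SSet.Subcomplex.mem_unionProd_iff _ _ _).1 hy with h | h
    · obtain ⟨j, hj⟩ := (mem_boundary_one _).1 h
      obtain rfl : s = vtx j m := hj
      exact (app_congr (hc (some j)) (x, vtx e m)).trans
        (huv' m j x).symm
    · exact (app_congr (hc none) ((⟨x, h⟩, s), vtx e m)).trans (huw' m (⟨x, h⟩, s)))
  refine ⟨E, hE1, fun j => ?_, ?_⟩
  · exact (congrArg (i j ▷ Δ[1] ≫ ·) hE2).trans (hc (some j))
  · exact (congrArg (i' ▷ Δ[1] ≫ ·) hE2).trans (hc none)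

/-- Homotopy extension relative to the ends of a cylinder: a homotopy starting at `u : X ⊗ Δ[1] ⟶ K`
can be prescribed on the two ends of `X ⊗ Δ[1]` and on `A ⊗ Δ[1]`. -/
lemma exists_homotopy_extension_ends {X K : SSet.{u}} [SSet.KanComplex K] (A : X.Subcomplex)
    (e : Fin 2) (u v₀ v₁ : X ⊗ Δ[1] ⟶ K) (w : ((A : SSet) ⊗ Δ[1]) ⊗ Δ[1] ⟶ K)
    (hu₀ : endpt X 0 ≫ u = endpt X e ≫ v₀) (hu₁ : endpt X 1 ≫ u = endpt X e ≫ v₁)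
    (huw : endpt _ e ≫ w = A.ι ▷ Δ[1] ≫ u)
    (hw₀ : endpt _ 0 ▷ Δ[1] ≫ w = A.ι ▷ Δ[1] ≫ v₀)
    (hw₁ : endpt _ 1 ▷ Δ[1] ≫ w = A.ι ▷ Δ[1] ≫ v₁) :
    ∃ E : (X ⊗ Δ[1]) ⊗ Δ[1] ⟶ K, endpt _ e ≫ E = u ∧ endpt X 0 ▷ Δ[1] ≫ E = v₀ ∧
      endpt X 1 ▷ Δ[1] ≫ E = v₁ ∧ (A.ι ▷ Δ[1]) ▷ Δ[1] ≫ E = w := by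
  obtain ⟨v, rfl, rfl⟩ : ∃ v : Fin 2 → (X ⊗ Δ[1] ⟶ K), v 0 = v₀ ∧ v 1 = v₁ :=
    ⟨![v₀, v₁], rfl, rfl⟩
  obtain ⟨E, h1, h2, h3⟩ := exists_homotopy_extension_family A e u v w
    (Fin.forall_fin_two.2 ⟨hu₀, hu₁⟩) huw (Fin.forall_fin_two.2 ⟨hw₀, hw₁⟩)
  exact ⟨E, h1, h2 0, h2 1, h3⟩

/-- The two ways to put `X` into the corner `(e, e')` of `X ⊗ Δ[1] ⊗ Δ[1]` agree. -/
lemma endpt_endpt {X K : SSet.{u}} (e e' : Fin 2) (E : (X ⊗ Δ[1]) ⊗ Δ[1] ⟶ K) :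
    endpt X e ≫ endpt _ e' ≫ E = endpt X e' ≫ endpt X e ▷ Δ[1] ≫ E := by
  have h : endpt X e ≫ endpt _ e' = endpt X e' ≫ endpt X e ▷ Δ[1] := by
    apply CartesianMonoidalCategory.hom_ext
    · simp [endpt]
    · simp [endpt]
  rw [← Category.assoc, h, Category.assoc]

end Simplicial

/-! ### Extension of maps along a deforming filtration -/

section Simplicial

open MonoidalCategory CartesianMonoidalCategory Simplicial SSet.modelCategoryQuillen

/-- A filtration of `B` whose stages deform into the subcomplex `A` one stage later, by homotopies
preserving `A`. -/
structure DeformingFiltration {B : SSet.{u}} (A : B.Subcomplex) where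
  /-- the stages of the filtration -/
  F : ℕ → B.Subcomplex
  le_succ : ∀ n, F n ≤ F (n + 1)
  exhaustive : ∀ m (b : B.obj m), ∃ n, b ∈ (F n).obj m
  /-- the deformation of a stage inside the next one -/
  H : ∀ n, (F n : SSet) ⊗ Δ[1] ⟶ (F (n + 1) : SSet)
  H_zero : ∀ n m (x : (F n : SSet).obj m), ((H n).app m (x, vtx 0 m)).1 = x.1
  H_one : ∀ n m (x : (F n : SSet).obj m), ((H n).app m (x, vtx 1 m)).1 ∈ A.obj m
  H_mem : ∀ n m (x : (F n : SSet).obj m) (t : Δ[1].obj m), x.1 ∈ A.obj m →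
    ((H n).app m (x, t)).1 ∈ A.obj m

namespace DeformingFiltration

variable {B : SSet.{u}} {A : B.Subcomplex} (𝓕 : DeformingFiltration A) {K : SSet.{u}}

/-- The intersection of `A` with a stage, as a subcomplex of that stage. -/
def inter (n : ℕ) : (𝓕.F n : SSet).Subcomplex := A.preimage (𝓕.F n).ι

/-- The inclusion of the intersection of `A` with a stage into `A`. -/
def interι (n : ℕ) : (𝓕.inter n : SSet) ⟶ (A : SSet) :=
  SSet.Subcomplex.lift ((𝓕.inter n).ι ≫ (𝓕.F n).ι) (by rintro m _ ⟨x, rfl⟩; exact x.2)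

/-- The end of the deformation, as a map into `A`. -/
def endMap (n : ℕ) : (𝓕.F n : SSet) ⟶ (A : SSet) :=
  SSet.Subcomplex.lift (endpt _ 1 ≫ 𝓕.H n ≫ (𝓕.F (n + 1)).ι) (by
    rintro m _ ⟨x, rfl⟩; exact 𝓕.H_one n m x)

/-- The restriction of the deformation to `A`. -/
def interH (n : ℕ) : (𝓕.inter n : SSet) ⊗ Δ[1] ⟶ (A : SSet) :=
  SSet.Subcomplex.lift ((𝓕.inter n).ι ▷ Δ[1] ≫ 𝓕.H n ≫ (𝓕.F (n + 1)).ι) (by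
    rintro m _ ⟨x, rfl⟩; exact 𝓕.H_mem n m x.1.1 x.2 x.1.2)

lemma endpt_zero_interH (n : ℕ) : endpt _ 0 ≫ 𝓕.interH n = 𝓕.interι n := by
  ext m x
  exact Subtype.ext (𝓕.H_zero n m x.1)

/-- A homotopy on a stage of the filtration which agrees with `f` composed with the deformation
wherever the latter lies in `A`. -/
def Fills (f : (A : SSet) ⟶ K) (n : ℕ) (γ : (𝓕.F n : SSet) ⊗ Δ[1] ⟶ K) : Prop :=
  endpt _ 1 ≫ γ = 𝓕.endMap n ≫ f ∧ (𝓕.inter n).ι ▷ Δ[1] ≫ γ = 𝓕.interH n ≫ f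

variable {𝓕}

lemma Fills.zero {f : (A : SSet) ⟶ K} {n : ℕ} {γ : (𝓕.F n : SSet) ⊗ Δ[1] ⟶ K}
    (h : 𝓕.Fills f n γ) : (𝓕.inter n).ι ≫ endpt _ 0 ≫ γ = 𝓕.interι n ≫ f := by
  rw [← endpt_zero_interH, Category.assoc, ← h.2]; rfl

lemma Fills.app_zero {f : (A : SSet) ⟶ K} {n : ℕ} {γ : (𝓕.F n : SSet) ⊗ Δ[1] ⟶ K}
    (h : 𝓕.Fills f n γ) {m : SimplexCategoryᵒᵖ} (x : (𝓕.F n : SSet).obj m) (hx : x.1 ∈ A.obj m) :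
    γ.app m (x, vtx 0 m) = f.app m ⟨x.1, hx⟩ :=
  app_congr h.zero (⟨x, hx⟩ : (𝓕.inter n : SSet).obj m)

variable [SSet.KanComplex K]

variable (𝓕) in
lemma exists_fills (f : (A : SSet) ⟶ K) (n : ℕ) : ∃ γ, 𝓕.Fills f n γ := by
  obtain ⟨c, h1, h2⟩ := exists_homotopy_extension (𝓕.inter n) 1 (𝓕.endMap n ≫ f)
    (𝓕.interH n ≫ f) rfl
  exact ⟨c, h1, h2⟩

/-- Two fillings, one on a stage and one on the next stage, have starting points which are homotopic
relative to `A`. Both starting points are homotopic to `f` composed with the end of the deformation: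
one by its filling, the other by composition with the deformation. -/
lemma Fills.exists_homotopy {f : (A : SSet) ⟶ K} {n : ℕ} {γ : (𝓕.F n : SSet) ⊗ Δ[1] ⟶ K}
    (h : 𝓕.Fills f n γ) {γ' : (𝓕.F (n + 1) : SSet) ⊗ Δ[1] ⟶ K} (h' : 𝓕.Fills f (n + 1) γ') :
    ∃ D : (𝓕.F n : SSet) ⊗ Δ[1] ⟶ K,
      endpt _ 0 ≫ D = SSet.Subcomplex.homOfLE (𝓕.le_succ n) ≫ endpt _ 0 ≫ γ' ∧
      endpt _ 1 ≫ D = endpt _ 0 ≫ γ ∧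
      (𝓕.inter n).ι ▷ Δ[1] ≫ D = fst _ _ ≫ 𝓕.interι n ≫ f := by
  have hH : endpt _ 0 ≫ 𝓕.H n = SSet.Subcomplex.homOfLE (𝓕.le_succ n) := by
    ext m x
    exact Subtype.ext (𝓕.H_zero n m x)
  -- fill the square having the two homotopies as opposite sides, and take the remaining side
  obtain ⟨E, -, hE0, hE1, hE2⟩ := exists_homotopy_extension_ends (𝓕.inter n) 1
    (fst _ _ ≫ 𝓕.endMap n ≫ f) (𝓕.H n ≫ endpt _ 0 ≫ γ') γ
    (fst _ _ ▷ Δ[1] ≫ 𝓕.interH n ≫ f)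
    (by ext m x; exact (h'.app_zero _ (𝓕.H_one n m x)).symm) h.1.symm rfl
    (by ext m ⟨x, t⟩; exact (h'.app_zero _ (𝓕.H_mem n m x.1 t x.2)).symm) h.2.symm
  refine ⟨endpt _ 0 ≫ E, ?_, ?_, ?_⟩
  · rw [endpt_endpt, hE0, ← hH]; rfl
  · rw [endpt_endpt, hE1]
  · refine (congrArg (endpt _ 0 ≫ ·) hE2).trans ?_
    rw [← endpt_zero_interH]; rfl

/-- A filling on a stage can be continued to the next stage by one whose starting point extends the
given one. -/
lemma Fills.exists_succ {f : (A : SSet) ⟶ K} {n : ℕ} {γ : (𝓕.F n : SSet) ⊗ Δ[1] ⟶ K}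
    (h : 𝓕.Fills f n γ) : ∃ γ', 𝓕.Fills f (n + 1) γ' ∧
      SSet.Subcomplex.homOfLE (𝓕.le_succ n) ≫ endpt _ 0 ≫ γ' = endpt _ 0 ≫ γ := by
  obtain ⟨γ₁, h₁⟩ := 𝓕.exists_fills f (n + 1)
  obtain ⟨D, hD0, hD1, hDA⟩ := h.exists_homotopy h₁
  -- extend the homotopy `D` to the next stage, constantly on `A`
  let P : (𝓕.F (n + 1) : SSet).Subcomplex := (𝓕.F n).preimage (𝓕.F (n + 1)).ι ⊔ 𝓕.inter (n + 1)
  let i : (𝓕.F n : SSet) ⟶ (P : SSet) :=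
    SSet.Subcomplex.lift (SSet.Subcomplex.homOfLE (𝓕.le_succ n)) (by
      rintro m _ ⟨x, rfl⟩; exact Or.inl x.2)
  let j : (𝓕.inter (n + 1) : SSet) ⟶ (P : SSet) := SSet.Subcomplex.homOfLE le_sup_right
  obtain ⟨b, hb1, hb2⟩ := exists_glue (i ▷ Δ[1]) (j ▷ Δ[1])
    (fun m x x' hx => Prod.ext (Subtype.ext (congrArg (fun y => y.1.1.1) hx))
      (congrArg (fun y => y.2) hx))
    (fun m x x' hx => Prod.ext (Subtype.ext (congrArg (fun y => y.1.1) hx))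
      (congrArg (fun y => y.2) hx))
    (fun m ⟨⟨x, hx⟩, t⟩ => by
      rcases hx with hx | hx
      · exact Or.inl ⟨(⟨x.1, hx⟩, t), rfl⟩
      · exact Or.inr ⟨(⟨x, hx⟩, t), rfl⟩)
    D (fst _ _ ≫ 𝓕.interι (n + 1) ≫ f) (fun m ⟨x, t⟩ ⟨y, t'⟩ hxy => by
      have e1 : x.1 = y.1.1 := congrArg (fun y => y.1.1.1) hxy
      have e2 : t = t' := congrArg (fun y => y.2) hxy
      subst e2
      have hx : x.1 ∈ A.obj m := e1 ▸ y.2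
      refine (app_congr hDA ((⟨x, hx⟩ : (𝓕.inter n : SSet).obj m), t)).trans ?_
      exact congrArg (f.app m) (Subtype.ext e1))
  obtain ⟨D', hD'0, hD'P⟩ := exists_homotopy_extension P 0 (endpt _ 0 ≫ γ₁) b (by
    ext m ⟨x, hx⟩
    rcases hx with hx | hx
    · refine (app_congr hb1 ((⟨x.1, hx⟩ : (𝓕.F n : SSet).obj m), vtx 0 m)).trans ?_
      exact app_congr hD0 (⟨x.1, hx⟩ : (𝓕.F n : SSet).obj m)
    · refine (app_congr hb2 ((⟨x, hx⟩ : (𝓕.inter (n + 1) : SSet).obj m), vtx 0 m)).trans ?_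
      exact (h₁.app_zero x hx).symm)
  have hD'F : SSet.Subcomplex.homOfLE (𝓕.le_succ n) ▷ Δ[1] ≫ D' = D :=
    (congrArg (i ▷ Δ[1] ≫ ·) hD'P).trans hb1
  have hD'A : (𝓕.inter (n + 1)).ι ▷ Δ[1] ≫ D' = fst _ _ ≫ 𝓕.interι (n + 1) ≫ f :=
    (congrArg (j ▷ Δ[1] ≫ ·) hD'P).trans hb2
  -- move the starting point of the filling `γ₁` along `D'`
  obtain ⟨E, -, hE0, hE1, hE2⟩ := exists_homotopy_extension_ends (𝓕.inter (n + 1)) 0 γ₁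
    D' (fst _ _ ≫ 𝓕.endMap (n + 1) ≫ f) (fst _ _ ≫ 𝓕.interH (n + 1) ≫ f)
    hD'0.symm h₁.1 h₁.2.symm (by rw [hD'A, ← endpt_zero_interH]; rfl) rfl
  refine ⟨endpt _ 1 ≫ E, ⟨?_, ?_⟩, ?_⟩
  · rw [endpt_endpt, hE1]; rfl
  · exact congrArg (endpt _ 1 ≫ ·) hE2
  · rw [endpt_endpt, hE0, ← hD1, ← hD'F]; rfl

variable (𝓕)

/-- Maps from `A` to a Kan complex extend to `B`. -/
theorem exists_extension (𝓕 : DeformingFiltration A) (f : (A : SSet) ⟶ K) :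
    ∃ g : B ⟶ K, A.ι ≫ g = f := by
  have : ∀ n, Nonempty ((𝓕.F n : SSet) ⊗ Δ[1] ⟶ K) := fun n => ⟨(𝓕.exists_fills f n).choose⟩
  choose! next hnext using fun n (γ : (𝓕.F n : SSet) ⊗ Δ[1] ⟶ K) (h : 𝓕.Fills f n γ) =>
    h.exists_succ
  let Γ : ∀ n, (𝓕.F n : SSet) ⊗ Δ[1] ⟶ K :=
    Nat.rec (𝓕.exists_fills f 0).choose (fun n γ => next n γ)
  have hΓ : ∀ n, 𝓕.Fills f n (Γ n) := by
    intro n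
    induction n with
    | zero => exact (𝓕.exists_fills f 0).choose_spec
    | succ n ih => exact (hnext n _ ih).1
  have hs : ∀ n m (b : B.obj m) (h : b ∈ (𝓕.F n).obj m) (h' : b ∈ (𝓕.F (n + 1)).obj m),
      (Γ (n + 1)).app m (⟨b, h'⟩, vtx 0 m) = (Γ n).app m (⟨b, h⟩, vtx 0 m) := fun n m b h _ =>
    app_congr (hnext n _ (hΓ n)).2 (⟨b, h⟩ : (𝓕.F n : SSet).obj m)
  have hle : ∀ n d m (b : B.obj m) (h : b ∈ (𝓕.F n).obj m) (h' : b ∈ (𝓕.F (n + d)).obj m),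
      (Γ (n + d)).app m (⟨b, h'⟩, vtx 0 m) = (Γ n).app m (⟨b, h⟩, vtx 0 m) := by
    intro n d m b h
    induction d with
    | zero => exact fun _ => rfl
    | succ d ih =>
      intro h'
      have h2 : b ∈ (𝓕.F (n + d)).obj m :=
        monotone_nat_of_le_succ 𝓕.le_succ (Nat.le_add_right n d) _ h
      rw [← ih h2]
      exact hs _ _ _ _ _
  -- the starting points of the compatible fillings `Γ n` glue
  obtain ⟨g, hg⟩ := exists_glue_family (fun n => (𝓕.F n).ι)
    (fun m b => (𝓕.exhaustive m b).imp fun n h => ⟨⟨b, h⟩, rfl⟩)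
    (fun n => endpt _ 0 ≫ Γ n) (fun m k k' p p' hp => by
      obtain ⟨p, h⟩ := p
      obtain ⟨p', h'⟩ := p'
      obtain rfl : p = p' := hp
      rcases Nat.le_total k k' with hk | hk
      · obtain ⟨d, rfl⟩ := Nat.exists_eq_add_of_le hk
        exact (hle _ _ _ _ _ _).symm
      · obtain ⟨d, rfl⟩ := Nat.exists_eq_add_of_le hk
        exact hle _ _ _ _ _ _)
  refine ⟨g, ?_⟩
  ext m ⟨x, hx⟩
  obtain ⟨n, hn⟩ := 𝓕.exhaustive m x
  exact (app_congr (hg n) (⟨x, hn⟩ : (𝓕.F n : SSet).obj m)).trans ((hΓ n).app_zero ⟨x, hn⟩ hx)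

/-- The product of a deforming filtration of `(B, A)` with a pair `(Y, T)`. -/
def unionProd {Y : SSet.{u}} (T : Y.Subcomplex) : DeformingFiltration (A.unionProd T) where
  F n := (𝓕.F n).prod ⊤
  le_succ n := SSet.Subcomplex.prod_monotone (𝓕.le_succ n) le_rfl
  exhaustive m b := (𝓕.exhaustive m b.1).imp fun n h => ⟨h, trivial⟩
  H n := SSet.Subcomplex.lift
    (CartesianMonoidalCategory.lift
      (((SSet.Subcomplex.prodIso (𝓕.F n) ⊤).hom ≫ fst _ _) ▷ Δ[1] ≫ 𝓕.H n ≫ (𝓕.F (n + 1)).ι)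
      (fst _ _ ≫ ((𝓕.F n).prod ⊤).ι ≫ snd _ _)) (by
        rintro m _ ⟨x, rfl⟩
        exact ⟨((𝓕.H n).app m (⟨x.1.1.1, x.1.2.1⟩, x.2)).2, trivial⟩)
  H_zero n m x := Prod.ext (𝓕.H_zero n m ⟨x.1.1, x.2.1⟩) rfl
  H_one n m x := (SSet.Subcomplex.mem_unionProd_iff _ _ _).2
    (Or.inr (𝓕.H_one n m ⟨x.1.1, x.2.1⟩))
  H_mem n m x t hx := (SSet.Subcomplex.mem_unionProd_iff _ _ _).2
    (((SSet.Subcomplex.mem_unionProd_iff _ _ _).1 hx).imp id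
      (fun h => 𝓕.H_mem n m ⟨x.1.1, x.2.1⟩ t h))

end DeformingFiltration

end Simplicial

/-! ### Deforming filtrations give weak equivalences -/

section Simplicial

open MonoidalCategory CartesianMonoidalCategory Simplicial SSet.modelCategoryQuillen

lemma IsWeakEquiv.of_isIso {A B : SSet.{u}} (f : A ⟶ B) [IsIso f] : IsWeakEquiv f := by
  intro K _
  have : IsIso ((MonoidalClosed.pre f).app K) := by
    have : IsIso (MonoidalClosed.pre f) :=
      inferInstanceAs (IsIso (MonoidalClosed.internalHom.map f.op))
    infer_instance
  exact (isIso_iff_bijective (SSet.π₀Functor.map ((MonoidalClosed.pre f).app K))).1 inferInstance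

lemma IsWeakEquiv.comp {A B C : SSet.{u}} {f : A ⟶ B} {g : B ⟶ C} (hf : IsWeakEquiv f)
    (hg : IsWeakEquiv g) : IsWeakEquiv (f ≫ g) := by
  intro K hK
  rw [MonoidalClosed.pre_map, NatTrans.comp_app]
  have : SSet.mapπ₀ ((MonoidalClosed.pre g).app K ≫ (MonoidalClosed.pre f).app K) =
      SSet.mapπ₀ ((MonoidalClosed.pre f).app K) ∘ SSet.mapπ₀ ((MonoidalClosed.pre g).app K) := by
    funext x; exact SSet.mapπ₀_comp_apply _ _ x
  rw [this]
  exact (hf K hK).comp (hg K hK)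

/-- A map with the right lifting property with respect to the inclusions of boundaries is bijective
on connected components. -/
lemma bijective_mapπ₀ {E B : SSet.{u}} (p : E ⟶ B)
    (hp : ∀ n : ℕ, HasLiftingProperty (SSet.boundary.{u} n).ι p) :
    Function.Bijective (SSet.mapπ₀ p) := by
  -- vertices lift
  have surj : ∀ b : B _⦋0⦌, ∃ a, p.app (op ⦋0⦌) a = b := by
    intro b
    have := hp 0
    obtain ⟨c, -⟩ := exists_glue_family (ι := PEmpty.{1}) (P := PEmpty.elim)
      (Y := (SSet.boundary.{u} 0 : SSet)) (K := E) (fun k => k.elim)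
      (fun m ⟨y, h⟩ => by
        rw [SSet.boundary_zero] at h
        exact h.elim) (fun k => k.elim) (fun m k => k.elim)
    have sq : CommSq c (SSet.boundary.{u} 0).ι p (SSet.yonedaEquiv.symm b) :=
      ⟨SSet.boundary.hom_ext₀⟩
    refine ⟨SSet.yonedaEquiv sq.lift, ?_⟩
    rw [← SSet.yonedaEquiv_comp, sq.fac_right, Equiv.apply_symm_apply]
  -- edges lift with prescribed end points
  have edge : ∀ x y : E _⦋0⦌, SSet.Edge (p.app (op ⦋0⦌) x) (p.app (op ⦋0⦌) y) →
      SSet.π₀.mk x = SSet.π₀.mk y := by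
    intro x y e
    have := hp 1
    let v : Fin 2 → E _⦋0⦌ := fun j => if j = 0 then x else y
    let i : Fin 2 → (Δ[0] ⟶ (SSet.boundary.{u} 1 : SSet)) := fun j =>
      SSet.Subcomplex.lift (SSet.const (SSet.stdSimplex.obj₀Equiv.symm j)) (by
        rintro m _ ⟨z, rfl⟩; exact (mem_boundary_one _).2 ⟨j, rfl⟩)
    have hi : ∀ j m z, ((i j).app m z).1 = vtx j m := fun _ _ _ => rfl
    have surj_i : ∀ m (z : (SSet.boundary.{u} 1 : SSet).obj m), ∃ k q, (i k).app m q = z := by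
      rintro m ⟨z, hz⟩
      obtain ⟨j, rfl⟩ := (mem_boundary_one _).1 hz
      exact ⟨j, SSet.stdSimplex.const 0 0 m, Subtype.ext (hi j m _)⟩
    obtain ⟨c, hc⟩ := exists_glue_family i surj_i (fun j => SSet.const (v j))
      (fun m k k' q q' h => by
        obtain rfl := vtx_injective m (congrArg Subtype.val h)
        rfl)
    have hσ : ∀ j, i j ≫ (SSet.boundary.{u} 1).ι ≫ SSet.yonedaEquiv.symm e.edge =
        SSet.const (p.app _ (v j)) := by
      rw [Fin.forall_fin_two]
      constructor
      · change (SSet.const (SSet.stdSimplex.obj₀Equiv.symm 0) : Δ[0] ⟶ Δ[1]) ≫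
          SSet.yonedaEquiv.symm e.edge = _
        rw [← SSet.stdSimplex.δ_one_eq_const, SSet.stdSimplex.δ_comp_yonedaEquiv_symm, e.src_eq,
          SSet.yonedaEquiv_symm_zero]
        rfl
      · change (SSet.const (SSet.stdSimplex.obj₀Equiv.symm 1) : Δ[0] ⟶ Δ[1]) ≫
          SSet.yonedaEquiv.symm e.edge = _
        rw [← SSet.stdSimplex.δ_zero_eq_const, SSet.stdSimplex.δ_comp_yonedaEquiv_symm, e.tgt_eq,
          SSet.yonedaEquiv_symm_zero]
        rfl
    have sq : CommSq c (SSet.boundary.{u} 1).ι p (SSet.yonedaEquiv.symm e.edge) := by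
      constructor
      ext m z
      obtain ⟨j, q, rfl⟩ := surj_i m z
      refine (congrArg (p.app m) (app_congr (hc j) q)).trans ?_
      refine Eq.trans ?_ (app_congr (hσ j) q).symm
      rw [← SSet.const_comp]; rfl
    have hl : ∀ j, SSet.const (X := Δ[0]) (SSet.stdSimplex.obj₀Equiv.symm j) ≫ sq.lift =
        SSet.const (v j) := fun j =>
      (congrArg (i j ≫ ·) sq.fac_left).trans (hc j)
    refine SSet.π₀.sound (SSet.Edge.mk (SSet.yonedaEquiv sq.lift) ?_ ?_)
    · apply SSet.yonedaEquiv.symm.injective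
      rw [← SSet.stdSimplex.δ_comp_yonedaEquiv_symm, Equiv.symm_apply_apply,
        SSet.stdSimplex.δ_one_eq_const, hl, SSet.yonedaEquiv_symm_zero]
      rfl
    · apply SSet.yonedaEquiv.symm.injective
      rw [← SSet.stdSimplex.δ_comp_yonedaEquiv_symm, Equiv.symm_apply_apply,
        SSet.stdSimplex.δ_zero_eq_const, hl, SSet.yonedaEquiv_symm_zero]
      rfl
  -- chains of edges lift with prescribed end points
  have conn : ∀ b b' : B _⦋0⦌, Relation.EqvGen SSet.π₀Rel b b' → ∀ x y : E _⦋0⦌,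
      p.app _ x = b → p.app _ y = b' → SSet.π₀.mk x = SSet.π₀.mk y := by
    intro b b' h
    induction h with
    | rel b b' h =>
      rintro x y rfl rfl
      exact edge x y h.some
    | refl b =>
      rintro x y rfl h
      refine edge x y ?_
      rw [h]
      exact SSet.Edge.id _
    | symm b b' _ ih => exact fun x y hx hy => (ih y x hy hx).symm
    | trans b b' b'' _ _ ih ih' =>
      intro x y hx hy
      obtain ⟨z, hz⟩ := surj b'
      exact (ih x z hx hz).trans (ih' z y hz hy)
  constructor
  · intro x y h
    induction x with | mk x => ?_
    induction y with | mk y => ?_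
    rw [SSet.mapπ₀_mk, SSet.mapπ₀_mk, SSet.π₀.mk_eq_mk_iff] at h
    exact conn _ _ h x y rfl rfl
  · intro b
    induction b with | mk b => ?_
    obtain ⟨a, rfl⟩ := surj b
    exact ⟨SSet.π₀.mk a, SSet.mapπ₀_mk p a⟩

namespace DeformingFiltration

variable {B : SSet.{u}} {A : B.Subcomplex}

/-- By adjunction, this is the extension of maps from `A ⊗ Y ∪ B ⊗ T` to `B ⊗ Y`, where `B ⊗ Y` has
the product filtration. -/
lemma hasLiftingProperty_pre (𝓕 : DeformingFiltration A) (K : SSet.{u}) [SSet.KanComplex K]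
    {Y : SSet.{u}} (T : Y.Subcomplex) :
    HasLiftingProperty T.ι ((MonoidalClosed.pre A.ι).app K) := by
  let sq₁₃ := Functor.PullbackObjObj.ofIsTerminal
    MonoidalClosed.internalHom A.ι (terminal.from K) terminalIsTerminal
  change HasLiftingProperty T.ι sq₁₃.π
  rw [← MonoidalClosed.internalHomAdjunction₂.hasLiftingProperty_iff
    (SSet.Subcomplex.unionProd.pushoutObjObj A T)]
  refine ⟨fun {f g} sq => ?_⟩
  obtain ⟨l, hl⟩ := (𝓕.unionProd T).exists_extension f
  exact ⟨⟨⟨l, hl, Subsingleton.elim _ _⟩⟩⟩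

lemma isWeakEquiv_ι (𝓕 : DeformingFiltration A) : IsWeakEquiv A.ι := fun K _ =>
  bijective_mapπ₀ _ fun _ => 𝓕.hasLiftingProperty_pre K _

/-- A monomorphism whose image admits a deforming filtration is a weak equivalence. -/
lemma isWeakEquiv {A' : SSet.{u}} (f : A' ⟶ B) [Mono f]
    (𝓕 : DeformingFiltration (SSet.Subcomplex.range f)) : IsWeakEquiv f := by
  have h : IsWeakEquiv (SSet.Subcomplex.toRange f) := .of_isIso _
  have h' := h.comp 𝓕.isWeakEquiv_ι
  rwa [SSet.Subcomplex.toRange_ι] at h'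

end DeformingFiltration

end Simplicial

/-! ### Coproducts of schemes -/

section coproducts

variable {U V W P T : Scheme.{u}}

lemma etale_coprodDesc (f : U ⟶ W) (g : V ⟶ W) (hf : Etale f) (hg : Etale g) :
    Etale (coprod.desc f g) := by
  have : IsZariskiLocalAtSource @Etale :=
    HasRingHomProperty.instIsZariskiLocalAtSource (Q := RingHom.Etale)
  refine IsZariskiLocalAtSource.of_openCover (P := @Etale) (coprodOpenCover.{u, u} U V) ?_
  rintro (_ | _)
  · exact (coprod.inl_desc f g).symm ▸ hf
  · exact (coprod.inr_desc f g).symm ▸ hg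

lemma coprod_cases (x : ↥(U ⨿ V)) :
    (∃ y : U, (coprod.inl : U ⟶ U ⨿ V) y = x) ∨ ∃ y : V, (coprod.inr : V ⟶ U ⨿ V) y = x := by
  have := (isCompl_range_inl_inr U V).sup_eq_top
  have hx : x ∈ (⊤ : Set ↥(U ⨿ V)) := trivial
  rw [← this] at hx
  exact hx

lemma pb_coprod_ext {s t : Γ(U ⨿ V, ⊤)}
    (h₁ : pb (coprod.inl : U ⟶ U ⨿ V) s = pb (coprod.inl : U ⟶ U ⨿ V) t)
    (h₂ : pb (coprod.inr : V ⟶ U ⨿ V) s = pb (coprod.inr : V ⟶ U ⨿ V) t) : s = t := by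
  -- functions are morphisms to the affine line
  have : Aff.lift (n := 1) (𝟙 _) (fun _ => s) = Aff.lift (𝟙 _) (fun _ => t) := by
    apply coprod.hom_ext <;> apply Aff.hom_ext
    · simp only [Category.assoc, Aff.lift_proj]
    · intro i
      rw [pb_comp, pb_comp, Aff.pb_lift_coord, Aff.pb_lift_coord, h₁]
    · simp only [Category.assoc, Aff.lift_proj]
    · intro i
      rw [pb_comp, pb_comp, Aff.pb_lift_coord, Aff.pb_lift_coord, h₂]
  have h2 := congrArg (fun F => pb F (Aff.coord _ 0)) this
  simpa only [Aff.pb_lift_coord] using h2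

lemma exists_pb_coprod {n : ℕ} (φ : Fin n → Γ(U, ⊤)) (ψ : Fin n → Γ(V, ⊤)) :
    ∃ χ : Fin n → Γ(U ⨿ V, ⊤), (∀ i, pb (coprod.inl : U ⟶ U ⨿ V) (χ i) = φ i) ∧
      ∀ i, pb (coprod.inr : V ⟶ U ⨿ V) (χ i) = ψ i :=
  ⟨fun i => pb (coprod.desc (Aff.lift coprod.inl φ) (Aff.lift coprod.inr ψ)) (Aff.coord (U ⨿ V) i),
    fun i => by rw [← pb_comp, coprod.inl_desc, Aff.pb_lift_coord],
    fun i => by rw [← pb_comp, coprod.inr_desc, Aff.pb_lift_coord]⟩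

lemma exists_lift_inl (a : P ⟶ U ⨿ V) (h : ∀ x y, a x ≠ (coprod.inr : V ⟶ U ⨿ V) y) :
    ∃ l : P ⟶ U, l ≫ coprod.inl = a := by
  refine ⟨IsOpenImmersion.lift coprod.inl a ?_, IsOpenImmersion.lift_fac _ _ _⟩
  rintro _ ⟨x, rfl⟩
  exact (coprod_cases (a x)).resolve_right fun ⟨y, hy⟩ => h x y hy.symm

lemma exists_lift_inr (a : P ⟶ U ⨿ V) (h : ∀ x y, a x ≠ (coprod.inl : U ⟶ U ⨿ V) y) :
    ∃ l : P ⟶ V, l ≫ coprod.inr = a := by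
  refine ⟨IsOpenImmersion.lift coprod.inr a ?_, IsOpenImmersion.lift_fac _ _ _⟩
  rintro _ ⟨x, rfl⟩
  exact (coprod_cases (a x)).resolve_left fun ⟨y, hy⟩ => h x y hy.symm

/-- Morphisms out of a scheme `P` with a map to a coproduct can be compared over the two
summands. -/
lemma hom_ext_over_coprod (t : P ⟶ U ⨿ V) {a b : P ⟶ T}
    (h₁ : ∀ {Q : Scheme.{u}} (f : Q ⟶ P) (s : Q ⟶ U), f ≫ t = s ≫ coprod.inl → f ≫ a = f ≫ b)
    (h₂ : ∀ {Q : Scheme.{u}} (f : Q ⟶ P) (s : Q ⟶ V), f ≫ t = s ≫ coprod.inr → f ≫ a = f ≫ b) :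
    a = b := by
  refine Scheme.Cover.hom_ext (P.openCoverOfIsOpenCover
    (fun k : Bool => t ⁻¹ᵁ (if k then (coprod.inl : U ⟶ U ⨿ V).opensRange else
      (coprod.inr : V ⟶ U ⨿ V).opensRange)) ?_) _ _ ?_
  · refine .mk ?_
    rw [eq_top_iff]
    intro x _
    rw [Opens.mem_iSup]
    rcases coprod_cases (t x) with h | h
    · exact ⟨true, h⟩
    · exact ⟨false, h⟩
  · rintro (_ | _)
    · obtain ⟨l, hl⟩ := exists_lift_inr ((t ⁻¹ᵁ (coprod.inr : V ⟶ U ⨿ V).opensRange).ι ≫ t)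
        (fun x y h => by
          obtain ⟨z, hz⟩ := x.2
          exact inl_ne_inr _ _ y z (h.symm.trans hz.symm))
      exact h₂ _ l hl.symm
    · obtain ⟨l, hl⟩ := exists_lift_inl ((t ⁻¹ᵁ (coprod.inl : U ⟶ U ⨿ V).opensRange).ι ≫ t)
        (fun x y h => by
          obtain ⟨z, hz⟩ := x.2
          exact inl_ne_inr _ _ z y (hz.trans h))
      exact h₁ _ l hl.symm

/-- Two monomorphisms with disjoint images define a monomorphism on the coproduct. -/
lemma mono_coprodDesc (i : U ⟶ W) (j : V ⟶ W) [Mono i] [Mono j] (h : ∀ x y, i x ≠ j y) :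
    Mono (coprod.desc i j) := by
  constructor
  intro P a b e
  have hx : ∀ x, coprod.desc i j (a x) = coprod.desc i j (b x) := fun x => by
    rw [← Scheme.Hom.comp_apply, e, Scheme.Hom.comp_apply]
  have hl : ∀ u : U, coprod.desc i j ((coprod.inl : U ⟶ U ⨿ V) u) = i u := fun u => by
    rw [← Scheme.Hom.comp_apply, coprod.inl_desc]
  have hr : ∀ v : V, coprod.desc i j ((coprod.inr : V ⟶ U ⨿ V) v) = j v := fun v => by
    rw [← Scheme.Hom.comp_apply, coprod.inr_desc]
  apply hom_ext_over_coprod a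
  · intro Q f s hf
    obtain ⟨l, hl'⟩ := exists_lift_inl (f ≫ b) (fun x y hxy => by
      refine h (s x) y ?_
      rw [← hl, ← hr, ← hxy, Scheme.Hom.comp_apply, ← hx, ← Scheme.Hom.comp_apply f, hf,
        Scheme.Hom.comp_apply])
    have e' := congrArg (f ≫ ·) e
    simp only [← Category.assoc] at e'
    rw [hf, ← hl', Category.assoc, Category.assoc, coprod.inl_desc, cancel_mono] at e'
    rw [hf, ← hl', e']
  · intro Q f s hf
    obtain ⟨l, hl'⟩ := exists_lift_inr (f ≫ b) (fun x y hxy => by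
      refine h y (s x) ?_
      rw [← hl, ← hr, ← hxy, Scheme.Hom.comp_apply, ← hx, ← Scheme.Hom.comp_apply f, hf,
        Scheme.Hom.comp_apply])
    have e' := congrArg (f ≫ ·) e
    simp only [← Category.assoc] at e'
    rw [hf, ← hl', Category.assoc, Category.assoc, coprod.inr_desc, cancel_mono] at e'
    rw [hf, ← hl', e']

lemma isClosedImmersion_coprodDesc (i : U ⟶ W) (j : V ⟶ W) [IsClosedImmersion i]
    [IsClosedImmersion j] (h : ∀ x y, i x ≠ j y) : IsClosedImmersion (coprod.desc i j) := by
  have := mono_coprodDesc i j h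
  -- a finite monomorphism is a closed immersion
  rw [IsClosedImmersion.iff_isFinite_and_mono]
  exact ⟨inferInstance, inferInstance⟩

end coproducts

/-! ### Correspondences to a disjoint union -/

section projections

variable {S : Scheme.{u}} {n : ℕ} {X Y₁ Y₂ : Over S}

lemma levelZero_toX {X Y : Over S} {U : Scheme.{u}} (j : U ⟶ X.left) [IsOpenImmersion j]
    [IsClosedImmersion j] (g : U ⟶ Y.left) (w : g ≫ Y.hom = j ≫ X.hom) :
    (levelZero j g w).toX = j := by
  change (j ≫ inv (Aff.proj 0 X.left)) ≫ Aff.proj 0 X.left = j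
  rw [Category.assoc, IsIso.inv_hom_id, Category.comp_id]

lemma projLeft_toX : (projLeft Y₁ Y₂).toX = disjInl Y₁ Y₂ := levelZero_toX _ _ _

lemma projRight_toX : (projRight Y₁ Y₂).toX = disjInr Y₁ Y₂ := levelZero_toX _ _ _

lemma disj_cases (y : (disj Y₁ Y₂).left) :
    (∃ z, disjInl Y₁ Y₂ z = y) ∨ ∃ z, disjInr Y₁ Y₂ z = y := coprod_cases y

lemma disjInl_ne_disjInr (y : Y₁.left) (z : Y₂.left) : disjInl Y₁ Y₂ y ≠ disjInr Y₁ Y₂ z :=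
  inl_ne_inr _ _ y z

namespace ExplicitCorr

/-- The support of a correspondence of level zero is its whole étale neighbourhood. -/
lemma mem_range_sec_zero {X Y : Over S} (Ψ : ExplicitCorr 0 X Y) (v : Ψ.U) :
    v ∈ Set.range Ψ.sec := by
  rw [← framing']; exact fun i => i.elim0

section
variable {Y Y' : Over S} (Φ : ExplicitCorr n X Y) (Ψ : ExplicitCorr 0 Y Y')

lemma comp_p_zero : (Φ.comp Ψ).p = Φ.compFst Ψ ≫ Φ.p := by
  apply Aff.hom_ext
  · rw [comp_p_proj, Category.assoc]
    rfl
  · intro i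
    rw [pb_comp]
    exact comp_p_left Φ Ψ i

lemma comp_φ_zero (i : Fin n) : (Φ.comp Ψ).φ i = pb (Φ.compFst Ψ) (Φ.φ i) :=
  comp_φ_left Φ Ψ i

lemma mem_range_sec_comp_zero (u : (Φ.comp Ψ).U) :
    u ∈ Set.range (Φ.comp Ψ).sec ↔ Φ.compFst Ψ u ∈ Set.range Φ.sec := by
  rw [mem_range_sec_comp]
  exact and_iff_left (mem_range_sec_zero Ψ _)

end

/-- The étale neighbourhood of the first component of a correspondence to `Y₁ ⊔ Y₂` is the inverse
image of `Y₁`. -/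
lemma compLeft_sq (Φ : ExplicitCorr n X (disj Y₁ Y₂)) :
    IsPullback (Φ.compFst (projLeft Y₁ Y₂)) (Φ.comp (projLeft Y₁ Y₂)).g Φ.g (disjInl Y₁ Y₂) := by
  have h := Φ.comp_sq (projLeft Y₁ Y₂)
  rw [projLeft_toX] at h
  have : (Φ.comp (projLeft Y₁ Y₂)).g = Φ.compSnd (projLeft Y₁ Y₂) := Category.comp_id _
  rwa [this]

/-- The étale neighbourhood of the second component of a correspondence to `Y₁ ⊔ Y₂` is the inverse
image of `Y₂`. -/
lemma compRight_sq (Φ : ExplicitCorr n X (disj Y₁ Y₂)) :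
    IsPullback (Φ.compFst (projRight Y₁ Y₂)) (Φ.comp (projRight Y₁ Y₂)).g Φ.g
      (disjInr Y₁ Y₂) := by
  have h := Φ.comp_sq (projRight Y₁ Y₂)
  rw [projRight_toX] at h
  have : (Φ.comp (projRight Y₁ Y₂)).g = Φ.compSnd (projRight Y₁ Y₂) := Category.comp_id _
  rwa [this]

instance (Φ : ExplicitCorr n X (disj Y₁ Y₂)) :
    IsOpenImmersion (Φ.compFst (projLeft Y₁ Y₂)) :=
  MorphismProperty.of_isPullback Φ.compLeft_sq.flip inferInstance

instance (Φ : ExplicitCorr n X (disj Y₁ Y₂)) :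
    IsOpenImmersion (Φ.compFst (projRight Y₁ Y₂)) :=
  MorphismProperty.of_isPullback Φ.compRight_sq.flip inferInstance

/-- A correspondence to a disjoint union is determined by its two components: its étale
neighbourhood is the disjoint union of theirs, so that common refinements of the étale
neighbourhoods of the components add up. -/
lemma rel_of_rel_proj {Φ Ψ : ExplicitCorr n X (disj Y₁ Y₂)}
    (h₁ : Rel (Φ.comp (projLeft Y₁ Y₂)) (Ψ.comp (projLeft Y₁ Y₂)))
    (h₂ : Rel (Φ.comp (projRight Y₁ Y₂)) (Ψ.comp (projRight Y₁ Y₂))) : Rel Φ Ψ := by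
  obtain ⟨V₁, a₁, b₁, ha₁, -, hp₁, hg₁, hφ₁, sa₁, sb₁⟩ := h₁.elim
  obtain ⟨V₂, a₂, b₂, ha₂, -, hp₂, hg₂, hφ₂, sa₂, sb₂⟩ := h₂.elim
  -- maps covering the supports of the components together cover the support
  have cover : ∀ (Θ : ExplicitCorr n X (disj Y₁ Y₂)) (c₁ : V₁ ⟶ (Θ.comp (projLeft Y₁ Y₂)).U)
      (c₂ : V₂ ⟶ (Θ.comp (projRight Y₁ Y₂)).U),
      (∀ u, u ∈ Set.range (Θ.comp (projLeft Y₁ Y₂)).sec → u ∈ Set.range c₁) →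
      (∀ u, u ∈ Set.range (Θ.comp (projRight Y₁ Y₂)).sec → u ∈ Set.range c₂) →
      ∀ u, u ∈ Set.range Θ.sec → u ∈ Set.range
        (coprod.desc (c₁ ≫ Θ.compFst (projLeft Y₁ Y₂)) (c₂ ≫ Θ.compFst (projRight Y₁ Y₂))) := by
    intro Θ c₁ c₂ s₁ s₂ u hu
    rcases disj_cases (Θ.g u) with ⟨y, hy⟩ | ⟨y, hy⟩
    · obtain ⟨w, rfl, -⟩ := exists_preimage Θ.compLeft_sq u y hy.symm
      obtain ⟨v, rfl⟩ := s₁ w ((mem_range_sec_comp_zero Θ _ w).2 hu)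
      refine ⟨(coprod.inl : V₁ ⟶ V₁ ⨿ V₂) v, ?_⟩
      rw [← Scheme.Hom.comp_apply, coprod.inl_desc, Scheme.Hom.comp_apply]
    · obtain ⟨w, rfl, -⟩ := exists_preimage Θ.compRight_sq u y hy.symm
      obtain ⟨v, rfl⟩ := s₂ w ((mem_range_sec_comp_zero Θ _ w).2 hu)
      refine ⟨(coprod.inr : V₂ ⟶ V₁ ⨿ V₂) v, ?_⟩
      rw [← Scheme.Hom.comp_apply, coprod.inr_desc, Scheme.Hom.comp_apply]
  rw [comp_p_zero, comp_p_zero] at hp₁ hp₂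
  refine Rel.of
    (coprod.desc (a₁ ≫ Φ.compFst (projLeft Y₁ Y₂)) (a₂ ≫ Φ.compFst (projRight Y₁ Y₂)))
    (coprod.desc (b₁ ≫ Ψ.compFst (projLeft Y₁ Y₂)) (b₂ ≫ Ψ.compFst (projRight Y₁ Y₂)))
    (etale_coprodDesc _ _ (etale_trans _ _ ha₁ inferInstance)
      (etale_trans _ _ ha₂ inferInstance)) ?_ ?_ ?_ (cover Φ a₁ a₂ sa₁ sa₂)
    (cover Ψ b₁ b₂ sb₁ sb₂)
  · apply coprod.hom_ext
    · rw [coprod.inl_desc_assoc, coprod.inl_desc_assoc, Category.assoc, hp₁, Category.assoc]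
    · rw [coprod.inr_desc_assoc, coprod.inr_desc_assoc, Category.assoc, hp₂, Category.assoc]
  · apply coprod.hom_ext
    · rw [coprod.inl_desc_assoc, coprod.inl_desc_assoc, Category.assoc, Category.assoc,
        Φ.compLeft_sq.w, Ψ.compLeft_sq.w, ← Category.assoc, hg₁, Category.assoc]
    · rw [coprod.inr_desc_assoc, coprod.inr_desc_assoc, Category.assoc, Category.assoc,
        Φ.compRight_sq.w, Ψ.compRight_sq.w, ← Category.assoc, hg₂, Category.assoc]
  · intro i
    have e₁ := hφ₁ i
    have e₂ := hφ₂ i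
    rw [comp_φ_zero, comp_φ_zero] at e₁ e₂
    apply pb_coprod_ext
    · rw [← pb_comp, ← pb_comp, coprod.inl_desc, coprod.inl_desc, pb_comp, pb_comp]
      exact e₁
    · rw [← pb_comp, ← pb_comp, coprod.inr_desc, coprod.inr_desc, pb_comp, pb_comp]
      exact e₂

/-- The two components of a correspondence to a disjoint union have disjoint supports. -/
lemma disjoint_proj (Φ : ExplicitCorr n X (disj Y₁ Y₂)) :
    Disjoint ((Φ.comp (projLeft Y₁ Y₂)).Z : Set (Aff n X.left))
      ((Φ.comp (projRight Y₁ Y₂)).Z : Set (Aff n X.left)) := by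
  rw [Set.disjoint_left]
  intro z h₁ h₂
  obtain ⟨u₁, e₁⟩ := (Φ.comp (projLeft Y₁ Y₂)).exists_point h₁
  obtain ⟨u₂, e₂⟩ := (Φ.comp (projRight Y₁ Y₂)).exists_point h₂
  have hu := (mem_range_sec_comp_zero Φ _ u₁).1
    ((mem_range_sec _ _).2 (by rw [e₁]; exact h₁))
  rw [comp_p_zero, Scheme.Hom.comp_apply] at e₁ e₂
  have h := Φ.p_sec_inj ((Φ.mem_range_sec _).1 hu) (e₁.trans e₂.symm)
  refine disjInl_ne_disjInr (Y₁ := Y₁) (Y₂ := Y₂) ((Φ.comp (projLeft Y₁ Y₂)).g u₁)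
    ((Φ.comp (projRight Y₁ Y₂)).g u₂) ?_
  rw [← Scheme.Hom.comp_apply, ← Φ.compLeft_sq.w, Scheme.Hom.comp_apply, h,
    ← Scheme.Hom.comp_apply, Φ.compRight_sq.w, Scheme.Hom.comp_apply]

end ExplicitCorr

end projections

/-! ### Correspondences with disjoint supports -/

namespace ExplicitCorr

variable {S : Scheme.{u}} {n : ℕ} {X Y Y₁ Y₂ : Over S}

section restrict

variable (Φ : ExplicitCorr n X Y) {W : Scheme.{u}} (j : W ⟶ Φ.U) [IsOpenImmersion j]
  (h : ∀ u, u ∈ Set.range Φ.sec → u ∈ Set.range j)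

/-- The explicit correspondence obtained by shrinking the étale neighbourhood to an open
subscheme containing the support. -/
def restrict : ExplicitCorr n X Y where
  Z := Φ.Z
  finite := Φ.finite
  U := W
  p := j ≫ Φ.p
  etale := inferInstance
  nbhd := by
    have hl : IsOpenImmersion.lift j Φ.sec (by rintro _ ⟨x, rfl⟩; exact h _ ⟨x, rfl⟩) ≫ j =
        Φ.sec := IsOpenImmersion.lift_fac _ _ _
    refine red_nbhd (i := redι Φ.Z) (isPullback_section (by
      rw [← Category.assoc, hl, Φ.sec_p]) fun a t e => ?_) _ (range_redι _).symm
    rw [← cancel_mono j, Category.assoc, hl]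
    exact isPullback_section_elim Φ.sec_isPullback _ _ (by rw [Category.assoc, e])
  φ i := pb j (Φ.φ i)
  framing u := by
    rw [Scheme.Hom.comp_apply, ← Φ.framing]
    exact forall_congr' fun i => not_congr (mem_basicOpen_pb _ _ _)
  generic u hu i := by
    rw [mem_basicOpen_pb]
    refine Φ.generic _ (fun v hv hs => ?_) i
    -- open subsets are stable under generization
    obtain ⟨w, rfl⟩ := hs.mem_open j.isOpenEmbedding.isOpen_range ⟨u, rfl⟩
    rw [hu w (by simpa using hv) (j.isOpenEmbedding.isInducing.specializes_iff.1 hs)]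
  g := j ≫ Φ.g
  w := by rw [Category.assoc, Φ.w]; simp only [Category.assoc]

lemma rel_restrict : Rel (Φ.restrict j h) Φ :=
  Rel.of (𝟙 _) j inferInstance (Category.id_comp _) (Category.id_comp _)
    (fun i => by rw [pb, Scheme.Hom.id_appTop]; rfl) (fun u _ => ⟨u, rfl⟩) h

end restrict

/-- Every correspondence is equivalent to one whose étale neighbourhood lies over a given open
neighbourhood of the support. -/
lemma exists_restrict (Φ : ExplicitCorr n X Y) (O : (Aff n X.left).Opens)
    (hO : ∀ z ∈ Φ.Z, z ∈ O) :
    ∃ Ψ : ExplicitCorr n X Y, Ψ.Z = Φ.Z ∧ Rel Ψ Φ ∧ ∀ u, Ψ.p u ∈ O := by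
  have h : ∀ u, u ∈ Set.range Φ.sec → u ∈ Set.range (Φ.p ⁻¹ᵁ O).ι := fun u hu => by
    rw [Scheme.Opens.range_ι]
    exact hO _ ((Φ.mem_range_sec u).1 hu)
  refine ⟨Φ.restrict _ h, rfl, Φ.rel_restrict _ h, fun u => ?_⟩
  exact u.2

section sum

variable (Φ₁ : ExplicitCorr n X Y₁) (Φ₂ : ExplicitCorr n X Y₂)

lemma isGenericInFiber_of_isOpenImmersion {U V T : Scheme.{u}} (j : U ⟶ V) [IsOpenImmersion j]
    (f : V ⟶ T) (u : U) (hu : IsGenericInFiber f (j u)) : IsGenericInFiber (j ≫ f) u :=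
  fun v hv hs => j.isOpenEmbedding.injective
    (hu _ (by simpa using hv) (hs.map j.continuous))

/-- The sum of two explicit correspondences to `Y₁` and `Y₂`, as a correspondence to `Y₁ ⊔ Y₂`,
whose étale neighbourhood is the disjoint union. For this to be a neighbourhood of the union of
the supports, the support of each has to miss the neighbourhood of the other. -/
def sum (h₁ : ∀ u, Φ₁.p u ∉ Φ₂.Z) (h₂ : ∀ u, Φ₂.p u ∉ Φ₁.Z) :
    ExplicitCorr n X (disj Y₁ Y₂) :=
  have hχ := exists_pb_coprod Φ₁.φ Φ₂.φ
  have hl : ∀ u : Φ₁.U, coprod.desc Φ₁.p Φ₂.p ((coprod.inl : Φ₁.U ⟶ Φ₁.U ⨿ Φ₂.U) u) = Φ₁.p u :=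
    fun u => by rw [← Scheme.Hom.comp_apply, coprod.inl_desc]
  have hr : ∀ u : Φ₂.U, coprod.desc Φ₁.p Φ₂.p ((coprod.inr : Φ₂.U ⟶ Φ₁.U ⨿ Φ₂.U) u) = Φ₂.p u :=
    fun u => by rw [← Scheme.Hom.comp_apply, coprod.inr_desc]
  have hZ₁ : ∀ t, redι Φ₁.Z t ∈ Φ₁.Z := fun t => by
    have : redι Φ₁.Z t ∈ (Φ₁.Z : Set _) := by rw [← range_redι]; exact ⟨t, rfl⟩
    exact this
  have hZ₂ : ∀ t, redι Φ₂.Z t ∈ Φ₂.Z := fun t => by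
    have : redι Φ₂.Z t ∈ (Φ₂.Z : Set _) := by rw [← range_redι]; exact ⟨t, rfl⟩
    exact this
  have hi : IsClosedImmersion (coprod.desc (redι Φ₁.Z) (redι Φ₂.Z)) :=
    isClosedImmersion_coprodDesc _ _ (fun x y e => h₁ (Φ₁.sec x) (by
      rw [← Scheme.Hom.comp_apply, Φ₁.sec_p, e]; exact hZ₂ y))
  ofSection (T := red Φ₁.Z ⨿ red Φ₂.Z) (coprod.desc (redι Φ₁.Z) (redι Φ₂.Z))
    (coprod.desc Φ₁.p Φ₂.p) (coprod.desc (Φ₁.sec ≫ coprod.inl) (Φ₂.sec ≫ coprod.inr))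
    hi
    (by rw [coprod.desc_comp]; infer_instance)
    (etale_coprodDesc _ _ inferInstance inferInstance)
    (isPullback_section (by
      apply coprod.hom_ext
      · rw [coprod.inl_desc_assoc, coprod.inl_desc, Category.assoc, coprod.inl_desc, Φ₁.sec_p]
      · rw [coprod.inr_desc_assoc, coprod.inr_desc, Category.assoc, coprod.inr_desc, Φ₂.sec_p])
      (by
        intro P a t e
        have ex : ∀ x, coprod.desc Φ₁.p Φ₂.p (a x) = coprod.desc (redι Φ₁.Z) (redι Φ₂.Z) (t x) :=
          fun x => by rw [← Scheme.Hom.comp_apply, e, Scheme.Hom.comp_apply]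
        apply hom_ext_over_coprod t
        · intro Q f s hs
          obtain ⟨l, hl'⟩ := exists_lift_inl (f ≫ a) (fun x y hxy => by
            refine h₂ y ?_
            rw [← hr, ← hxy, Scheme.Hom.comp_apply, ex, ← Scheme.Hom.comp_apply f, hs,
              ← Scheme.Hom.comp_apply, Category.assoc, coprod.inl_desc, Scheme.Hom.comp_apply]
            exact hZ₁ _)
          have e' : l ≫ Φ₁.p = s ≫ redι Φ₁.Z := by
            have := congrArg (f ≫ ·) e
            simp only [← Category.assoc] at this
            rwa [hs, ← hl', Category.assoc, Category.assoc, coprod.inl_desc,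
              coprod.inl_desc] at this
          rw [← Category.assoc f t, hs, ← hl', Category.assoc, coprod.inl_desc, ← Category.assoc,
            isPullback_section_elim Φ₁.sec_isPullback _ _ e']
        · intro Q f s hs
          obtain ⟨l, hl'⟩ := exists_lift_inr (f ≫ a) (fun x y hxy => by
            refine h₁ y ?_
            rw [← hl, ← hxy, Scheme.Hom.comp_apply, ex, ← Scheme.Hom.comp_apply f, hs,
              ← Scheme.Hom.comp_apply, Category.assoc, coprod.inr_desc, Scheme.Hom.comp_apply]
            exact hZ₂ _)
          have e' : l ≫ Φ₂.p = s ≫ redι Φ₂.Z := by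
            have := congrArg (f ≫ ·) e
            simp only [← Category.assoc] at this
            rwa [hs, ← hl', Category.assoc, Category.assoc, coprod.inr_desc,
              coprod.inr_desc] at this
          rw [← Category.assoc f t, hs, ← hl', Category.assoc, coprod.inr_desc, ← Category.assoc,
            isPullback_section_elim Φ₂.sec_isPullback _ _ e']))
    hχ.choose
    (by
      intro u
      rcases coprod_cases u with ⟨y, rfl⟩ | ⟨y, rfl⟩
      · have : (∀ i, (coprod.inl : Φ₁.U ⟶ Φ₁.U ⨿ Φ₂.U) y ∉
            (Φ₁.U ⨿ Φ₂.U).basicOpen (hχ.choose i)) ↔ y ∈ Set.range Φ₁.sec := by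
          rw [← framing']
          refine forall_congr' fun i => not_congr ?_
          rw [← mem_basicOpen_pb, hχ.choose_spec.1]
        rw [this]
        constructor
        · rintro ⟨t, rfl⟩
          refine ⟨(coprod.inl : red Φ₁.Z ⟶ red Φ₁.Z ⨿ red Φ₂.Z) t, ?_⟩
          rw [← Scheme.Hom.comp_apply, coprod.inl_desc, Scheme.Hom.comp_apply]
        · rintro ⟨t, ht⟩
          rcases coprod_cases t with ⟨t, rfl⟩ | ⟨t, rfl⟩
          · rw [← Scheme.Hom.comp_apply, coprod.inl_desc, Scheme.Hom.comp_apply] at ht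
            exact ⟨t, (Scheme.Hom.isOpenEmbedding (coprod.inl : Φ₁.U ⟶ Φ₁.U ⨿ Φ₂.U)).injective ht⟩
          · rw [← Scheme.Hom.comp_apply, coprod.inr_desc, Scheme.Hom.comp_apply] at ht
            exact (inl_ne_inr _ _ _ _ ht.symm).elim
      · have : (∀ i, (coprod.inr : Φ₂.U ⟶ Φ₁.U ⨿ Φ₂.U) y ∉
            (Φ₁.U ⨿ Φ₂.U).basicOpen (hχ.choose i)) ↔ y ∈ Set.range Φ₂.sec := by
          rw [← framing']
          refine forall_congr' fun i => not_congr ?_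
          rw [← mem_basicOpen_pb, hχ.choose_spec.2]
        rw [this]
        constructor
        · rintro ⟨t, rfl⟩
          refine ⟨(coprod.inr : red Φ₂.Z ⟶ red Φ₁.Z ⨿ red Φ₂.Z) t, ?_⟩
          rw [← Scheme.Hom.comp_apply, coprod.inr_desc, Scheme.Hom.comp_apply]
        · rintro ⟨t, ht⟩
          rcases coprod_cases t with ⟨t, rfl⟩ | ⟨t, rfl⟩
          · rw [← Scheme.Hom.comp_apply, coprod.inl_desc, Scheme.Hom.comp_apply] at ht
            exact (inl_ne_inr _ _ _ _ ht).elim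
          · rw [← Scheme.Hom.comp_apply, coprod.inr_desc, Scheme.Hom.comp_apply] at ht
            exact ⟨t, (Scheme.Hom.isOpenEmbedding (coprod.inr : Φ₂.U ⟶ Φ₁.U ⨿ Φ₂.U)).injective ht⟩)
    (by
      intro u hu i
      rcases coprod_cases u with ⟨y, rfl⟩ | ⟨y, rfl⟩
      · rw [← mem_basicOpen_pb, hχ.choose_spec.1]
        have := isGenericInFiber_of_isOpenImmersion _ _ _ hu
        rw [coprod.inl_desc_assoc] at this
        exact Φ₁.generic y this i
      · rw [← mem_basicOpen_pb, hχ.choose_spec.2]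
        have := isGenericInFiber_of_isOpenImmersion _ _ _ hu
        rw [coprod.inr_desc_assoc] at this
        exact Φ₂.generic y this i)
    (coprod.desc (Φ₁.g ≫ disjInl Y₁ Y₂) (Φ₂.g ≫ disjInr Y₁ Y₂))
    (by
      apply coprod.hom_ext
      · simp only [Category.assoc, coprod.inl_desc_assoc, disjInl_hom, Φ₁.w]
      · simp only [Category.assoc, coprod.inr_desc_assoc, disjInr_hom, Φ₂.w])

variable {Φ₁ Φ₂} (h₁ : ∀ u, Φ₁.p u ∉ Φ₂.Z) (h₂ : ∀ u, Φ₂.p u ∉ Φ₁.Z)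

lemma rel_sum_left : Rel ((sum Φ₁ Φ₂ h₁ h₂).comp (projLeft Y₁ Y₂)) Φ₁ := by
  have hg : (coprod.inl : Φ₁.U ⟶ Φ₁.U ⨿ Φ₂.U) ≫ (sum Φ₁ Φ₂ h₁ h₂).g = Φ₁.g ≫ disjInl Y₁ Y₂ :=
    coprod.inl_desc _ _
  have hg' : (coprod.inr : Φ₂.U ⟶ Φ₁.U ⨿ Φ₂.U) ≫ (sum Φ₁ Φ₂ h₁ h₂).g = Φ₂.g ≫ disjInr Y₁ Y₂ :=
    coprod.inr_desc _ _
  obtain ⟨b, b1, b2⟩ := (sum Φ₁ Φ₂ h₁ h₂).compLeft_sq.exists_lift _ _ hg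
  refine rel_equivalence.symm (Rel.of_hom b ?_ b2.symm (fun i => ?_) fun w => ?_)
  · rw [comp_p_zero, ← Category.assoc, b1]
    exact (coprod.inl_desc _ _).symm
  · rw [comp_φ_zero, ← pb_comp, b1]
    exact ((exists_pb_coprod Φ₁.φ Φ₂.φ).choose_spec.1 i).symm
  · rcases coprod_cases (U := Φ₁.U) (V := Φ₂.U)
      ((sum Φ₁ Φ₂ h₁ h₂).compFst (projLeft Y₁ Y₂) w) with ⟨y, hy⟩ | ⟨y, hy⟩
    · refine ⟨y, ((sum Φ₁ Φ₂ h₁ h₂).compFst (projLeft Y₁ Y₂)).isOpenEmbedding.injective ?_⟩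
      rw [← Scheme.Hom.comp_apply, b1]
      exact hy
    · refine (disjInl_ne_disjInr (((sum Φ₁ Φ₂ h₁ h₂).comp (projLeft Y₁ Y₂)).g w) (Φ₂.g y) ?_).elim
      rw [← Scheme.Hom.comp_apply, ← Scheme.Hom.comp_apply, ← hg', ← (compLeft_sq _).w,
        Scheme.Hom.comp_apply]
      exact congrArg (sum Φ₁ Φ₂ h₁ h₂).g hy.symm

lemma rel_sum_right : Rel ((sum Φ₁ Φ₂ h₁ h₂).comp (projRight Y₁ Y₂)) Φ₂ := by
  have hg : (coprod.inl : Φ₁.U ⟶ Φ₁.U ⨿ Φ₂.U) ≫ (sum Φ₁ Φ₂ h₁ h₂).g = Φ₁.g ≫ disjInl Y₁ Y₂ :=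
    coprod.inl_desc _ _
  have hg' : (coprod.inr : Φ₂.U ⟶ Φ₁.U ⨿ Φ₂.U) ≫ (sum Φ₁ Φ₂ h₁ h₂).g = Φ₂.g ≫ disjInr Y₁ Y₂ :=
    coprod.inr_desc _ _
  obtain ⟨b, b1, b2⟩ := (sum Φ₁ Φ₂ h₁ h₂).compRight_sq.exists_lift _ _ hg'
  refine rel_equivalence.symm (Rel.of_hom b ?_ b2.symm (fun i => ?_) fun w => ?_)
  · rw [comp_p_zero, ← Category.assoc, b1]
    exact (coprod.inr_desc _ _).symm
  · rw [comp_φ_zero, ← pb_comp, b1]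
    exact ((exists_pb_coprod Φ₁.φ Φ₂.φ).choose_spec.2 i).symm
  · rcases coprod_cases (U := Φ₁.U) (V := Φ₂.U)
      ((sum Φ₁ Φ₂ h₁ h₂).compFst (projRight Y₁ Y₂) w) with ⟨y, hy⟩ | ⟨y, hy⟩
    rotate_left
    · refine ⟨y, ((sum Φ₁ Φ₂ h₁ h₂).compFst (projRight Y₁ Y₂)).isOpenEmbedding.injective ?_⟩
      rw [← Scheme.Hom.comp_apply, b1]
      exact hy
    · refine (disjInl_ne_disjInr (Φ₁.g y) (((sum Φ₁ Φ₂ h₁ h₂).comp (projRight Y₁ Y₂)).g w) ?_).elim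
      rw [← Scheme.Hom.comp_apply, ← Scheme.Hom.comp_apply, ← hg, ← (compRight_sq _).w,
        Scheme.Hom.comp_apply]
      exact congrArg (sum Φ₁ Φ₂ h₁ h₂).g hy

end sum

/-- Two correspondences with disjoint supports are the components of a correspondence to the
disjoint union: remove from the étale neighbourhood of each the inverse image of the support of the
other, and add up. -/
lemma exists_rel_proj (Φ₁ : ExplicitCorr n X Y₁) (Φ₂ : ExplicitCorr n X Y₂)
    (h : Disjoint (Φ₁.Z : Set (Aff n X.left)) (Φ₂.Z : Set (Aff n X.left))) :
    ∃ Φ : ExplicitCorr n X (disj Y₁ Y₂), Rel (Φ.comp (projLeft Y₁ Y₂)) Φ₁ ∧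
      Rel (Φ.comp (projRight Y₁ Y₂)) Φ₂ := by
  rw [Set.disjoint_left] at h
  obtain ⟨Ψ₁, e₁, r₁, h₁⟩ := Φ₁.exists_restrict ⟨_, Φ₂.Z.isClosed.isOpen_compl⟩ fun z hz => h hz
  obtain ⟨Ψ₂, e₂, r₂, h₂⟩ := Φ₂.exists_restrict ⟨_, Φ₁.Z.isClosed.isOpen_compl⟩
    fun z hz hz' => h hz' hz
  have h₁' : ∀ u, Ψ₁.p u ∉ Ψ₂.Z := fun u => by rw [e₂]; exact h₁ u
  have h₂' : ∀ u, Ψ₂.p u ∉ Ψ₁.Z := fun u => by rw [e₁]; exact h₂ u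
  exact ⟨sum Ψ₁ Ψ₂ h₁' h₂', rel_equivalence.trans (rel_sum_left _ _) r₁,
    rel_equivalence.trans (rel_sum_right _ _) r₂⟩

end ExplicitCorr

/-! ### Injectivity of stabilization -/

section lastCoordinate

variable {n : ℕ}

/-- The projection `𝔸ⁿ⁺¹_X ⟶ 𝔸ⁿ_X` forgetting the last coordinate. -/
def forgetLast (n : ℕ) (X : Scheme.{u}) : Aff (n + 1) X ⟶ Aff n X :=
  Aff.lift (Aff.proj _ X) (fun i => Aff.coord X (Fin.castAdd 1 i))

lemma forgetLast_proj (X : Scheme.{u}) :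
    forgetLast n X ≫ Aff.proj n X = Aff.proj (n + 1) X := by
  unfold forgetLast
  exact Aff.lift_proj (n := n) (Aff.proj _ X) (fun i => Aff.coord X (Fin.castAdd 1 i))

lemma pb_forgetLast (X : Scheme.{u}) (i : Fin n) :
    pb (forgetLast n X) (Aff.coord X i) = Aff.coord X (Fin.castAdd 1 i) := by
  unfold forgetLast
  exact Aff.pb_lift_coord (n := n) (Aff.proj _ X) (fun i => Aff.coord X (Fin.castAdd 1 i)) i

/-- The zero section `𝔸ⁿ_X ⟶ 𝔸ⁿ⁺¹_X`. -/
def zeroExt (n : ℕ) (X : Scheme.{u}) : Aff n X ⟶ Aff (n + 1) X :=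
  Aff.lift (Aff.proj n X) (Fin.append (fun i => Aff.coord X i) (fun _ : Fin 1 => 0))

lemma zeroExt_proj (X : Scheme.{u}) : zeroExt n X ≫ Aff.proj (n + 1) X = Aff.proj n X := by
  unfold zeroExt
  exact Aff.lift_proj (n := n + 1) _ (Fin.append (fun i => Aff.coord X i) (fun _ : Fin 1 => 0))

lemma pb_zeroExt_left (X : Scheme.{u}) (i : Fin n) :
    pb (zeroExt n X) (Aff.coord X (Fin.castAdd 1 i)) = Aff.coord X i := by
  unfold zeroExt
  rw [Aff.pb_lift_coord (n := n + 1), Fin.append_left]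

lemma pb_zeroExt_right (X : Scheme.{u}) (j : Fin 1) :
    pb (zeroExt n X) (Aff.coord X (Fin.natAdd n j)) = 0 := by
  unfold zeroExt
  rw [Aff.pb_lift_coord (n := n + 1), Fin.append_right]

end lastCoordinate

namespace ExplicitCorr

variable {S : Scheme.{u}} {n : ℕ} {X X' Y : Over S}

/-- The support of `σ_Y` is the zero section. -/
lemma mem_range_sec_sigma (v : (sigma Y).U) :
    v ∈ Set.range (sigma Y).sec ↔ v ∈ Set.range (zeroSec Y.left ≫ inv (sigma Y).p) := by
  rw [mem_range_sec]
  have hZ : ∀ z, z ∈ (sigma Y).Z ↔ z ∈ Set.range (zeroSec Y.left) := fun _ => Iff.rfl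
  rw [hZ]
  constructor
  · rintro ⟨y, hy⟩
    refine ⟨y, (sigma Y).p.isOpenEmbedding.injective ?_⟩
    rw [← hy, ← Scheme.Hom.comp_apply, Category.assoc, IsIso.inv_hom_id, Category.comp_id]
  · rintro ⟨y, rfl⟩
    refine ⟨y, ?_⟩
    rw [← Scheme.Hom.comp_apply, Category.assoc, IsIso.inv_hom_id, Category.comp_id]

/-- The zero section of the étale neighbourhood of the stabilization of a correspondence. -/
lemma exists_zeroSec (Φ : ExplicitCorr n X Y) : ∃ z : Φ.U ⟶ (Φ.comp (sigma Y)).U,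
    z ≫ Φ.compFst (sigma Y) = 𝟙 _ ∧
      (∀ u, u ∈ Set.range z ↔ Φ.compSnd (sigma Y) u ∈ Set.range (sigma Y).sec) ∧
      z ≫ (Φ.comp (sigma Y)).p = Φ.p ≫ zeroExt n X.left := by
  have h0 : (zeroSec Y.left ≫ inv (sigma Y).p) ≫ (sigma Y).toX = 𝟙 _ := by
    rw [toX, Category.assoc, IsIso.inv_hom_id_assoc, zeroSec_proj]
  obtain ⟨z, z1, z2⟩ := (Φ.comp_sq (sigma Y)).exists_lift (𝟙 _)
    (Φ.g ≫ zeroSec Y.left ≫ inv (sigma Y).p) (by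
      rw [Category.assoc, h0, Category.id_comp, Category.comp_id])
  have sq : IsPullback z Φ.g (Φ.compSnd (sigma Y)) (zeroSec Y.left ≫ inv (sigma Y).p) := by
    refine IsPullback.of_right ?_ z2 (Φ.comp_sq (sigma Y))
    rw [z1, h0]
    exact IsPullback.of_horiz_isIso ⟨by simp⟩
  refine ⟨z, z1, fun u => ?_, ?_⟩
  · rw [mem_range_sec_sigma]
    constructor
    · rintro ⟨x, rfl⟩
      rw [← Scheme.Hom.comp_apply, z2, Scheme.Hom.comp_apply]
      exact ⟨_, rfl⟩
    · rintro ⟨y, hy⟩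
      obtain ⟨t, ht, -⟩ := exists_preimage sq u y hy.symm
      exact ⟨t, ht⟩
  · apply Aff.hom_ext_append
    · rw [Category.assoc, comp_p_proj, ← Category.assoc, z1, Category.id_comp, Category.assoc,
        zeroExt_proj]
    · intro i
      rw [pb_comp, comp_p_left, ← pb_comp z, z1, pb_comp, pb_zeroExt_left, ← pb_comp,
        Category.id_comp]
    · intro j
      rw [pb_comp, comp_p_right, ← pb_comp z, z2, pb_comp Φ.p, pb_zeroExt_right, ← pb_comp,
        Category.assoc, Category.assoc, IsIso.inv_hom_id, Category.comp_id, pb_comp, pb_zeroSec,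
        pb, pb, map_zero, map_zero]

lemma zeroExt_mem {Φ : ExplicitCorr n X Y} {x : Aff n X.left} (hx : x ∈ Φ.Z) :
    zeroExt n X.left x ∈ (Φ.comp (sigma Y)).Z := by
  obtain ⟨u, rfl⟩ := Φ.exists_point hx
  obtain ⟨z, z1, hz, hp⟩ := Φ.exists_zeroSec
  rw [← Scheme.Hom.comp_apply, ← hp, Scheme.Hom.comp_apply, ← mem_range_sec,
    mem_range_sec_comp, ← Scheme.Hom.comp_apply, z1]
  exact ⟨(mem_range_sec _ _).2 hx, (hz _).1 ⟨u, rfl⟩⟩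

/-- Stabilization is injective: a correspondence is recovered from its stabilization by
restriction to the zero section. -/
lemma rel_of_rel_comp_sigma {Φ Φ' : ExplicitCorr n X Y}
    (h : Rel (Φ.comp (sigma Y)) (Φ'.comp (sigma Y))) : Rel Φ Φ' := by
  obtain ⟨V, a, b, ha, -, hp, hg, hφ, sa, sb⟩ := h.elim
  obtain ⟨z, z1, hz, -⟩ := Φ.exists_zeroSec
  obtain ⟨z', z1', hz', -⟩ := Φ'.exists_zeroSec
  have hab : ∀ v, a v ∈ Set.range (Φ.comp (sigma Y)).sec ↔
      b v ∈ Set.range (Φ'.comp (sigma Y)).sec := fun v => by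
    rw [← framing', ← framing']
    refine forall_congr' fun i => ?_
    rw [← mem_basicOpen_pb, ← mem_basicOpen_pb, hφ]
  have mem : ∀ u, u ∈ Set.range Φ.sec → z u ∈ Set.range (Φ.comp (sigma Y)).sec := fun u hu => by
    refine (mem_range_sec_comp _ _ _).2 ⟨?_, (hz _).1 ⟨u, rfl⟩⟩
    rw [← Scheme.Hom.comp_apply, z1]; exact hu
  have mem' : ∀ u, u ∈ Set.range Φ'.sec → z' u ∈ Set.range (Φ'.comp (sigma Y)).sec :=
    fun u hu => by
      refine (mem_range_sec_comp _ _ _).2 ⟨?_, (hz' _).1 ⟨u, rfl⟩⟩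
      rw [← Scheme.Hom.comp_apply, z1']; exact hu
  -- a common refinement of `Φ.U` and `Φ'.U` is the inverse image in `V` of the zero section
  have sq := IsPullback.of_hasPullback a z
  have e : pullback.snd a z = (pullback.fst a z ≫ a) ≫ Φ.compFst (sigma Y) := by
    rw [sq.w, Category.assoc, z1, Category.comp_id]
  refine Rel.of (pullback.snd a z) ((pullback.fst a z ≫ b) ≫ Φ'.compFst (sigma Y)) inferInstance
    ?_ ?_ ?_ ?_ ?_
  · rw [e]
    apply Aff.hom_ext
    · have := congrArg (fun F => pullback.fst a z ≫ F ≫ Aff.proj _ _) hp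
      simp only [Category.assoc, comp_p_proj] at this
      simpa only [Category.assoc] using this
    · intro i
      have := congrArg (fun F => pb (pullback.fst a z) (pb F (Aff.coord _ (Fin.castAdd 1 i)))) hp
      simp only [pb_comp _ (p _), comp_p_left] at this
      simpa only [← pb_comp, Category.assoc] using this
  · rw [e]
    simp only [Category.assoc, (Φ.comp_sq (sigma Y)).w, (Φ'.comp_sq (sigma Y)).w]
    rw [← sigma_g, ← comp_g, ← comp_g, hg]
  · intro i
    rw [e, pb_comp _ (Φ.compFst _), pb_comp _ (Φ'.compFst _), ← comp_φ_left, ← comp_φ_left,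
      pb_comp, pb_comp, hφ]
  · intro u hu
    obtain ⟨v, hv⟩ := sa _ (mem u hu)
    obtain ⟨t, -, ht⟩ := exists_preimage sq v u hv
    exact ⟨t, ht⟩
  · intro u hu
    obtain ⟨v, hv⟩ := sb _ (mem' u hu)
    have h1 : a v ∈ Set.range (Φ.comp (sigma Y)).sec := (hab v).2 (hv ▸ mem' u hu)
    obtain ⟨x, hx⟩ := (hz _).2 ((mem_range_sec_comp _ _ _).1 h1).2
    obtain ⟨t, ht, -⟩ := exists_preimage sq v x hx.symm
    refine ⟨t, ?_⟩
    rw [Scheme.Hom.comp_apply, Scheme.Hom.comp_apply, ht, hv, ← Scheme.Hom.comp_apply, z1']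
    rfl

end ExplicitCorr

/-! ### Translations of affine space -/

section translation

/-- The translation of `𝔸ⁿ_X` by a vector of functions on `X`. -/
def Aff.translation {n : ℕ} {X : Scheme.{u}} (v : Fin n → Γ(X, ⊤)) : Aff n X ⟶ Aff n X :=
  Aff.lift (Aff.proj n X) (fun i => Aff.coord X i + pb (Aff.proj n X) (v i))

variable {n : ℕ} {X X' : Scheme.{u}}

lemma Aff.translation_proj (v : Fin n → Γ(X, ⊤)) :
    Aff.translation v ≫ Aff.proj n X = Aff.proj n X := by
  unfold Aff.translation
  exact Aff.lift_proj (Aff.proj n X) (fun i : Fin n => Aff.coord X i + pb (Aff.proj n X) (v i))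

lemma Aff.pb_translation_coord (v : Fin n → Γ(X, ⊤)) (i : Fin n) :
    pb (Aff.translation v) (Aff.coord X i) = Aff.coord X i + pb (Aff.proj n X) (v i) := by
  unfold Aff.translation
  exact Aff.pb_lift_coord (Aff.proj n X)
    (fun i : Fin n => Aff.coord X i + pb (Aff.proj n X) (v i)) i

lemma pb_add {U V : Scheme.{u}} (f : U ⟶ V) (s t : Γ(V, ⊤)) : pb f (s + t) = pb f s + pb f t :=
  map_add _ _ _

lemma pb_sub {U V : Scheme.{u}} (f : U ⟶ V) (s t : Γ(V, ⊤)) : pb f (s - t) = pb f s - pb f t :=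
  map_sub _ _ _

lemma pb_id {U : Scheme.{u}} (s : Γ(U, ⊤)) : pb (𝟙 U) s = s := by
  rw [pb, Scheme.Hom.id_appTop]; rfl

lemma Aff.translation_comp (v w : Fin n → Γ(X, ⊤)) :
    Aff.translation v ≫ Aff.translation w = Aff.translation (v + w) := by
  apply Aff.hom_ext
  · rw [Category.assoc, translation_proj, translation_proj, translation_proj]
  · intro i
    rw [pb_comp, pb_translation_coord, pb_translation_coord, pb_add, pb_translation_coord,
      ← pb_comp, translation_proj, Pi.add_apply, pb_add, add_assoc]

lemma Aff.translation_zero : Aff.translation (0 : Fin n → Γ(X, ⊤)) = 𝟙 _ := by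
  apply Aff.hom_ext
  · rw [translation_proj, Category.id_comp]
  · intro i
    rw [pb_translation_coord, pb_id, Pi.zero_apply, pb, map_zero, add_zero]

instance (v : Fin n → Γ(X, ⊤)) : IsIso (Aff.translation v) :=
  ⟨Aff.translation (-v), by rw [Aff.translation_comp, add_neg_cancel, Aff.translation_zero],
    by rw [Aff.translation_comp, neg_add_cancel, Aff.translation_zero]⟩

lemma Aff.translation_map (f : X' ⟶ X) (v : Fin n → Γ(X, ⊤)) :
    Aff.translation (fun i => pb f (v i)) ≫ Aff.map n f = Aff.map n f ≫ Aff.translation v := by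
  apply Aff.hom_ext
  · rw [Category.assoc, Category.assoc, map_proj, translation_proj, map_proj, ← Category.assoc,
      translation_proj]
  · intro i
    rw [pb_comp, pb_comp, pb_translation_coord, pb_map_coord, pb_translation_coord, pb_add,
      pb_map_coord, ← pb_comp, ← pb_comp, map_proj]

end translation

namespace ExplicitCorr

variable {S : Scheme.{u}} {n : ℕ} {X X' Y Y₁ Y₂ : Over S}

/-! ### Moving supports apart -/

/-- The translate of an explicit correspondence of level `n` by a vector of `n` functions on the
source. -/
def translate (v : Fin n → Γ(X.left, ⊤)) (Φ : ExplicitCorr n X Y) : ExplicitCorr n X Y :=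
  ofSection (redι Φ.Z ≫ Aff.translation v) (Φ.p ≫ Aff.translation v) Φ.sec inferInstance
    (by rw [Category.assoc, Aff.translation_proj]; exact Φ.finite) inferInstance
    (isPullback_section (by rw [← Category.assoc, Φ.sec_p]) fun a t e => by
      rw [← Category.assoc, ← Category.assoc, cancel_mono] at e
      exact isPullback_section_elim Φ.sec_isPullback _ _ e)
    Φ.φ Φ.framing'
    (by rw [Category.assoc, Aff.translation_proj]; exact Φ.generic) Φ.g
    (by rw [Φ.w, Category.assoc Φ.p (Aff.translation v), Aff.translation_proj])

variable (v : Fin n → Γ(X.left, ⊤))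

lemma mem_range_sec_translate (Φ : ExplicitCorr n X Y) (u : Φ.U) :
    u ∈ Set.range (Φ.translate v).sec ↔ u ∈ Set.range Φ.sec :=
  ((Φ.translate v).framing' u).symm.trans (Φ.framing' u)

lemma exists_of_mem_translate {Φ : ExplicitCorr n X Y} {z : Aff n X.left}
    (hz : z ∈ (Φ.translate v).Z) : ∃ z' ∈ Φ.Z, Aff.translation v z' = z := by
  obtain ⟨t, rfl⟩ : z ∈ Set.range (redι Φ.Z ≫ Aff.translation v) := hz
  refine ⟨redι Φ.Z t, ?_, by rw [Scheme.Hom.comp_apply]⟩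
  have : redι Φ.Z t ∈ (Φ.Z : Set _) := by rw [← range_redι]; exact ⟨t, rfl⟩
  exact this

lemma Rel.translate {Φ Ψ : ExplicitCorr n X Y} (h : Rel Φ Ψ) :
    Rel (Φ.translate v) (Ψ.translate v) := by
  obtain ⟨V, a, b, ha, -, hp, hg, hφ, sa, sb⟩ := h.elim
  refine Rel.of (Φ := Φ.translate v) (Ψ := Ψ.translate v) a b ha ?_ hg hφ
    (fun u hu => sa u ((mem_range_sec_translate v Φ u).1 hu))
    (fun u hu => sb u ((mem_range_sec_translate v Ψ u).1 hu))
  change a ≫ Φ.p ≫ _ = b ≫ Ψ.p ≫ _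
  rw [← Category.assoc, hp, Category.assoc]

lemma rel_translate_zero (Φ : ExplicitCorr n X Y) : Rel (Φ.translate 0) Φ :=
  Rel.of_hom (Φ := Φ.translate 0) (𝟙 _)
    (by
      change Φ.p ≫ _ = 𝟙 _ ≫ Φ.p
      rw [Aff.translation_zero, Category.comp_id, Category.id_comp])
    (Category.id_comp _).symm (fun i => (pb_id _).symm) (fun u => ⟨u, rfl⟩)

lemma rel_pull_translate (f : X' ⟶ X) (Φ : ExplicitCorr n X Y) :
    Rel ((Φ.translate v).pull f) ((Φ.pull f).translate fun i => pb f.left (v i)) := by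
  have sq := (Φ.pull_sq f).paste_vert
    (IsPullback.of_vert_isIso ⟨(Aff.translation_map f.left v).symm⟩)
  obtain ⟨e, e1, e2⟩ := sq.exists_lift _ _ ((Φ.translate v).pull_sq f).w
  obtain ⟨e', e1', e2'⟩ := ((Φ.translate v).pull_sq f).exists_lift _ _ sq.w
  refine Rel.of_hom (Ψ := (Φ.pull f).translate fun i => pb f.left (v i)) e e2.symm ?_ ?_
    (surjective_of_iso e e' ?_)
  · rw [pull_g, ← e1]
    exact Category.assoc _ _ _
  · intro i
    rw [pull_φ, ← e1]
    exact pb_comp _ _ _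
  · apply sq.hom_ext
    · rw [Category.assoc, e1, Category.id_comp]; exact e1'
    · rw [Category.assoc, e2, Category.id_comp]; exact e2'

/-- The stabilization of an explicit correspondence, translated by `s` in the new coordinate. For
`s = 0` this is the stabilization itself. -/
def slide (s : Γ(X.left, ⊤)) (Φ : ExplicitCorr n X Y) : ExplicitCorr (n + 1) X Y :=
  (Φ.comp (sigma Y)).translate (Fin.append (0 : Fin n → _) (fun _ : Fin 1 => s))

lemma Rel.slide (s : Γ(X.left, ⊤)) {Φ Ψ : ExplicitCorr n X Y} (h : Rel Φ Ψ) :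
    Rel (Φ.slide s) (Ψ.slide s) :=
  (h.comp (rel_equivalence.refl _)).translate _

lemma rel_slide_zero (Φ : ExplicitCorr n X Y) : Rel (Φ.slide 0) (Φ.comp (sigma Y)) := by
  have : Fin.append (0 : Fin n → Γ(X.left, ⊤)) (fun _ : Fin 1 => 0) = 0 := by
    funext i
    refine Fin.addCases (fun i => ?_) (fun j => ?_) i
    · rw [Fin.append_left]; rfl
    · rw [Fin.append_right]; rfl
  unfold slide
  rw [this]
  exact rel_translate_zero _

lemma rel_pull_slide (f : X' ⟶ X) (s : Γ(X.left, ⊤)) (Φ : ExplicitCorr n X Y) :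
    Rel ((Φ.slide s).pull f) ((Φ.pull f).slide (pb f.left s)) := by
  have : (fun i => pb f.left (Fin.append (0 : Fin n → Γ(X.left, ⊤)) (fun _ : Fin 1 => s) i)) =
      Fin.append 0 (fun _ : Fin 1 => pb f.left s) := by
    funext i
    refine Fin.addCases (fun i => ?_) (fun j => ?_) i
    · rw [Fin.append_left, Fin.append_left]; exact map_zero _
    · rw [Fin.append_right, Fin.append_right]
  have h := rel_pull_translate (Fin.append (0 : Fin n → _) (fun _ : Fin 1 => s)) f
    (Φ.comp (sigma Y))
  rw [this] at h
  exact rel_equivalence.trans h (Rel.translate _ (rel_equivalence.symm (rel_pull_of_comp f Φ _)))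

/-- The support of the stabilization of `Φ` lies over the support of `Φ`, and the last coordinate
vanishes on it. -/
lemma of_mem_comp_sigma {Φ : ExplicitCorr n X Y} {z : Aff (n + 1) X.left}
    (hz : z ∈ (Φ.comp (sigma Y)).Z) : forgetLast n X.left z ∈ Φ.Z ∧
      z ∉ (Aff (n + 1) X.left).basicOpen (Aff.coord X.left (Fin.natAdd n (0 : Fin 1))) := by
  obtain ⟨u, rfl⟩ := (Φ.comp (sigma Y)).exists_point hz
  obtain ⟨h1, h2⟩ := (mem_range_sec_comp Φ (sigma Y) u).1 ((mem_range_sec _ _).2 hz)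
  constructor
  · have : (Φ.comp (sigma Y)).p ≫ forgetLast n X.left = Φ.compFst (sigma Y) ≫ Φ.p := by
      apply Aff.hom_ext
      · rw [Category.assoc, forgetLast_proj, comp_p_proj, Category.assoc]
      · intro i
        rw [pb_comp, pb_comp, pb_forgetLast, comp_p_left]
    rw [← Scheme.Hom.comp_apply, this, Scheme.Hom.comp_apply]
    exact (mem_range_sec _ _).1 h1
  · rw [← mem_basicOpen_pb, comp_p_right, mem_basicOpen_pb, ← sigma_φ]
    exact (framing' _ _).2 h2 0

/-- The support of `Φ.slide s` lies over the support of `Φ`, and the last coordinate is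
`s` on it. -/
lemma of_mem_slide {s : Γ(X.left, ⊤)} {Φ : ExplicitCorr n X Y} {z : Aff (n + 1) X.left}
    (hz : z ∈ (Φ.slide s).Z) : forgetLast n X.left z ∈ Φ.Z ∧
      z ∉ (Aff (n + 1) X.left).basicOpen (Aff.coord X.left (Fin.natAdd n (0 : Fin 1)) -
        pb (Aff.proj _ _) s) := by
  obtain ⟨z, hz', rfl⟩ := exists_of_mem_translate _ hz
  obtain ⟨h1, h2⟩ := of_mem_comp_sigma hz'
  constructor
  · have : Aff.translation (Fin.append (0 : Fin n → Γ(X.left, ⊤)) (fun _ : Fin 1 => s)) ≫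
        forgetLast n X.left = forgetLast n X.left := by
      apply Aff.hom_ext
      · rw [Category.assoc, forgetLast_proj, Aff.translation_proj]
      · intro i
        rw [pb_comp, pb_forgetLast, Aff.pb_translation_coord, Fin.append_left, Pi.zero_apply, pb,
          map_zero, add_zero]
    rwa [← Scheme.Hom.comp_apply, this]
  · rwa [← mem_basicOpen_pb, pb_sub, Aff.pb_translation_coord, ← pb_comp,
      Aff.translation_proj, Fin.append_right, add_sub_cancel_right]

/-- Disjointness of supports is not affected by stabilization. -/
lemma disjoint_comp_sigma_iff (Φ₁ : ExplicitCorr n X Y₁) (Φ₂ : ExplicitCorr n X Y₂) :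
    Disjoint ((Φ₁.comp (sigma Y₁)).Z : Set (Aff (n + 1) X.left)) ((Φ₂.comp (sigma Y₂)).Z : Set _) ↔
      Disjoint (Φ₁.Z : Set (Aff n X.left)) (Φ₂.Z : Set (Aff n X.left)) := by
  rw [Set.disjoint_left, Set.disjoint_left]
  exact ⟨fun h z h₁ h₂ => h (zeroExt_mem h₁) (zeroExt_mem h₂),
    fun h z h₁ h₂ => h (of_mem_comp_sigma h₁).1 (of_mem_comp_sigma h₂).1⟩

/-- Sliding does not destroy disjointness of supports. -/
lemma disjoint_slide (s : Γ(X.left, ⊤)) {Φ₁ : ExplicitCorr n X Y₁} {Φ₂ : ExplicitCorr n X Y₂}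
    (h : Disjoint (Φ₁.Z : Set (Aff n X.left)) (Φ₂.Z : Set (Aff n X.left))) :
    Disjoint ((Φ₁.comp (sigma Y₁)).Z : Set (Aff (n + 1) X.left)) ((Φ₂.slide s).Z : Set _) := by
  rw [Set.disjoint_left] at h ⊢
  exact fun z h₁ h₂ => h (of_mem_comp_sigma h₁).1 (of_mem_slide h₂).1

/-- After sliding the second of two correspondences to the height `1`, their supports are
disjoint. -/
lemma disjoint_slide_one (Φ₁ : ExplicitCorr n X Y₁) (Φ₂ : ExplicitCorr n X Y₂) :
    Disjoint ((Φ₁.comp (sigma Y₁)).Z : Set (Aff (n + 1) X.left))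
      ((Φ₂.slide 1).Z : Set _) := by
  rw [Set.disjoint_left]
  intro z h₁ h₂
  have a := (of_mem_comp_sigma h₁).2
  have b := (of_mem_slide h₂).2
  rw [pb, map_one] at b
  have h : z ∈ (Aff (n + 1) X.left).basicOpen ((1 : Γ(Aff (n + 1) X.left, ⊤))) := by
    rw [Scheme.basicOpen_of_isUnit _ isUnit_one]; trivial
  rw [Scheme.mem_basicOpen_top] at a b h
  -- the functions `x` and `x - 1` cannot both vanish at `z`
  refine (IsLocalRing.nonunits_add a ((IsUnit.neg_iff _).not.2 b)) ?_
  rw [← map_neg, ← map_add, neg_sub, add_sub_cancel]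
  exact h

end ExplicitCorr

/-! ### Stable framed correspondences -/

section stable

variable {S : Scheme.{u}} {n : ℕ} {Y Y' Y₁ Y₂ : Over S}

/-- The support of a framed correspondence. -/
def FrSet.supp {X : Over S} : FrSet n X Y → Closeds (Aff n X.left) :=
  Quotient.lift (fun Φ => Φ.Z) (fun _ _ h => h.1)

/-- Two framed correspondences of the same level have disjoint supports. -/
def FrSet.DisjointSupp {X : Over S} (a₁ : FrSet n X Y₁) (a₂ : FrSet n X Y₂) : Prop :=
  Disjoint (a₁.supp : Set (Aff n X.left)) (a₂.supp : Set (Aff n X.left))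

/-- `slide` on equivalence classes. -/
def FrSet.slide {X : Over S} (s : Γ(X.left, ⊤)) : FrSet n X Y → FrSet (n + 1) X Y :=
  Quotient.map' (fun Φ => Φ.slide s) (fun _ _ h => h.slide s)

lemma disjointSupp_postcomp_sigma {X : (Over S)ᵒᵖ} (a₁ : FrSet n X.unop Y₁)
    (a₂ : FrSet n X.unop Y₂) :
    FrSet.DisjointSupp (n := n + 1) (X := X.unop) ((postcomp n (sigma Y₁)).app X a₁)
      ((postcomp n (sigma Y₂)).app X a₂) ↔ a₁.DisjointSupp a₂ := by
  induction a₁ using Quotient.inductionOn'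
  induction a₂ using Quotient.inductionOn'
  exact ExplicitCorr.disjoint_comp_sigma_iff _ _

lemma disjointSupp_postcomp_slide {X : (Over S)ᵒᵖ} (s : Γ(X.unop.left, ⊤))
    (a₁ : FrSet n X.unop Y₁) (a₂ : FrSet n X.unop Y₂) (h : a₁.DisjointSupp a₂) :
    FrSet.DisjointSupp (n := n + 1) (X := X.unop) ((postcomp n (sigma Y₁)).app X a₁)
      (a₂.slide s) := by
  induction a₁ using Quotient.inductionOn'
  induction a₂ using Quotient.inductionOn'
  exact ExplicitCorr.disjoint_slide s h

lemma disjointSupp_postcomp_slide_one {X : (Over S)ᵒᵖ}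
    (a₁ : FrSet n X.unop Y₁) (a₂ : FrSet n X.unop Y₂) :
    FrSet.DisjointSupp (n := n + 1) (X := X.unop) ((postcomp n (sigma Y₁)).app X a₁)
      (a₂.slide 1) := by
  induction a₁ using Quotient.inductionOn'
  induction a₂ using Quotient.inductionOn'
  exact ExplicitCorr.disjoint_slide_one _ _

lemma slide_zero {X : (Over S)ᵒᵖ} (a : FrSet n X.unop Y) :
    a.slide 0 = (postcomp n (sigma Y)).app X a := by
  induction a using Quotient.inductionOn'
  exact Quotient.sound (ExplicitCorr.rel_slide_zero _)

lemma map_slide {X X' : (Over S)ᵒᵖ} (f : X ⟶ X') (s : Γ(X.unop.left, ⊤))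
    (a : FrSet n X.unop Y) : (frLevel (n + 1) Y).map f (a.slide s) =
      FrSet.slide (X := X'.unop) (pb f.unop.left s) ((frLevel n Y).map f a) := by
  induction a using Quotient.inductionOn'
  exact Quotient.sound (ExplicitCorr.rel_pull_slide _ _ _)

lemma postcomp_sigma_injective (X : (Over S)ᵒᵖ) :
    Function.Injective ((postcomp n (sigma Y)).app X) := by
  intro a b h
  induction a using Quotient.inductionOn'
  induction b using Quotient.inductionOn'
  exact Quotient.sound (ExplicitCorr.rel_of_rel_comp_sigma (Quotient.exact h))

lemma eq_of_postcomp_proj {X : (Over S)ᵒᵖ} {a b : FrSet n X.unop (disj Y₁ Y₂)}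
    (h₁ : (postcomp n (projLeft Y₁ Y₂)).app X a = (postcomp n (projLeft Y₁ Y₂)).app X b)
    (h₂ : (postcomp n (projRight Y₁ Y₂)).app X a = (postcomp n (projRight Y₁ Y₂)).app X b) :
    a = b := by
  induction a using Quotient.inductionOn'
  induction b using Quotient.inductionOn'
  exact Quotient.sound (ExplicitCorr.rel_of_rel_proj (Quotient.exact h₁) (Quotient.exact h₂))

/-- A pair of framed correspondences to `Y₁` and `Y₂` comes from a framed correspondence to
`Y₁ ⊔ Y₂` if and only if their supports are disjoint. -/
lemma disjointSupp_iff {X : (Over S)ᵒᵖ} (a₁ : FrSet n X.unop Y₁) (a₂ : FrSet n X.unop Y₂) :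
    a₁.DisjointSupp a₂ ↔ ∃ a : FrSet n X.unop (disj Y₁ Y₂),
      (postcomp n (projLeft Y₁ Y₂)).app X a = a₁ ∧
        (postcomp n (projRight Y₁ Y₂)).app X a = a₂ := by
  constructor
  · intro h
    induction a₁ using Quotient.inductionOn'
    induction a₂ using Quotient.inductionOn'
    obtain ⟨Φ, h₁, h₂⟩ := ExplicitCorr.exists_rel_proj _ _ h
    exact ⟨Quotient.mk'' Φ, Quotient.sound h₁, Quotient.sound h₂⟩
  · rintro ⟨a, rfl, rfl⟩
    induction a using Quotient.inductionOn'
    exact ExplicitCorr.disjoint_proj _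

/-- The map from framed correspondences of level `n` to stable framed correspondences. -/
def frι (n : ℕ) (Y : Over S) : frLevel n Y ⟶ Fr Y := colimit.ι (frSequence Y) n

lemma frSequence_map_succ (n : ℕ) (Y : Over S) :
    (frSequence Y).map (homOfLE (Nat.le_add_right n 1)) = postcomp n (sigma Y) :=
  Functor.ofSequence_map_homOfLE_succ _ n

lemma frι_postcomp_sigma (X : (Over S)ᵒᵖ) (a : (frLevel n Y).obj X) :
    (frι (n + 1) Y).app X ((postcomp n (sigma Y)).app X a) = (frι n Y).app X a := by
  have h := colimit.w (frSequence Y) (homOfLE (Nat.le_add_right n 1))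
  rw [frSequence_map_succ] at h
  exact ConcreteCategory.congr_hom (NatTrans.congr_app h X) a

/-- `Fr(X, Y)` is the colimit of the sets `Fr_n(X, Y)`. -/
def isColimitFr (X : (Over S)ᵒᵖ) (Y : Over S) :
    IsColimit (((evaluation _ _).obj X).mapCocone (colimit.cocone (frSequence Y))) :=
  isColimitOfPreserves _ (colimit.isColimit _)

lemma exists_frι (X : (Over S)ᵒᵖ) (x : (Fr Y).obj X) :
    ∃ (n : ℕ) (a : (frLevel n Y).obj X), (frι n Y).app X a = x :=
  Types.jointly_surjective_of_isColimit (isColimitFr X Y) x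

lemma frSequence_map_injective (X : (Over S)ᵒᵖ) {n m : ℕ} (f : n ⟶ m) :
    Function.Injective (((frSequence Y).map f).app X) := by
  suffices H : ∀ h : n ≤ m, Function.Injective (((frSequence Y).map (homOfLE h)).app X) from
    H (leOfHom f)
  clear f
  intro h
  induction m, h using Nat.le_induction with
  | base =>
    rw [show homOfLE (le_refl n) = 𝟙 n from Subsingleton.elim _ _,
      CategoryTheory.Functor.map_id]
    exact fun _ _ h => h
  | succ m h ih =>
    rw [show homOfLE (Nat.le_succ_of_le h) = homOfLE h ≫ homOfLE (Nat.le_add_right m 1) from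
      Subsingleton.elim _ _, CategoryTheory.Functor.map_comp, frSequence_map_succ]
    exact fun a b e => ih (postcomp_sigma_injective X e)

/-- Framed correspondences of level `n` embed into stable framed correspondences. -/
lemma frι_injective (X : (Over S)ᵒᵖ) : Function.Injective ((frι n Y).app X) := by
  intro a b h
  obtain ⟨m, f, e⟩ := (Types.FilteredColimit.isColimit_eq_iff' (isColimitFr X Y) a b).1 h
  exact frSequence_map_injective X f e

lemma exists_frι_of_le (X : (Over S)ᵒᵖ) {n m : ℕ} (h : n ≤ m) (a : (frLevel n Y).obj X) :
    ∃ b : (frLevel m Y).obj X, (frι m Y).app X b = (frι n Y).app X a := by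
  induction m, h using Nat.le_induction with
  | base => exact ⟨a, rfl⟩
  | succ m h ih =>
    obtain ⟨b, hb⟩ := ih
    exact ⟨_, (frι_postcomp_sigma X b).trans hb⟩

lemma exists_frι_pair (X : (Over S)ᵒᵖ) (x₁ : (Fr Y₁).obj X) (x₂ : (Fr Y₂).obj X) :
    ∃ (n : ℕ) (a₁ : (frLevel n Y₁).obj X) (a₂ : (frLevel n Y₂).obj X),
      (frι n Y₁).app X a₁ = x₁ ∧ (frι n Y₂).app X a₂ = x₂ := by
  obtain ⟨n₁, a₁, rfl⟩ := exists_frι X x₁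
  obtain ⟨n₂, a₂, rfl⟩ := exists_frι X x₂
  obtain ⟨b₁, h₁⟩ := exists_frι_of_le X (le_max_left n₁ n₂) a₁
  obtain ⟨b₂, h₂⟩ := exists_frι_of_le X (le_max_right n₁ n₂) a₂
  exact ⟨_, b₁, b₂, h₁, h₂⟩

lemma frMap_frι (Ψ : ExplicitCorr 0 Y Y') (X : (Over S)ᵒᵖ) (a : (frLevel n Y).obj X) :
    (Fr.map Ψ).app X ((frι n Y).app X a) = (frι n Y').app X ((postcomp n Ψ).app X a) := by
  have h : frι n Y ≫ Fr.map Ψ = postcomp n Ψ ≫ frι n Y' := ι_colimMap _ _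
  exact ConcreteCategory.congr_hom (NatTrans.congr_app h X) a

/-- Disjointness of supports does not depend on the level. -/
lemma disjointSupp_congr (X : (Over S)ᵒᵖ) {n m : ℕ}
    {a₁ : (frLevel n Y₁).obj X} {a₂ : (frLevel n Y₂).obj X} {b₁ : (frLevel m Y₁).obj X}
    {b₂ : (frLevel m Y₂).obj X} (h₁ : (frι n Y₁).app X a₁ = (frι m Y₁).app X b₁)
    (h₂ : (frι n Y₂).app X a₂ = (frι m Y₂).app X b₂) :
    FrSet.DisjointSupp a₁ a₂ ↔ FrSet.DisjointSupp b₁ b₂ := by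
  wlog h : n ≤ m generalizing n m
  · exact (this h₁.symm h₂.symm (le_of_not_ge h)).symm
  induction m, h using Nat.le_induction with
  | base => rw [frι_injective X h₁, frι_injective X h₂]
  | succ m h ih =>
    obtain ⟨c₁, hc₁⟩ := exists_frι_of_le X h a₁
    obtain ⟨c₂, hc₂⟩ := exists_frι_of_le X h a₂
    refine (ih hc₁.symm hc₂.symm).trans ((disjointSupp_postcomp_sigma c₁ c₂).symm.trans ?_)
    rw [← hc₁, ← frι_postcomp_sigma] at h₁
    rw [← hc₂, ← frι_postcomp_sigma] at h₂
    rw [← frι_injective X h₁, ← frι_injective X h₂]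

/-- A pair of stable framed correspondences, represented in level `n`, comes from `Y₁ ⊔ Y₂` if and
only if the supports in level `n` are disjoint. -/
lemma disjointSupp_iff_stable (X : (Over S)ᵒᵖ) (a₁ : (frLevel n Y₁).obj X)
    (a₂ : (frLevel n Y₂).obj X) :
    FrSet.DisjointSupp a₁ a₂ ↔ ∃ x : (Fr (disj Y₁ Y₂)).obj X,
      (Fr.map (projLeft Y₁ Y₂)).app X x = (frι n Y₁).app X a₁ ∧
        (Fr.map (projRight Y₁ Y₂)).app X x = (frι n Y₂).app X a₂ := by
  constructor
  · intro h
    obtain ⟨a, rfl, rfl⟩ := (disjointSupp_iff (X := X) a₁ a₂).1 h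
    exact ⟨(frι n _).app X a, frMap_frι _ X a, frMap_frι _ X a⟩
  · rintro ⟨x, h₁, h₂⟩
    obtain ⟨m, a, rfl⟩ := exists_frι X x
    rw [frMap_frι] at h₁ h₂
    rw [← disjointSupp_congr X h₁ h₂]
    exact (disjointSupp_iff (X := X) _ _).2 ⟨a, rfl, rfl⟩

lemma eq_of_frMap_proj (X : (Over S)ᵒᵖ) {x y : (Fr (disj Y₁ Y₂)).obj X}
    (h₁ : (Fr.map (projLeft Y₁ Y₂)).app X x = (Fr.map (projLeft Y₁ Y₂)).app X y)
    (h₂ : (Fr.map (projRight Y₁ Y₂)).app X x = (Fr.map (projRight Y₁ Y₂)).app X y) : x = y := by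
  obtain ⟨n, a, b, rfl, rfl⟩ := exists_frι_pair X x y
  rw [frMap_frι, frMap_frι] at h₁ h₂
  rw [eq_of_postcomp_proj (X := X) (frι_injective X h₁) (frι_injective X h₂)]

end stable

/-! ### The height function and the filtration by level -/

section height

open MonoidalCategory CartesianMonoidalCategory Simplicial

variable {k : Type u} [Field k]

/-- The coordinate function `x₁` on the algebraic `1`-simplex. -/
def simplexCoord (k : Type u) [Field k] : Γ(((cosimplicialScheme k).obj ⦋1⦌).left, ⊤) :=
  (Scheme.ΓSpecIso (.of (simplexRing k 1))).inv (Ideal.Quotient.mk _ (MvPolynomial.X 1))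

lemma pb_simplexCoord {m : SimplexCategory} (θ : m ⟶ ⦋1⦌) :
    pb ((cosimplicialScheme k).map θ).left (simplexCoord k) =
      (Scheme.ΓSpecIso (.of (simplexRing k m.len))).inv
        (∑ j with θ.toOrderHom j = 1, Ideal.Quotient.mk _ (MvPolynomial.X j)) := by
  have h := Scheme.ΓSpecIso_inv_naturality
    (CommRingCat.ofHom (simplexRingMap k θ.toOrderHom).toRingHom)
  have h' := ConcreteCategory.congr_hom h (Ideal.Quotient.mk _ (MvPolynomial.X 1))
  refine h'.symm.trans (congrArg (Scheme.ΓSpecIso (.of (simplexRing k m.len))).inv ?_)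
  exact simplexRingMap_X k θ.toOrderHom 1

lemma sum_simplexRing_X (n : ℕ) :
    ∑ j, (Ideal.Quotient.mk _ (MvPolynomial.X j) : simplexRing k n) = 1 := by
  rw [← map_sum, ← sub_eq_zero, ← map_one (Ideal.Quotient.mk _), ← map_sub]
  exact Ideal.Quotient.eq_zero_iff_mem.2 (Ideal.subset_span rfl)

/-- The projection `X × Δᵐ ⟶ Δᵐ`. -/
def prodSimplexSnd (X : Sm k) (m : SimplexCategoryᵒᵖ) :
    ((prodSimplex.obj (op X)).obj m).unop ⟶ (cosimplicialScheme k).obj m.unop :=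
  (prod.snd : X.obj ⨯ (cosimplicialScheme k).obj m.unop ⟶ _)

lemma prodSimplexSnd_naturality (X : Sm k) {m m' : SimplexCategoryᵒᵖ} (f : m ⟶ m') :
    ((prodSimplex.obj (op X)).map f).unop ≫ prodSimplexSnd X m =
      prodSimplexSnd X m' ≫ (cosimplicialScheme k).map f.unop :=
  prod.map_snd _ _

/-- An `m`-simplex `θ` of `Δ[1]` defines a map `X × Δᵐ ⟶ Δ¹` and hence, by means of the coordinate
`x₁` on `Δ¹`, a function on `X × Δᵐ`. -/
def height (X : Sm k) {m : SimplexCategoryᵒᵖ} (θ : (Δ[1] : SSet.{u + 1}).obj m) :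
    Γ(((prodSimplex.obj (op X)).obj m).unop.left, ⊤) :=
  pb (prodSimplexSnd X m ≫ (cosimplicialScheme k).map (SSet.stdSimplex.objEquiv θ)).left
    (simplexCoord k)

lemma height_map (X : Sm k) {m m' : SimplexCategoryᵒᵖ} (f : m ⟶ m')
    (θ : (Δ[1] : SSet.{u + 1}).obj m) :
    height X ((Δ[1] : SSet.{u + 1}).map f θ) =
      pb ((prodSimplex.obj (op X)).map f).unop.left (height X θ) := by
  unfold height
  rw [← pb_comp, ← Over.comp_left, ← Category.assoc, prodSimplexSnd_naturality, Category.assoc,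
    ← CategoryTheory.Functor.map_comp]
  rfl

lemma height_vtx_zero (X : Sm k) (m : SimplexCategoryᵒᵖ) : height X (vtx 0 m) = 0 := by
  unfold height
  rw [Over.comp_left, pb_comp, pb_simplexCoord, Finset.filter_false_of_mem, Finset.sum_empty,
    map_zero]
  · exact map_zero (Scheme.Hom.appTop _).hom
  · intro j _ h
    exact zero_ne_one ((asOrderHom_vtx.{u + 1} 0 m j).symm.trans h)

lemma height_vtx_one (X : Sm k) (m : SimplexCategoryᵒᵖ) : height X (vtx 1 m) = 1 := by
  unfold height
  rw [Over.comp_left, pb_comp, pb_simplexCoord, Finset.filter_true_of_mem, sum_simplexRing_X,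
    map_one]
  · exact map_one (Scheme.Hom.appTop _).hom
  · exact fun j _ => asOrderHom_vtx.{u + 1} 1 m j

end height

section additivity

open MonoidalCategory CartesianMonoidalCategory Simplicial

variable {k : Type u} [Field k] (X Y₁ Y₂ : Sm k)

/-- The product `C_*Fr(X, Y₁) × C_*Fr(X, Y₂)`. -/
abbrev pairs : SSet.{u + 1} :=
  (Cstar (Fr Y₁.obj)).obj (op X) ⊗ (Cstar (Fr Y₂.obj)).obj (op X)

/-- The subcomplex of `C_*Fr(X, Y₁) × C_*Fr(X, Y₂)` of pairs represented in level `n`. -/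
def stage (n : ℕ) : (pairs X Y₁ Y₂).Subcomplex where
  obj m := {b | ∃ (a₁ : (frLevel n Y₁.obj).obj ((prodSimplex.obj (op X)).obj m))
    (a₂ : (frLevel n Y₂.obj).obj ((prodSimplex.obj (op X)).obj m)),
    (frι n Y₁.obj).app _ a₁ = b.1 ∧ (frι n Y₂.obj).app _ a₂ = b.2}
  map f := by
    rintro b ⟨a₁, a₂, h₁, h₂⟩
    refine ⟨(frLevel n Y₁.obj).map ((prodSimplex.obj (op X)).map f) a₁,
      (frLevel n Y₂.obj).map ((prodSimplex.obj (op X)).map f) a₂, ?_, ?_⟩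
    · refine (ConcreteCategory.congr_hom ((frι n Y₁.obj).naturality _) a₁).trans ?_
      exact congrArg ((Fr Y₁.obj).map ((prodSimplex.obj (op X)).map f)) h₁
    · refine (ConcreteCategory.congr_hom ((frι n Y₂.obj).naturality _) a₂).trans ?_
      exact congrArg ((Fr Y₂.obj).map ((prodSimplex.obj (op X)).map f)) h₂

variable {X Y₁ Y₂}

/-- The representative in level `n` of the second component of a simplex of a stage. -/
def stageSnd {n : ℕ} {m : SimplexCategoryᵒᵖ} (x : (stage X Y₁ Y₂ n : SSet).obj m) :
    (frLevel n Y₂.obj).obj ((prodSimplex.obj (op X)).obj m) := x.2.choose_spec.choose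

lemma frι_stageSnd {n : ℕ} {m : SimplexCategoryᵒᵖ} (x : (stage X Y₁ Y₂ n : SSet).obj m) :
    (frι n Y₂.obj).app _ (stageSnd x) = x.1.2 := x.2.choose_spec.choose_spec.2

lemma stageSnd_map {n : ℕ} {m m' : SimplexCategoryᵒᵖ} (f : m ⟶ m')
    (x : (stage X Y₁ Y₂ n : SSet).obj m) :
    stageSnd ((stage X Y₁ Y₂ n : SSet).map f x) =
      (frLevel n Y₂.obj).map ((prodSimplex.obj (op X)).map f) (stageSnd x) := by
  apply frι_injective
  rw [frι_stageSnd]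
  refine Eq.trans ?_ (ConcreteCategory.congr_hom ((frι n Y₂.obj).naturality _) _).symm
  exact congrArg ((Fr Y₂.obj).map ((prodSimplex.obj (op X)).map f)) (frι_stageSnd x).symm

/-- The deformation of the stage `n` inside the stage `n + 1`: the first component is fixed, the
second is translated in the new coordinate by the height. -/
def stageHomotopy (X Y₁ Y₂ : Sm k) (n : ℕ) :
    (stage X Y₁ Y₂ n : SSet) ⊗ Δ[1] ⟶ (stage X Y₁ Y₂ (n + 1) : SSet) where
  app m := ↾(fun p => ⟨(p.1.1.1, (frι (n + 1) Y₂.obj).app _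
      (FrSet.slide (height X p.2) (stageSnd p.1))), by
    obtain ⟨a₁, a₂, h₁, h₂⟩ := p.1.2
    exact ⟨_, _, (frι_postcomp_sigma _ a₁).trans h₁, rfl⟩⟩)
  naturality m m' f := by
    ext p
    apply Subtype.ext
    refine Prod.ext rfl ?_
    refine Eq.trans ?_ (ConcreteCategory.congr_hom ((frι (n + 1) Y₂.obj).naturality _) _)
    refine congrArg ((frι (n + 1) Y₂.obj).app _) ?_
    refine Eq.trans ?_ (map_slide _ _ _).symm
    rw [← height_map, ← stageSnd_map]
    rfl

/-- The additivity map at `X`, with values in the product of simplicial sets. -/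
def toPairs (X Y₁ Y₂ : Sm k) :
    (Cstar (Fr (disj Y₁.obj Y₂.obj))).obj (op X) ⟶ pairs X Y₁ Y₂ :=
  CartesianMonoidalCategory.lift
    ((Cstar.map (Fr.map (projLeft Y₁.obj Y₂.obj))).app (op X))
    ((Cstar.map (Fr.map (projRight Y₁.obj Y₂.obj))).app (op X))

lemma toPairs_injective (m : SimplexCategoryᵒᵖ) :
    Function.Injective ((toPairs X Y₁ Y₂).app m) := fun _ _ h =>
  eq_of_frMap_proj ((prodSimplex.obj (op X)).obj m) (congrArg Prod.fst h) (congrArg Prod.snd h)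

instance : Mono (toPairs X Y₁ Y₂) := by
  rw [NatTrans.mono_iff_mono_app]
  exact fun m => (mono_iff_injective _).2 (toPairs_injective m)

/-- The image of the additivity map consists of the pairs with disjoint supports. -/
lemma mem_range_toPairs {n : ℕ} {m : SimplexCategoryᵒᵖ}
    (a₁ : (frLevel n Y₁.obj).obj ((prodSimplex.obj (op X)).obj m))
    (a₂ : (frLevel n Y₂.obj).obj ((prodSimplex.obj (op X)).obj m)) (b : (pairs X Y₁ Y₂).obj m)
    (h₁ : (frι n Y₁.obj).app _ a₁ = b.1) (h₂ : (frι n Y₂.obj).app _ a₂ = b.2) :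
    b ∈ (SSet.Subcomplex.range (toPairs X Y₁ Y₂)).obj m ↔ FrSet.DisjointSupp a₁ a₂ := by
  rw [disjointSupp_iff_stable, h₁, h₂]
  constructor
  · rintro ⟨x, rfl⟩
    exact ⟨x, rfl, rfl⟩
  · rintro ⟨x, e₁, e₂⟩
    exact ⟨x, Prod.ext e₁ e₂⟩

/-- The filtration of `C_*Fr(X, Y₁) × C_*Fr(X, Y₂)` by the level, with the deformations into
`C_*Fr(X, Y₁ ⊔ Y₂)`. -/
def levelFiltration (X Y₁ Y₂ : Sm k) :
    DeformingFiltration (SSet.Subcomplex.range (toPairs X Y₁ Y₂)) where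
  F := stage X Y₁ Y₂
  le_succ n m := by
    rintro b ⟨a₁, a₂, h₁, h₂⟩
    exact ⟨_, _, (frι_postcomp_sigma _ a₁).trans h₁, (frι_postcomp_sigma _ a₂).trans h₂⟩
  exhaustive m b := by
    obtain ⟨n, a₁, a₂, h₁, h₂⟩ := exists_frι_pair _ b.1 b.2
    exact ⟨n, a₁, a₂, h₁, h₂⟩
  H := stageHomotopy X Y₁ Y₂
  H_zero n m x := by
    refine Prod.ext rfl ?_
    change (frι (n + 1) Y₂.obj).app _ (FrSet.slide (height X (vtx 0 m)) (stageSnd x)) = _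
    rw [height_vtx_zero]
    exact (congrArg _ (slide_zero _)).trans ((frι_postcomp_sigma _ _).trans (frι_stageSnd x))
  H_one n m x := by
    obtain ⟨a₁, a₂, h₁, h₂⟩ := x.2
    refine (mem_range_toPairs (n := n + 1) _ (FrSet.slide (height X (vtx 1 m)) (stageSnd x))
      ((stageHomotopy X Y₁ Y₂ n).app m (x, vtx 1 m)).1
      ((frι_postcomp_sigma _ a₁).trans h₁) rfl).2 ?_
    rw [height_vtx_one]
    exact disjointSupp_postcomp_slide_one _ _
  H_mem n m x t hx := by
    obtain ⟨a₁, a₂, h₁, h₂⟩ := x.2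
    refine (mem_range_toPairs (n := n + 1) _ (FrSet.slide (height X t) (stageSnd x))
      ((stageHomotopy X Y₁ Y₂ n).app m (x, t)).1
      ((frι_postcomp_sigma _ a₁).trans h₁) rfl).2 ?_
    exact disjointSupp_postcomp_slide _ _ _
      ((mem_range_toPairs _ _ _ h₁ (frι_stageSnd x)).1 hx)

/-- Products of simplicial presheaves are computed schemewise. -/
lemma isIso_lift_prod (F G : (Sm k)ᵒᵖ ⥤ SSet.{u + 1}) (X : (Sm k)ᵒᵖ) :
    IsIso (CartesianMonoidalCategory.lift ((prod.fst : F ⨯ G ⟶ F).app X)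
      ((prod.snd : F ⨯ G ⟶ G).app X)) := by
  have h := mapIsLimitOfPreservesOfIsLimit ((evaluation (Sm k)ᵒᵖ SSet.{u + 1}).obj X)
    (prod.fst : F ⨯ G ⟶ F) (prod.snd : F ⨯ G ⟶ G) (prodIsProd F G)
  obtain ⟨l, l₁, l₂⟩ := BinaryFan.IsLimit.lift' h
    (SemiCartesianMonoidalCategory.fst (F.obj X) (G.obj X))
    (SemiCartesianMonoidalCategory.snd (F.obj X) (G.obj X))
  refine ⟨l, BinaryFan.IsLimit.hom_ext h ?_ ?_, CartesianMonoidalCategory.hom_ext _ _ ?_ ?_⟩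
  · refine (Category.assoc _ _ _).trans ((congrArg _ l₁).trans ?_)
    exact (CartesianMonoidalCategory.lift_fst _ _).trans (Category.id_comp _).symm
  · refine (Category.assoc _ _ _).trans ((congrArg _ l₂).trans ?_)
    exact (CartesianMonoidalCategory.lift_snd _ _).trans (Category.id_comp _).symm
  · rw [Category.assoc, CartesianMonoidalCategory.lift_fst, Category.id_comp]
    exact l₁
  · rw [Category.assoc, CartesianMonoidalCategory.lift_snd, Category.id_comp]
    exact l₂

end additivity

end Framed

end

theorem mainTheorem7 (k : Type u) [Field k] (Y₁ Y₂ : Framed.Sm k) :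
    Framed.IsSchemewiseWeakEquiv (Framed.additivityMap Y₁ Y₂) := by
  intro X
  have := Framed.isIso_lift_prod (Framed.Cstar (Framed.Fr Y₁.obj)) (Framed.Cstar (Framed.Fr Y₂.obj))
    (op X)
  have h : (Framed.additivityMap Y₁ Y₂).app (op X) = Framed.toPairs X Y₁ Y₂ ≫
      inv (CartesianMonoidalCategory.lift
        ((prod.fst : Framed.Cstar (Framed.Fr Y₁.obj) ⨯ Framed.Cstar (Framed.Fr Y₂.obj) ⟶ _).app
          (op X)) ((prod.snd : _ ⨯ Framed.Cstar (Framed.Fr Y₂.obj) ⟶ _).app (op X))) := by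
    rw [IsIso.eq_comp_inv, CartesianMonoidalCategory.comp_lift, ← NatTrans.comp_app,
      ← NatTrans.comp_app, Framed.additivityMap, prod.lift_fst, prod.lift_snd]
    rfl
  rw [h]
  exact (Framed.levelFiltration X Y₁ Y₂).isWeakEquiv.comp (Framed.IsWeakEquiv.of_isIso _)
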